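/- Let $u$ be the Hastings--McLeod solution of Painlevé II, i.e. $u''=tu+2u^3$ on $\mathbb R$ with $u(t)\sim\mathrm{Ai}(t)$ as $t\to+\infty$ and $u(t)\sim\sqrt{-t/2}$ as $t\to-\infty$. Consider real solutions, defined and differentiable on a neighbourhood of $t=+\infty$, of $$q_2'=\tfrac23\alpha q_2+\tfrac{u'}{u}\tfrac{(1+q_2)(2-q_2)}{3},\qquad \alpha'=\alpha\Big(\tfrac23\alpha+\tfrac{u'}{u}\tfrac{2-q_2}{3}\Big)-\tfrac t6(1+q_2)-\tfrac{u^2}{3}(3+q_2),\tag{1}$$ or, equivalently with $\tilde q_2=1+q_2$, of $$\tilde q_2'=\tfrac23(\tilde q_2-1)\alpha+\tfrac{u'}{u}\tfrac{3-\tilde q_2}{3}\tilde q_2,\qquad \alpha'=\Big(\tfrac23\alpha+\tfrac{u'}{u}\tfrac{3-\tilde q_2}{3}\Big)\alpha-\tfrac t6\tilde q_2-\tfrac{2+\tilde q_2}{3}u^2.\tag{2}$$ Write $\hat t=t/3^{2/3}$, $\hat s=s/3^{2/3}$, $\int_\infty^t=-\int_t^\infty$, and $$J(t)=\int_\infty^t\Big(\tfrac13\mathrm{Ai}'(s)\mathrm{Bi}(\hat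 s)+\tfrac1{3^{2/3}}\mathrm{Ai}(s)\mathrm{Bi}'(\hat s)\Big)ds,\quad \tilde M_2(t)=-\mathrm{Bi}(\hat t)J(t),\quad \tilde N_2(t)=-\mathrm{Bi}'(\hat t)J(t),$$ $$\Phi_{01}^{(0)}(t)=\int_\infty^t\Big(\tfrac13u'(s)\mathrm{Bi}(\hat s)+\tfrac{1}{3^{2/3}}u(s)\mathrm{Bi}'(\hat s)\Big)ds,\quad \Phi_{02}^{(0)}(t)=\int_\infty^t\Big(\tfrac13u'(s)\mathrm{Ai}(\hat s)+\tfrac{1}{3^{2/3}}u(s)\mathrm{Ai}'(\hat s)\Big)ds,\quad R=\Phi_{02}^{(0)}/\Phi_{01}^{(0)}.$$ (i) Every solution $(\tilde q_2,\alpha)$ of (2) near $t=+\infty$ belongs to one of the following three classes (all limits and asymptotics are for $t\to+\infty$). Class A: $\tilde q_2\to0$, $\alpha\to0$, and for some real $c_1,c_2$ $$\tilde q_2=\mathrm{Ai}(t)\big[c_1\mathrm{Bi}(\hat t)+c_2\mathrm{Ai}(\hat t)+c_1^2\tilde M_2(t)\big]+o\big(e^{-\frac43t^{3/2}}\big),$$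 $$\alpha=-\tfrac{3^{1/3}}2\mathrm{Ai}(t)\big[c_1\mathrm{Bi}'(\hat t)+c_2\mathrm{Ai}'(\hat t)+c_1^2\tilde N_2(t)\big]+o\big(e^{-\frac43t^{3/2}}\big).\tag{3}$$ Class B: $\tilde q_2\to+\infty$, $\alpha\to-\infty$, and for some real $c_2$ $$\tilde q_2=\big[\mathrm{Bi}(\hat t)+c_2\big(\mathrm{Ai}(\hat t)-\mathrm{Bi}(\hat t)R\big)\big]\frac{\mathrm{Ai}(t)}{\Phi_{01}^{(0)}}+O\big(t^{9/2}e^{-\frac89t^{3/2}}\big),$$ $$\alpha=-\tfrac{3^{1/3}}2\big[\mathrm{Bi}'(\hat t)+c_2\big(\mathrm{Ai}'(\hat t)-\mathrm{Bi}'(\hat t)R\big)\big]\frac{\mathrm{Ai}(t)}{\Phi_{01}^{(0)}}+O\big(t^{5}e^{-\frac89t^{3/2}}\big);$$ moreover both error terms become $o\big(e^{-\frac89t^{3/2}}\big)$ when the term $-c_2^2R\big(\mathrm{Ai}(\hat t)-\mathrm{Bi}(\hat t)R\big)$ is added inside the first square bracket and $-c_2^2R\big(\mathrm{Ai}'(\hat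 t)-\mathrm{Bi}'(\hat t)R\big)$ inside the second (with the same $c_2$). Class C: $\tilde q_2\to2$ and $\alpha\sim\sqrt t$; moreover $\alpha-\sqrt t\to0$. (ii) $\tilde M_2(t)=o(\mathrm{Ai}(\hat t))$ and $\tilde N_2(t)=o(\mathrm{Ai}'(\hat t))$. (iii) Every solution $(q_2,\alpha)$ of (1) near $t=+\infty$ with $q_2\to-1$ and $\alpha\to0$ is of class A (with $\tilde q_2=1+q_2$), and (3) holds for exactly one pair $(c_1,c_2)\in\mathbb R^2$. Conversely every $(c_1,c_2)\in\mathbb R^2$ occurs for such a solution, and two solutions satisfying (3) with the same $(c_1,c_2)$ coincide near $t=+\infty$. If $c_1=c_2=0$, then $$q_2+1=\frac{4\pi}{3^{4/3}}\mathrm{Ai}(t)\Big[\mathrm{Bi}(\hat t)\int_\infty^t\mathrm{Ai}(s)\mathrm{Ai}(\hat s)ds-\mathrm{Ai}(\hat t)\int_\infty^t\mathrm{Ai}(s)\mathrm{Bi}(\hat s)ds\Big]+o\big(e^{-\frac83t^{3/2}}\big),$$ $$\alpha=\frac{2\pi}{3}\mathrm{Ai}(t)\Big[\mathrm{Ai}'(\hat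 t)\int_\infty^t\mathrm{Ai}(s)\mathrm{Bi}(\hat s)ds-\mathrm{Bi}'(\hat t)\int_\infty^t\mathrm{Ai}(s)\mathrm{Ai}(\hat s)ds\Big]+o\big(\sqrt t\,e^{-\frac83t^{3/2}}\big).$$ -/

import Mathlib

open Filter Topology Asymptotics MeasureTheory Set

noncomputable section

/-- The ray integral `∫ exp (z³/3 - x z) dz` over the ray from `0` to `∞ · e^{iπ/3}`,
parametrised by `z = r e^{iπ/3}` (so that `z³ = -r³`). It converges absolutely for every real `x`. -/
def airyRay (x : ℝ) : ℂ :=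
  Complex.exp (Real.pi * Complex.I / 3) *
    ∫ r in Ioi (0 : ℝ),
      Complex.exp (-(r : ℂ) ^ 3 / 3 - x * r * Complex.exp (Real.pi * Complex.I / 3))

/-- The Airy function `Ai` on the real line:
`Ai x = (2πi)⁻¹ ∫ exp (z³/3 - x z) dz` along the contour from `∞ e^{-iπ/3}` to `∞ e^{iπ/3}`. The
two halves of the contour (through `0`) are complex conjugate to each other. -/
def airyAi (x : ℝ) : ℝ := (airyRay x).im / Real.pi

/-- The Airy function `Bi` on the real line:
`Bi x = (2π)⁻¹ (∫ + ∫) exp (z³/3 - x z) dz` along the two contours from `-∞` to `∞ e^{± iπ/3}`. -/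
def airyBi (x : ℝ) : ℝ :=
  ((∫ r in Ioi (0 : ℝ), Real.exp (-r ^ 3 / 3 + x * r)) + (airyRay x).re) / Real.pi

/-- `u` is the Hastings-McLeod solution of the Painlevé II equation `u'' = t u + 2 u³`. -/
structure IsHastingsMcLeod (u : ℝ → ℝ) : Prop where
  contDiff : ContDiff ℝ 2 u
  painleve : ∀ t, deriv (deriv u) t = t * u t + 2 * u t ^ 3
  atTop : u ~[atTop] airyAi
  atBot : u ~[atBot] fun t => Real.sqrt (-t / 2)

/-- `(q₂, α)` is a (real) solution of the `(q₂, α)` system on a neighbourhood of `t = +∞`. -/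
def SolvesSystem (u q₂ α : ℝ → ℝ) : Prop :=
  ∀ᶠ t in atTop,
    HasDerivAt q₂
      (2 / 3 * α t * q₂ t + deriv u t / u t * ((1 + q₂ t) * (2 - q₂ t) / 3)) t ∧
    HasDerivAt α
      (α t * (2 / 3 * α t + deriv u t / u t * ((2 - q₂ t) / 3)) - t / 6 * (1 + q₂ t)
        - u t ^ 2 / 3 * (3 + q₂ t)) t

/-- `(q, α)`, with `q = 1 + q₂`, is a (real) solution of the shifted system on a neighbourhood of
`t = +∞`. -/
def SolvesShiftedSystem (u q α : ℝ → ℝ) : Prop :=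
  ∀ᶠ t in atTop,
    HasDerivAt q
      (2 / 3 * (q t - 1) * α t + deriv u t / u t * ((3 - q t) / 3) * q t) t ∧
    HasDerivAt α
      ((2 / 3 * α t + deriv u t / u t * ((3 - q t) / 3)) * α t - t / 6 * q t
        - (2 + q t) / 3 * u t ^ 2) t

/-- `∫_∞^t f(s) ds`. -/
def intFromTop (f : ℝ → ℝ) (t : ℝ) : ℝ := -∫ s in Ioi t, f s

/-- `Ai(t / 3^{2/3})`. -/
def scAi (t : ℝ) : ℝ := airyAi (t / (3 : ℝ) ^ (2 / 3 : ℝ))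

/-- `Bi(t / 3^{2/3})`. -/
def scBi (t : ℝ) : ℝ := airyBi (t / (3 : ℝ) ^ (2 / 3 : ℝ))

/-- `Ai'(t / 3^{2/3})`: the derivative of `Ai`, evaluated at `t / 3^{2/3}`. -/
def scAi' (t : ℝ) : ℝ := deriv airyAi (t / (3 : ℝ) ^ (2 / 3 : ℝ))

/-- `Bi'(t / 3^{2/3})`: the derivative of `Bi`, evaluated at `t / 3^{2/3}`. -/
def scBi' (t : ℝ) : ℝ := deriv airyBi (t / (3 : ℝ) ^ (2 / 3 : ℝ))

/-- The factor `∫_∞^t (Ai'(s) Bi(s/3^{2/3}) / 3 + Ai(s) Bi'(s/3^{2/3}) / 3^{2/3}) ds`. -/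
def airyMixedInt (t : ℝ) : ℝ :=
  intFromTop (fun s => 1 / 3 * deriv airyAi s * scBi s
    + 1 / (3 : ℝ) ^ (2 / 3 : ℝ) * airyAi s * scBi' s) t

/-- The function `M̃₂`. -/
def tildeM (t : ℝ) : ℝ := -scBi t * airyMixedInt t

/-- The function `Ñ₂`. -/
def tildeN (t : ℝ) : ℝ := -scBi' t * airyMixedInt t

/-- `Φ₀₁⁽⁰⁾(t) = ∫_∞^t (u' g₁ / 3 + u g₁') ds` with `g₁(s) = Bi(s/3^{2/3})`. -/
def Phi01 (u : ℝ → ℝ) (t : ℝ) : ℝ :=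
  intFromTop (fun s => 1 / 3 * deriv u s * scBi s
    + 1 / (3 : ℝ) ^ (2 / 3 : ℝ) * u s * scBi' s) t

/-- `Φ₀₂⁽⁰⁾(t) = ∫_∞^t (u' g₂ / 3 + u g₂') ds` with `g₂(s) = Ai(s/3^{2/3})`. -/
def Phi02 (u : ℝ → ℝ) (t : ℝ) : ℝ :=
  intFromTop (fun s => 1 / 3 * deriv u s * scAi s
    + 1 / (3 : ℝ) ^ (2 / 3 : ℝ) * u s * scAi' s) t

/-- The Class A expansion of `(q, α)`, `q = 1 + q₂`, with parameters `(c₁, c₂)`. -/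
def ExpansionA (c₁ c₂ : ℝ) (q α : ℝ → ℝ) : Prop :=
  ((fun t => q t - airyAi t * (c₁ * scBi t + c₂ * scAi t + c₁ ^ 2 * tildeM t))
    =o[atTop] fun t : ℝ => Real.exp (-(4 / 3) * t ^ (3 / 2 : ℝ))) ∧
  ((fun t => α t - -((3 : ℝ) ^ (1 / 3 : ℝ) / 2) * airyAi t *
      (c₁ * scBi' t + c₂ * scAi' t + c₁ ^ 2 * tildeN t))
    =o[atTop] fun t : ℝ => Real.exp (-(4 / 3) * t ^ (3 / 2 : ℝ)))

/-- Class A. -/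
def ClassA (q α : ℝ → ℝ) : Prop :=
  Tendsto q atTop (𝓝 0) ∧ Tendsto α atTop (𝓝 0) ∧ ∃ c₁ c₂ : ℝ, ExpansionA c₁ c₂ q α

/-- The Class B approximation of `q`, up to first order in the parameter `c₂`. -/
def mainBq (u : ℝ → ℝ) (c₂ t : ℝ) : ℝ :=
  (scBi t + c₂ * (scAi t - scBi t * (Phi02 u t / Phi01 u t))) * (airyAi t / Phi01 u t)

/-- The Class B approximation of `α`, up to first order in the parameter `c₂`. -/
def mainBα (u : ℝ → ℝ) (c₂ t : ℝ) : ℝ :=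
  -((3 : ℝ) ^ (1 / 3 : ℝ) / 2) *
    (scBi' t + c₂ * (scAi' t - scBi' t * (Phi02 u t / Phi01 u t))) * (airyAi t / Phi01 u t)

/-- The second order (in `c₂`) correction to `mainBq`. -/
def corrBq (u : ℝ → ℝ) (c₂ t : ℝ) : ℝ :=
  -c₂ ^ 2 * (Phi02 u t / Phi01 u t) *
    (scAi t - scBi t * (Phi02 u t / Phi01 u t)) * (airyAi t / Phi01 u t)

/-- The second order (in `c₂`) correction to `mainBα`. -/
def corrBα (u : ℝ → ℝ) (c₂ t : ℝ) : ℝ :=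
  (3 : ℝ) ^ (1 / 3 : ℝ) / 2 * c₂ ^ 2 * (Phi02 u t / Phi01 u t) *
    (scAi' t - scBi' t * (Phi02 u t / Phi01 u t)) * (airyAi t / Phi01 u t)

/-- The Class B expansion of `(q, α)` with parameter `c₂`: with the first order approximation, and
with the second order correction included. -/
def ExpansionB (u : ℝ → ℝ) (c₂ : ℝ) (q α : ℝ → ℝ) : Prop :=
  ((fun t => q t - mainBq u c₂ t)
    =O[atTop] fun t : ℝ => t ^ (9 / 2 : ℝ) * Real.exp (-(8 / 9) * t ^ (3 / 2 : ℝ))) ∧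
  ((fun t => α t - mainBα u c₂ t)
    =O[atTop] fun t : ℝ => t ^ 5 * Real.exp (-(8 / 9) * t ^ (3 / 2 : ℝ))) ∧
  ((fun t => q t - (mainBq u c₂ t + corrBq u c₂ t))
    =o[atTop] fun t : ℝ => Real.exp (-(8 / 9) * t ^ (3 / 2 : ℝ))) ∧
  ((fun t => α t - (mainBα u c₂ t + corrBα u c₂ t))
    =o[atTop] fun t : ℝ => Real.exp (-(8 / 9) * t ^ (3 / 2 : ℝ)))

/-- Class B. -/
def ClassB (u q α : ℝ → ℝ) : Prop :=
  Tendsto q atTop atTop ∧ Tendsto α atTop atBot ∧ ∃ c₂ : ℝ, ExpansionB u c₂ q α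

/-- Class C: `q → 2` and `α → √t`, both as `α ~ √t` and as `α - √t → 0`. -/
def ClassC (q α : ℝ → ℝ) : Prop :=
  Tendsto q atTop (𝓝 2) ∧ (α ~[atTop] fun t => Real.sqrt t) ∧
    Tendsto (fun t => α t - Real.sqrt t) atTop (𝓝 0)

/-- The leading terms of `(q, α)`, `q = 1 + q₂`, when `c₁ = c₂ = 0`. -/
def LeadingZero (q α : ℝ → ℝ) : Prop :=
  ((fun t => q t - 4 * Real.pi / (3 : ℝ) ^ (4 / 3 : ℝ) * airyAi t *
      (scBi t * intFromTop (fun s => airyAi s * scAi s) t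
        - scAi t * intFromTop (fun s => airyAi s * scBi s) t))
    =o[atTop] fun t : ℝ => Real.exp (-(8 / 3) * t ^ (3 / 2 : ℝ))) ∧
  ((fun t => α t - 2 * Real.pi / 3 * airyAi t *
      (scAi' t * intFromTop (fun s => airyAi s * scBi s) t
        - scBi' t * intFromTop (fun s => airyAi s * scAi s) t))
    =o[atTop] fun t : ℝ => Real.sqrt t * Real.exp (-(8 / 3) * t ^ (3 / 2 : ℝ)))

end

open Filter Topology Asymptotics MeasureTheory Set

noncomputable section

/-! The system is a Riccati system, the projectivisation of a linear system of order three. With q =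
u x / W, α = -(3/2) u x' / W and W' = u x' + u' x / 3, it becomes x'' = (t/9 + (2/9) u²) x + (4/9) u
W. Conversely W is recovered from (q, α) by integrating its logarithmic derivative, so every
solution arises in this way. Variation of constants, x = ξ₁ Bi(t̂) + ξ₂ Ai(t̂) and x' = ξ₁ Bi(t̂)' +
ξ₂ Ai(t̂)', turns this into a linear system `LinSol` for (ξ₁, ξ₂, W). Its coefficients are
O(exp(-(4/9) t^{3/2})), because u decays like Ai(t), faster than Bi(t̂) grows.

Consequently every solution has a limit (c₁, c₂, c₀) at infinity, the limit determines the solution,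
and every limit occurs: a two-sided Grönwall estimate gives the first two facts, and the change of
variable τ = 1/t, which makes infinity an ordinary initial point, gives the third
(`exists_solvesLinear`). Only the limit up to a common factor matters for (q, α). The strata c₀ ≠ 0,
then c₀ = 0 ≠ c₁, then c₀ = c₁ = 0 ≠ c₂ are the classes A, B and C. The expansions follow on
substituting the limits back into the linear system and expanding 1/W (`LinSol.isOG_expansionA`,
`LinSol.isOG_leadingZero`, `LinSol.isOG_expansionB`, `Represents.classC`).

All errors are measured by t^k exp(-(2/9) m t^{3/2}). The functions Ai(t), Ai(t̂), Bi(t̂) have rates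
m = 3, 1, -1; products add exponents, and for m > 0 integration from infinity keeps m and gains
t^{-1/2}. The sizes and logarithmic derivatives of the Airy functions come from a WKB comparison
(`IsWKB`), and u is compared with Ai through their Wronskian. -/

/-! ### Airy functions from their integral representations -/

/-- The moments `∫ rⁿ exp (-r³/3 + x r ζ) dr` over `(0, ∞)`. -/
def airyMoment (ζ : ℂ) (n : ℕ) (x : ℝ) : ℂ :=
  ∫ r in Ioi (0 : ℝ), (r : ℂ) ^ n * Complex.exp (-(r : ℂ) ^ 3 / 3 + x * r * ζ)

/-- Beyond r = c + 4 the cubic alone beats (c + 1) r; before it, (c + 4)² does. This yields a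
dominating function e^{-r} that is locally uniform in x. -/
lemma cubic_exponent_le {c r : ℝ} (hc : 0 ≤ c) (hr : 0 ≤ r) :
    -r ^ 3 / 3 + c * r ≤ (c + 4) ^ 2 - r := by
  rcases le_total r (c + 4) with h | h
  · nlinarith [pow_nonneg hr 3]
  · nlinarith [mul_nonneg hr (sub_nonneg.2 h), mul_nonneg (mul_nonneg hr hr) (sub_nonneg.2 h),
      mul_nonneg hr hc, mul_nonneg (mul_nonneg hr hc) (sub_nonneg.2 h)]

lemma norm_airyMoment_integrand_le {ζ : ℂ} (hζ : ‖ζ‖ ≤ 1) (n : ℕ) {x c r : ℝ} (hx : |x| ≤ c)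
    (hr : 0 ≤ r) :
    ‖(r : ℂ) ^ n * Complex.exp (-(r : ℂ) ^ 3 / 3 + x * r * ζ)‖ ≤
      Real.exp ((c + 4) ^ 2) * (Real.exp (-r) * r ^ n) := by
  have hc : 0 ≤ c := (abs_nonneg x).trans hx
  have e1 : (-(r : ℂ) ^ 3 / 3 + x * r * ζ).re = -r ^ 3 / 3 + x * r * ζ.re := by
    have : (-(r : ℂ) ^ 3 / 3 + x * r * ζ) = ((-r ^ 3 / 3 : ℝ) : ℂ) + ((x * r : ℝ) : ℂ) * ζ := by
      push_cast; ring
    rw [this, Complex.add_re, Complex.re_ofReal_mul, Complex.ofReal_re]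
  have e2 : x * r * ζ.re ≤ c * r := by
    have h1 : |ζ.re| ≤ 1 := (Complex.abs_re_le_norm ζ).trans hζ
    calc x * r * ζ.re ≤ |x * r * ζ.re| := le_abs_self _
      _ = |x| * r * |ζ.re| := by rw [abs_mul, abs_mul, abs_of_nonneg hr]
      _ ≤ c * r * 1 := by gcongr
      _ = c * r := mul_one _
  rw [norm_mul, norm_pow, Complex.norm_exp, Complex.norm_real, Real.norm_of_nonneg hr, e1]
  have h3 := cubic_exponent_le hc hr
  have : Real.exp (-r ^ 3 / 3 + x * r * ζ.re) ≤ Real.exp ((c + 4) ^ 2) * Real.exp (-r) := by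
    rw [← Real.exp_add]; apply Real.exp_le_exp.2; linarith
  calc _ ≤ r ^ n * (Real.exp ((c + 4) ^ 2) * Real.exp (-r)) := by gcongr
    _ = _ := by ring

lemma integrableOn_exp_neg_mul_pow (n : ℕ) :
    IntegrableOn (fun r : ℝ => Real.exp (-r) * r ^ n) (Ioi 0) := by
  have h := Real.GammaIntegral_convergent (s := n + 1) (by positivity)
  simpa using h

lemma integrable_airyMoment_integrand {ζ : ℂ} (hζ : ‖ζ‖ ≤ 1) (n : ℕ) (x : ℝ) :
    IntegrableOn (fun r : ℝ => (r : ℂ) ^ n * Complex.exp (-(r : ℂ) ^ 3 / 3 + x * r * ζ))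
      (Ioi 0) := by
  refine Integrable.mono' ((integrableOn_exp_neg_mul_pow n).const_mul (Real.exp ((|x| + 4) ^ 2)))
    (Continuous.aestronglyMeasurable (by fun_prop)) ?_
  filter_upwards [ae_restrict_mem measurableSet_Ioi] with r hr
  exact norm_airyMoment_integrand_le hζ n le_rfl (le_of_lt hr)

lemma hasDerivAt_airyMoment {ζ : ℂ} (hζ : ‖ζ‖ ≤ 1) (n : ℕ) (x : ℝ) :
    HasDerivAt (airyMoment ζ n) (ζ * airyMoment ζ (n + 1) x) x := by
  have key := hasDerivAt_integral_of_dominated_loc_of_deriv_le (μ := volume.restrict (Ioi (0 : ℝ)))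
    (F := fun (x : ℝ) (r : ℝ) => (r : ℂ) ^ n * Complex.exp (-(r : ℂ) ^ 3 / 3 + x * r * ζ))
    (F' := fun (x : ℝ) (r : ℝ) =>
      ζ * ((r : ℂ) ^ (n + 1) * Complex.exp (-(r : ℂ) ^ 3 / 3 + x * r * ζ)))
    (x₀ := x) (s := Metric.ball x 1)
    (bound := fun r => Real.exp ((|x| + 1 + 4) ^ 2) * (Real.exp (-r) * r ^ (n + 1)))
    (Metric.ball_mem_nhds x one_pos)
    (Eventually.of_forall fun y => Continuous.aestronglyMeasurable (by fun_prop))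
    (integrable_airyMoment_integrand hζ n x)
    (Continuous.aestronglyMeasurable (by fun_prop))
    ?_ ((integrableOn_exp_neg_mul_pow (n + 1)).const_mul _) ?_
  · have h2 := key.2
    rw [integral_const_mul] at h2
    exact h2
  · filter_upwards [ae_restrict_mem measurableSet_Ioi] with r hr y hy
    have hy' : |y| ≤ |x| + 1 := by
      have h1 : |y - x| < 1 := by simpa [Real.dist_eq] using hy
      have := abs_add_le (y - x) x
      rw [sub_add_cancel] at this
      linarith
    rw [norm_mul]
    calc _ ≤ 1 * ‖(r : ℂ) ^ (n + 1) * Complex.exp (-(r : ℂ) ^ 3 / 3 + y * r * ζ)‖ := by gcongr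
      _ ≤ _ := by
        rw [one_mul]
        exact norm_airyMoment_integrand_le hζ (n + 1) hy' (le_of_lt hr)
  · filter_upwards with r y _
    have h1 : HasDerivAt (fun y : ℝ => (-(r : ℂ) ^ 3 / 3 + y * r * ζ)) (1 * r * ζ) y :=
      (((Complex.ofRealCLM.hasDerivAt (x := y)).mul_const (r : ℂ)).mul_const ζ).const_add _
    have h2 := (h1.cexp).const_mul ((r : ℂ) ^ n)
    refine h2.congr_deriv ?_
    ring

/-- Integration of a total derivative in r. The boundary value at r = 0 leaves an inhomogeneous term
on each ray, which is real and so disappears from Ai, and cancels between the two rays that make up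
Bi. -/
lemma airyMoment_two {ζ : ℂ} (hζ : ‖ζ‖ ≤ 1) (x : ℝ) :
    airyMoment ζ 2 x = x * ζ * airyMoment ζ 0 x + 1 := by
  have hd : ∀ r ∈ Ici (0 : ℝ), HasDerivAt
      (fun r : ℝ => Complex.exp (-(r : ℂ) ^ 3 / 3 + x * r * ζ))
      (-((r : ℂ) ^ 2 * Complex.exp (-(r : ℂ) ^ 3 / 3 + x * r * ζ)) +
        x * ζ * ((r : ℂ) ^ 0 * Complex.exp (-(r : ℂ) ^ 3 / 3 + x * r * ζ))) r := by
    intro r _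
    have h0 : HasDerivAt (fun r : ℝ => (r : ℂ)) 1 r := Complex.ofRealCLM.hasDerivAt
    have h1 : HasDerivAt (fun r : ℝ => (-(r : ℂ) ^ 3 / 3 + x * r * ζ))
        (-(((3 : ℕ) : ℂ) * (r : ℂ) ^ 2 * 1) / 3 + x * 1 * ζ) r :=
      ((h0.pow 3).neg.div_const 3).add ((h0.const_mul (x : ℂ)).mul_const ζ)
    convert h1.cexp using 1
    push_cast
    ring
  have hi2 := integrable_airyMoment_integrand hζ 2 x
  have hi0 := (integrable_airyMoment_integrand hζ 0 x).const_mul (x * ζ : ℂ)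
  have ht : Tendsto (fun r : ℝ => Complex.exp (-(r : ℂ) ^ 3 / 3 + x * r * ζ)) atTop (𝓝 0) := by
    rw [tendsto_zero_iff_norm_tendsto_zero]
    refine squeeze_zero' (Eventually.of_forall fun _ => norm_nonneg _)
      (g := fun r => Real.exp ((|x| + 4) ^ 2) * (Real.exp (-r) * r ^ 0)) ?_ ?_
    · filter_upwards [eventually_ge_atTop 0] with r hr
      simpa using norm_airyMoment_integrand_le hζ 0 (le_refl |x|) hr
    · simpa using (Real.tendsto_exp_neg_atTop_nhds_zero).const_mul (Real.exp ((|x| + 4) ^ 2))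
  have h := integral_Ioi_of_hasDerivAt_of_tendsto' hd (hi2.neg.add hi0) ht
  have e : (∫ r in Ioi (0 : ℝ), (-((r : ℂ) ^ 2 * Complex.exp (-(r : ℂ) ^ 3 / 3 + x * r * ζ)) +
        x * ζ * ((r : ℂ) ^ 0 * Complex.exp (-(r : ℂ) ^ 3 / 3 + x * r * ζ)))) =
      -airyMoment ζ 2 x + x * ζ * airyMoment ζ 0 x := by
    have e1 := integral_add hi2.neg hi0
    simp only [Pi.neg_apply, integral_neg, integral_const_mul] at e1
    exact e1
  rw [e] at h
  have h' : -airyMoment ζ 2 x + x * ζ * airyMoment ζ 0 x = -1 := by simpa using h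
  linear_combination -h'

/-- The direction of the ray defining `airyRay`. -/
def airyDir : ℂ := Complex.exp (Real.pi * Complex.I / 3)

lemma airyDir_eq : airyDir = ⟨1 / 2, Real.sqrt 3 / 2⟩ := by
  have h : airyDir = Complex.exp ((Real.pi / 3 : ℝ) * Complex.I) := by
    rw [airyDir]; congr 1; push_cast; ring
  rw [h]
  apply Complex.ext
  · rw [Complex.exp_ofReal_mul_I_re, Real.cos_pi_div_three]
  · rw [Complex.exp_ofReal_mul_I_im, Real.sin_pi_div_three]

lemma airyDir_cube : airyDir ^ 3 = -1 := by
  rw [airyDir, ← Complex.exp_nat_mul, ← Complex.exp_pi_mul_I]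
  congr 1; push_cast; ring

lemma norm_airyDir : ‖airyDir‖ = 1 := by
  have h : airyDir = Complex.exp ((Real.pi / 3 : ℝ) * Complex.I) := by
    rw [airyDir]; congr 1; push_cast; ring
  rw [h, Complex.norm_exp_ofReal_mul_I]

lemma norm_neg_airyDir_le : ‖-airyDir‖ ≤ 1 := by rw [norm_neg, norm_airyDir]

lemma airyRay_eq (x : ℝ) : airyRay x = airyDir * airyMoment (-airyDir) 0 x := by
  unfold airyRay airyMoment airyDir
  congr 1
  refine integral_congr_ae (Eventually.of_forall fun r => ?_)
  simp only [pow_zero, one_mul]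
  congr 1
  ring

/-- The derivative of `airyRay`. -/
def airyRay' (x : ℝ) : ℂ := -airyDir ^ 2 * airyMoment (-airyDir) 1 x

lemma hasDerivAt_airyRay (x : ℝ) : HasDerivAt airyRay (airyRay' x) x := by
  have h := (hasDerivAt_airyMoment norm_neg_airyDir_le 0 x).const_mul airyDir
  rw [funext airyRay_eq]
  refine h.congr_deriv ?_
  rw [airyRay']; ring

lemma hasDerivAt_airyRay' (x : ℝ) : HasDerivAt airyRay' (x * airyRay x - 1) x := by
  have h := (hasDerivAt_airyMoment norm_neg_airyDir_le 1 x).const_mul (-airyDir ^ 2)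
  refine h.congr_deriv ?_
  rw [airyMoment_two norm_neg_airyDir_le, airyRay_eq]
  linear_combination (1 - x * airyDir * airyMoment (-airyDir) 0 x) * airyDir_cube

lemma airyMoment_one_eq (n : ℕ) (x : ℝ) : airyMoment 1 n x =
    ((∫ r in Ioi (0 : ℝ), r ^ n * Real.exp (-r ^ 3 / 3 + x * r) : ℝ) : ℂ) := by
  rw [airyMoment, ← integral_complex_ofReal]
  refine integral_congr_ae (Eventually.of_forall fun r => ?_)
  simp

/-- The derivative of `airyAi`. -/
def airyAi' (x : ℝ) : ℝ := (airyRay' x).im / Real.pi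

/-- The derivative of `airyBi`. -/
def airyBi' (x : ℝ) : ℝ := ((airyMoment 1 1 x).re + (airyRay' x).re) / Real.pi

lemma HasDerivAt.complex_re {f : ℝ → ℂ} {f' : ℂ} {x : ℝ} (h : HasDerivAt f f' x) :
    HasDerivAt (fun t => (f t).re) f'.re x :=
  Complex.reCLM.hasFDerivAt.comp_hasDerivAt x h

lemma HasDerivAt.complex_im {f : ℝ → ℂ} {f' : ℂ} {x : ℝ} (h : HasDerivAt f f' x) :
    HasDerivAt (fun t => (f t).im) f'.im x :=
  Complex.imCLM.hasFDerivAt.comp_hasDerivAt x h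

lemma hasDerivAt_airyAi (x : ℝ) : HasDerivAt airyAi (airyAi' x) x :=
  (hasDerivAt_airyRay x).complex_im.div_const _

lemma hasDerivAt_airyAi' (x : ℝ) : HasDerivAt airyAi' (x * airyAi x) x := by
  refine ((hasDerivAt_airyRay' x).complex_im.div_const Real.pi).congr_deriv ?_
  simp [airyAi, mul_div_assoc]

lemma airyBi_eq (x : ℝ) : airyBi x = ((airyMoment 1 0 x).re + (airyRay x).re) / Real.pi := by
  rw [airyBi, airyMoment_one_eq, Complex.ofReal_re]
  simp

lemma hasDerivAt_airyBi (x : ℝ) : HasDerivAt airyBi (airyBi' x) x := by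
  have h := hasDerivAt_airyMoment (ζ := 1) (by simp) 0 x
  rw [funext airyBi_eq]
  refine ((h.complex_re.add (hasDerivAt_airyRay x).complex_re).div_const Real.pi).congr_deriv ?_
  simp [airyBi']

lemma hasDerivAt_airyBi' (x : ℝ) : HasDerivAt airyBi' (x * airyBi x) x := by
  have h := hasDerivAt_airyMoment (ζ := 1) (by simp) 1 x
  refine ((h.complex_re.add (hasDerivAt_airyRay' x).complex_re).div_const Real.pi).congr_deriv ?_
  rw [airyMoment_two (by simp), airyBi_eq]
  simp
  ring

lemma deriv_airyAi : deriv airyAi = airyAi' := funext fun x => (hasDerivAt_airyAi x).deriv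

lemma deriv_airyBi : deriv airyBi = airyBi' := funext fun x => (hasDerivAt_airyBi x).deriv

lemma integral_exp_neg_cube : ∫ r in Ioi (0 : ℝ), r ^ 0 * Real.exp (-r ^ 3 / 3 + 0 * r) =
    (1 / 3 : ℝ) ^ (-(1 / 3) : ℝ) * (1 / 3) * Real.Gamma (1 / 3) := by
  have h := integral_rpow_mul_exp_neg_mul_rpow (p := 3) (q := 0) (b := 1 / 3) (by norm_num)
    (by norm_num) (by norm_num)
  norm_num at h
  norm_num
  rw [← h]
  refine integral_congr_ae (Eventually.of_forall fun r => ?_)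
  simp only
  congr 1; ring

lemma integral_mul_exp_neg_cube : ∫ r in Ioi (0 : ℝ), r ^ 1 * Real.exp (-r ^ 3 / 3 + 0 * r) =
    (1 / 3 : ℝ) ^ (-(2 / 3) : ℝ) * (1 / 3) * Real.Gamma (2 / 3) := by
  have h := integral_rpow_mul_exp_neg_mul_rpow (p := 3) (q := 1) (b := 1 / 3) (by norm_num)
    (by norm_num) (by norm_num)
  norm_num at h
  norm_num
  rw [← h]
  refine integral_congr_ae (Eventually.of_forall fun r => ?_)
  simp only
  congr 2; ring

lemma airyMoment_zero (ζ : ℂ) (n : ℕ) : airyMoment ζ n 0 = airyMoment 1 n 0 := by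
  simp [airyMoment]

/-- The zeroth moment at `x = 0`. -/
def airyG0 : ℝ := (1 / 3 : ℝ) ^ (-(1 / 3) : ℝ) * (1 / 3) * Real.Gamma (1 / 3)

/-- The first moment at `x = 0`. -/
def airyG1 : ℝ := (1 / 3 : ℝ) ^ (-(2 / 3) : ℝ) * (1 / 3) * Real.Gamma (2 / 3)

lemma airyG0_pos : 0 < airyG0 := by
  have := Real.Gamma_pos_of_pos (s := 1 / 3) (by norm_num)
  unfold airyG0; positivity

lemma airyG1_pos : 0 < airyG1 := by
  have := Real.Gamma_pos_of_pos (s := 2 / 3) (by norm_num)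
  unfold airyG1; positivity

/-- Euler's reflection formula at 1/3. The Wronskian at 0 depends on the two Gamma values only
through this product. -/
lemma airyG0_mul_airyG1 : airyG0 * airyG1 = 2 * Real.pi / (3 * Real.sqrt 3) := by
  have h := Real.Gamma_mul_Gamma_one_sub (1 / 3)
  rw [show Real.pi * (1 / 3) = Real.pi / 3 by ring, Real.sin_pi_div_three,
    show (1 : ℝ) - 1 / 3 = 2 / 3 by norm_num] at h
  have h2 : (1 / 3 : ℝ) ^ (-(1 / 3) : ℝ) * (1 / 3 : ℝ) ^ (-(2 / 3) : ℝ) = 3 := by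
    rw [← Real.rpow_add (by norm_num)]; norm_num [Real.rpow_neg_one]
  have h3 : airyG0 * airyG1 = ((1 / 3 : ℝ) ^ (-(1 / 3) : ℝ) * (1 / 3 : ℝ) ^ (-(2 / 3) : ℝ)) *
      (1 / 9) * (Real.Gamma (1 / 3) * Real.Gamma (2 / 3)) := by
    rw [airyG0, airyG1]; ring
  rw [h3, h2, h]
  field_simp
  norm_num

lemma airyMoment_zero_zero (ζ : ℂ) : airyMoment ζ 0 0 = airyG0 := by
  rw [airyMoment_zero, airyMoment_one_eq, integral_exp_neg_cube, airyG0]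

lemma airyMoment_one_zero (ζ : ℂ) : airyMoment ζ 1 0 = airyG1 := by
  rw [airyMoment_zero, airyMoment_one_eq, integral_mul_exp_neg_cube, airyG1]

lemma airyDir_sq : airyDir ^ 2 = ⟨-1 / 2, Real.sqrt 3 / 2⟩ := by
  rw [airyDir_eq, pow_two]
  have := Real.mul_self_sqrt (show (0 : ℝ) ≤ 3 by norm_num)
  apply Complex.ext
  · simp; nlinarith
  · simp; nlinarith

lemma airyAi_zero : airyAi 0 = Real.sqrt 3 / 2 * airyG0 / Real.pi := by
  rw [airyAi, airyRay_eq, airyMoment_zero_zero, Complex.im_mul_ofReal, airyDir_eq]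

lemma airyAi'_zero : airyAi' 0 = -(Real.sqrt 3 / 2 * airyG1) / Real.pi := by
  rw [airyAi', airyRay', airyMoment_one_zero, Complex.im_mul_ofReal, Complex.neg_im, airyDir_sq]
  simp

lemma airyBi_zero : airyBi 0 = 3 / 2 * airyG0 / Real.pi := by
  rw [airyBi_eq, airyRay_eq, airyMoment_zero_zero, airyMoment_zero_zero, Complex.re_mul_ofReal,
    airyDir_eq, Complex.ofReal_re]
  ring

lemma airyBi'_zero : airyBi' 0 = 3 / 2 * airyG1 / Real.pi := by
  rw [airyBi', airyRay', airyMoment_one_zero, airyMoment_one_zero, Complex.re_mul_ofReal,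
    Complex.neg_re, airyDir_sq, Complex.ofReal_re]
  ring

/-! ### Wronskian, decay and positivity of the Airy functions -/

/-- The Wronskian of `Ai` and `Bi`. -/
lemma airy_wronskian (x : ℝ) :
    airyAi x * airyBi' x - airyAi' x * airyBi x = 1 / Real.pi := by
  have hd : ∀ x, HasDerivAt (fun x => airyAi x * airyBi' x - airyAi' x * airyBi x) 0 x := by
    intro x
    refine (((hasDerivAt_airyAi x).mul (hasDerivAt_airyBi' x)).sub
      ((hasDerivAt_airyAi' x).mul (hasDerivAt_airyBi x))).congr_deriv ?_
    ring
  have h := is_const_of_deriv_eq_zero (fun x => (hd x).differentiableAt)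
    (fun x => (hd x).deriv) x 0
  rw [h, airyAi_zero, airyAi'_zero, airyBi_zero, airyBi'_zero]
  have h1 := airyG0_mul_airyG1
  have h2 : Real.sqrt 3 * (airyG0 * airyG1) * 3 = 2 * Real.pi := by
    rw [h1]; field_simp
  field_simp
  linear_combination 2 * h2

/-- The direction of the ray has real part 1/2, so the integrand is at most exp(-x r / 2) once the
cubic factor is dropped. -/
lemma norm_airyRay_le {x : ℝ} (hx : 0 < x) : ‖airyRay x‖ ≤ 2 / x := by
  rw [airyRay_eq, norm_mul, norm_airyDir, one_mul, airyMoment]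
  have hi : IntegrableOn (fun r : ℝ => Real.exp (-(x / 2) * r)) (Ioi 0) :=
    integrableOn_exp_mul_Ioi (by linarith) 0
  refine (norm_integral_le_of_norm_le hi ?_).trans ?_
  · filter_upwards [ae_restrict_mem measurableSet_Ioi] with r hr
    have hr0 : 0 < r := hr
    rw [pow_zero, one_mul, Complex.norm_exp]
    apply Real.exp_le_exp.2
    have : (-(r : ℂ) ^ 3 / 3 + x * r * -airyDir) =
        ((-r ^ 3 / 3 : ℝ) : ℂ) + ((x * r : ℝ) : ℂ) * -airyDir := by
      push_cast; ring
    rw [this, Complex.add_re, Complex.re_ofReal_mul, Complex.ofReal_re, Complex.neg_re, airyDir_eq]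
    simp only
    have := pow_pos hr0 3
    linarith
  · rw [integral_exp_mul_Ioi (by linarith) 0]
    simp

lemma tendsto_airyAi : Tendsto airyAi atTop (𝓝 0) := by
  have h1 : Tendsto (fun x : ℝ => 2 / x / Real.pi) atTop (𝓝 0) := by
    simpa using (tendsto_const_nhds.div_atTop tendsto_id (a := (2 : ℝ))).div_const Real.pi
  refine squeeze_zero_norm' ?_ h1
  filter_upwards [eventually_gt_atTop 0] with x hx
  rw [airyAi, norm_div, Real.norm_of_nonneg Real.pi_pos.le]
  gcongr
  exact (Complex.abs_im_le_norm _).trans (norm_airyRay_le hx)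

lemma monotoneOn_Ici_of_hasDerivAt {f f' : ℝ → ℝ} {a : ℝ}
    (hf : ∀ x, a ≤ x → HasDerivAt f (f' x) x) (hf' : ∀ x, a ≤ x → 0 ≤ f' x) :
    MonotoneOn f (Ici a) := by
  refine monotoneOn_of_deriv_nonneg (convex_Ici a)
    (fun x hx => (hf x hx).continuousAt.continuousWithinAt)
    (fun x hx => (hf x (interior_subset hx)).differentiableAt.differentiableWithinAt) ?_
  intro x hx
  have hx' : a ≤ x := interior_subset hx
  rw [(hf x hx').deriv]
  exact hf' x hx'

/-- The product Bi Bi' has derivative Bi'² + x Bi² ≥ 0 and is positive at 0, so neither factor can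
vanish on the half-line. -/
lemma airyBi_pos_and_airyBi'_pos {x : ℝ} (hx : 0 ≤ x) : 0 < airyBi x ∧ 0 < airyBi' x := by
  have hm : MonotoneOn (fun x => airyBi x * airyBi' x) (Ici 0) :=
    monotoneOn_Ici_of_hasDerivAt
      (fun x _ => (hasDerivAt_airyBi x).mul (hasDerivAt_airyBi' x)) fun x hx => by
        have : airyBi' x * airyBi' x + airyBi x * (x * airyBi x) =
          airyBi' x ^ 2 + x * airyBi x ^ 2 := by ring
        rw [this]; positivity
  have h0 : 0 < airyBi 0 := by
    have := airyG0_pos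
    rw [airyBi_zero]; positivity
  have h0' : 0 < airyBi' 0 := by
    have := airyG1_pos
    rw [airyBi'_zero]; positivity
  have hprod : ∀ y, 0 ≤ y → 0 < airyBi y * airyBi' y := fun y hy =>
    (mul_pos h0 h0').trans_le (hm (mem_Ici.2 le_rfl) (mem_Ici.2 hy) hy)
  have hpos : 0 < airyBi x := by
    by_contra! hneg
    have hc : ContinuousOn airyBi (Icc 0 x) := fun y _ =>
      (hasDerivAt_airyBi y).continuousAt.continuousWithinAt
    obtain ⟨y, hy, hy0⟩ := intermediate_value_Icc' hx hc ⟨hneg, h0.le⟩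
    have := hprod y hy.1
    rw [hy0, zero_mul] at this
    exact lt_irrefl _ this
  exact ⟨hpos, (pos_iff_pos_of_mul_pos (hprod x hx)).1 hpos⟩

/-- After a zero y of Ai the monotone product Ai Ai' is nonnegative, so Ai² increases there; as it
tends to 0, Ai vanishes on [y, ∞), against the Wronskian. -/
lemma airyAi_pos {x : ℝ} (hx : 0 ≤ x) : 0 < airyAi x := by
  have hm : MonotoneOn (fun x => airyAi x * airyAi' x) (Ici 0) :=
    monotoneOn_Ici_of_hasDerivAt
      (fun x _ => (hasDerivAt_airyAi x).mul (hasDerivAt_airyAi' x)) fun x hx => by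
        have : airyAi' x * airyAi' x + airyAi x * (x * airyAi x) =
          airyAi' x ^ 2 + x * airyAi x ^ 2 := by ring
        rw [this]; positivity
  have h0 : 0 < airyAi 0 := by
    have := airyG0_pos
    rw [airyAi_zero]; positivity
  have hne : ∀ y, 0 ≤ y → airyAi y ≠ 0 := by
    intro y hy hy0
    have hm2 : MonotoneOn (fun x => airyAi x ^ 2) (Ici y) := by
      refine monotoneOn_Ici_of_hasDerivAt (fun x _ => (hasDerivAt_airyAi x).pow 2) fun x hx => ?_
      have h1 := hm (mem_Ici.2 hy) (mem_Ici.2 (hy.trans hx)) hx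
      simp only [hy0, zero_mul] at h1
      simp
      linarith
    have hz : ∀ x, y ≤ x → airyAi x = 0 := by
      intro x hx
      have ht : Tendsto (fun x => airyAi x ^ 2) atTop (𝓝 0) := by
        simpa using tendsto_airyAi.pow 2
      have h1 : airyAi x ^ 2 ≤ 0 := ge_of_tendsto ht <| by
        filter_upwards [eventually_ge_atTop x] with z hz
        exact hm2 (mem_Ici.2 hx) (mem_Ici.2 (hx.trans hz)) hz
      exact pow_eq_zero_iff two_ne_zero |>.1 (le_antisymm h1 (sq_nonneg _))
    have hloc : airyAi =ᶠ[𝓝 (y + 1)] fun _ => (0 : ℝ) := by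
      filter_upwards [lt_mem_nhds (lt_add_one y)] with z hzy
      exact hz z hzy.le
    have hd : airyAi' (y + 1) = 0 :=
      (hasDerivAt_airyAi (y + 1)).unique ((hasDerivAt_const _ _).congr_of_eventuallyEq hloc)
    have hw := airy_wronskian (y + 1)
    rw [hd, hz _ (lt_add_one y).le] at hw
    have := one_div_pos.2 Real.pi_pos
    simp at hw
    exact Real.pi_ne_zero hw.symm
  by_contra! hneg
  have hc : ContinuousOn airyAi (Icc 0 x) := fun y _ =>
    (hasDerivAt_airyAi y).continuousAt.continuousWithinAt
  obtain ⟨y, hy, hy0⟩ := intermediate_value_Icc' hx hc ⟨hneg, h0.le⟩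
  exact hne y hy.1 hy0

/-! ### The scale of powers times exponentials of t^{3/2} -/

/-- The comparison functions `t ^ k * exp (-(2/9) m t^{3/2})`. -/
def expScale (k m t : ℝ) : ℝ := t ^ k * Real.exp (-(2 / 9) * m * t ^ (3 / 2 : ℝ))

lemma expScale_pos (k m : ℝ) {t : ℝ} (ht : 0 < t) : 0 < expScale k m t := by
  unfold expScale; positivity

lemma expScale_mul (k m k' m' : ℝ) {t : ℝ} (ht : 0 < t) :
    expScale k m t * expScale k' m' t = expScale (k + k') (m + m') t := by
  unfold expScale
  rw [Real.rpow_add ht, show -(2 / 9) * (m + m') * t ^ (3 / 2 : ℝ) =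
    -(2 / 9) * m * t ^ (3 / 2 : ℝ) + -(2 / 9) * m' * t ^ (3 / 2 : ℝ) by ring, Real.exp_add]
  ring

lemma expScale_inv (k m : ℝ) {t : ℝ} (ht : 0 < t) : (expScale k m t)⁻¹ = expScale (-k) (-m) t := by
  refine (eq_inv_of_mul_eq_one_left ?_).symm
  rw [expScale_mul _ _ _ _ ht]
  simp [expScale]

lemma expScale_zero (k : ℝ) : expScale k 0 = fun t => t ^ k := by
  funext t; simp [expScale]

lemma hasDerivAt_expScale (k m : ℝ) {t : ℝ} (ht : 0 < t) :
    HasDerivAt (expScale k m) (k * expScale (k - 1) m t - m / 3 * expScale (k + 1 / 2) m t) t := by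
  have h1 := Real.hasDerivAt_rpow_const (p := k) (Or.inl ht.ne')
  have h2 := (Real.hasDerivAt_rpow_const (p := 3 / 2) (Or.inl ht.ne')).const_mul (-(2 / 9) * m)
  refine (h1.mul h2.exp).congr_deriv ?_
  unfold expScale
  rw [Real.rpow_add ht, show (3 / 2 - 1 : ℝ) = 1 / 2 by norm_num]
  ring

lemma tendsto_expScale_of_pos (k : ℝ) {m : ℝ} (hm : 0 < m) : Tendsto (expScale k m) atTop (𝓝 0) := by
  have h1 := tendsto_rpow_mul_exp_neg_mul_atTop_nhds_zero (k * (2 / 3)) (2 / 9 * m) (by positivity)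
  have h2 := h1.comp (tendsto_rpow_atTop (y := 3 / 2) (by norm_num))
  refine h2.congr' ?_
  filter_upwards [eventually_gt_atTop 0] with t ht
  simp only [Function.comp, expScale]
  rw [← Real.rpow_mul ht.le, show 3 / 2 * (k * (2 / 3)) = k by ring]
  congr 2; ring

lemma tendsto_expScale_of_neg {k : ℝ} (hk : k < 0) : Tendsto (expScale k 0) atTop (𝓝 0) := by
  rw [expScale_zero]
  have := tendsto_rpow_neg_atTop (y := -k) (by linarith)
  simpa using this

/-- The scale is ordered lexicographically, by the rate m and then by the power k. Later estimates
thereby reduce to arithmetic with exponents. -/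
lemma expScale_isLittleO {k m k' m' : ℝ} (h : m' < m ∨ m' = m ∧ k < k') :
    expScale k m =o[atTop] expScale k' m' := by
  rw [isLittleO_iff_tendsto' (by
    filter_upwards [eventually_gt_atTop 0] with t ht h0
    exact absurd h0 (expScale_pos _ _ ht).ne')]
  have : Tendsto (expScale (k - k') (m - m')) atTop (𝓝 0) := by
    rcases h with h | ⟨h, h'⟩
    · exact tendsto_expScale_of_pos _ (by linarith)
    · rw [h, sub_self]; exact tendsto_expScale_of_neg (by linarith)
  refine this.congr' ?_
  filter_upwards [eventually_gt_atTop 0] with t ht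
  rw [div_eq_mul_inv, expScale_inv _ _ ht, expScale_mul _ _ _ _ ht, sub_eq_add_neg, sub_eq_add_neg]

lemma expScale_isBigO {k m k' m' : ℝ} (h : m' < m ∨ m' = m ∧ k ≤ k') :
    expScale k m =O[atTop] expScale k' m' := by
  rcases h with h | ⟨h, h'⟩
  · exact (expScale_isLittleO (Or.inl h)).isBigO
  · rcases h'.lt_or_eq with h'' | h''
    · exact (expScale_isLittleO (Or.inr ⟨h, h''⟩)).isBigO
    · rw [h, h'']

/-- `f = O(expScale k m)` at infinity. -/
abbrev OG (f : ℝ → ℝ) (k m : ℝ) : Prop := f =O[atTop] expScale k m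

lemma OG.weaken {f : ℝ → ℝ} {k m : ℝ} (hf : OG f k m) (k' m' : ℝ)
    (h : m' < m ∨ m' = m ∧ k ≤ k') : OG f k' m' :=
  hf.trans (expScale_isBigO h)

lemma OG.mul {f g : ℝ → ℝ} {k m k' m' : ℝ} (hf : OG f k m) (hg : OG g k' m') (k'' m'' : ℝ)
    (h : m'' < m + m' ∨ m'' = m + m' ∧ k + k' ≤ k'') : OG (fun t => f t * g t) k'' m'' := by
  refine ((IsBigO.mul hf hg).trans_eventuallyEq ?_).trans (expScale_isBigO h)
  filter_upwards [eventually_gt_atTop 0] with t ht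
  exact expScale_mul _ _ _ _ ht

lemma OG.tendsto_zero {f : ℝ → ℝ} {k m : ℝ} (hf : OG f k m) (h : 0 < m ∨ 0 = m ∧ k < 0) :
    Tendsto f atTop (𝓝 0) := by
  refine hf.trans_tendsto ?_
  rcases h with h | ⟨rfl, h⟩
  · exact tendsto_expScale_of_pos _ h
  · exact tendsto_expScale_of_neg h

lemma OG.of_tendsto {f : ℝ → ℝ} {c : ℝ} (h : Tendsto f atTop (𝓝 c)) : OG f 0 0 := by
  have : expScale 0 0 = fun _ => (1 : ℝ) := by simp [expScale_zero]
  rw [OG, this]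
  exact h.isBigO_one ℝ

lemma OG.rpow (k : ℝ) : OG (fun t => t ^ k) k 0 := by
  rw [OG, expScale_zero]

lemma OG.add {f g : ℝ → ℝ} {k m : ℝ} (hf : OG f k m) (hg : OG g k m) :
    OG (fun t => f t + g t) k m := IsBigO.add hf hg

lemma OG.sub {f g : ℝ → ℝ} {k m : ℝ} (hf : OG f k m) (hg : OG g k m) :
    OG (fun t => f t - g t) k m := IsBigO.sub hf hg

lemma OG.const_mul {f : ℝ → ℝ} {k m : ℝ} (hf : OG f k m) (c : ℝ) :
    OG (fun t => c * f t) k m := IsBigO.const_mul_left hf c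

lemma OG.congr {f g : ℝ → ℝ} {k m : ℝ} (hf : OG f k m) (h : ∀ᶠ t in atTop, f t = g t) :
    OG g k m := IsBigO.congr' hf h EventuallyEq.rfl

/-! ### Comparison and integration from infinity -/

/-- Both f - g and -f - g are eventually nondecreasing with limit 0, hence nonpositive. No integral
of f' is needed. -/
lemma abs_le_of_abs_deriv_le {f f' g g' : ℝ → ℝ} (hf : ∀ᶠ t in atTop, HasDerivAt f (f' t) t)
    (hg : ∀ᶠ t in atTop, HasDerivAt g (g' t) t) (h : ∀ᶠ t in atTop, |f' t| ≤ -g' t)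
    (hf0 : Tendsto f atTop (𝓝 0)) (hg0 : Tendsto g atTop (𝓝 0)) :
    ∀ᶠ t in atTop, |f t| ≤ g t := by
  obtain ⟨T, hT⟩ := eventually_atTop.1 (hf.and (hg.and h))
  have h1 : MonotoneOn (fun t => f t - g t) (Ici T) :=
    monotoneOn_Ici_of_hasDerivAt (fun x hx => (hT x hx).1.sub (hT x hx).2.1)
      fun x hx => by linarith [(abs_le.1 (hT x hx).2.2).1]
  have h2 : MonotoneOn (fun t => -f t - g t) (Ici T) :=
    monotoneOn_Ici_of_hasDerivAt (fun x hx => (hT x hx).1.neg.sub (hT x hx).2.1)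
      fun x hx => by linarith [(abs_le.1 (hT x hx).2.2).2]
  filter_upwards [eventually_ge_atTop T] with t ht
  have l1 : f t - g t ≤ 0 := ge_of_tendsto (by simpa using hf0.sub hg0) <| by
    filter_upwards [eventually_ge_atTop t] with s hs
    exact h1 (mem_Ici.2 ht) (mem_Ici.2 (ht.trans hs)) hs
  have l2 : -f t - g t ≤ 0 := ge_of_tendsto (by simpa using hf0.neg.sub hg0) <| by
    filter_upwards [eventually_ge_atTop t] with s hs
    exact h2 (mem_Ici.2 ht) (mem_Ici.2 (ht.trans hs)) hs
  exact abs_le.2 ⟨by linarith, by linarith⟩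

/-- The function f - g is nondecreasing, and it is bounded because f + g is nonincreasing and g ≥ 0.
-/
lemma tendsto_of_abs_deriv_le {f f' g g' : ℝ → ℝ} (hf : ∀ᶠ t in atTop, HasDerivAt f (f' t) t)
    (hg : ∀ᶠ t in atTop, HasDerivAt g (g' t) t) (h : ∀ᶠ t in atTop, |f' t| ≤ -g' t)
    (hg0 : Tendsto g atTop (𝓝 0)) : ∃ L, Tendsto f atTop (𝓝 L) := by
  obtain ⟨T, hT⟩ := eventually_atTop.1 (hf.and (hg.and h))
  have h1 : MonotoneOn (fun t => f t - g t) (Ici T) :=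
    monotoneOn_Ici_of_hasDerivAt (fun x hx => (hT x hx).1.sub (hT x hx).2.1)
      fun x hx => by linarith [(abs_le.1 (hT x hx).2.2).1]
  have h2 : MonotoneOn (fun t => -f t - g t) (Ici T) :=
    monotoneOn_Ici_of_hasDerivAt (fun x hx => (hT x hx).1.neg.sub (hT x hx).2.1)
      fun x hx => by linarith [(abs_le.1 (hT x hx).2.2).2]
  have h3 : MonotoneOn (fun t => -g t) (Ici T) :=
    monotoneOn_Ici_of_hasDerivAt (fun x hx => (hT x hx).2.1.neg)
      fun x hx => (abs_nonneg _).trans (hT x hx).2.2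
  -- Freezing the argument at T makes the function monotone on the whole line, as monotone
  -- convergence requires.
  have hmono : Monotone (fun t => f (max t T) - g (max t T)) := fun s t hst =>
    h1 (mem_Ici.2 (le_max_right _ _)) (mem_Ici.2 (le_max_right _ _)) (max_le_max_right _ hst)
  have hbdd : BddAbove (range fun t => f (max t T) - g (max t T)) := by
    refine ⟨f T + g T, ?_⟩
    rintro _ ⟨t, rfl⟩
    have hmem : max t T ∈ Ici T := mem_Ici.2 (le_max_right _ _)
    have l2 := h2 (mem_Ici.2 le_rfl) hmem (le_max_right _ _)
    have l3 : -g (max t T) ≤ 0 := ge_of_tendsto (by simpa using hg0.neg) <| by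
      filter_upwards [eventually_ge_atTop (max t T)] with s hs
      exact h3 hmem (mem_Ici.2 ((le_max_right t T).trans hs)) hs
    simp only at l2 l3 ⊢
    linarith
  have ht := tendsto_atTop_ciSup hmono hbdd
  refine ⟨(⨆ t, f (max t T) - g (max t T)) + 0, ?_⟩
  refine (ht.add hg0).congr' ?_
  filter_upwards [eventually_ge_atTop T] with t htT
  rw [max_eq_left htT]; ring

lemma exists_expScale_majorant (k : ℝ) {m C : ℝ} (hm : 0 < m) (hC : 0 ≤ C) :
    ∃ g g' : ℝ → ℝ, (∀ᶠ t in atTop, HasDerivAt g (g' t) t) ∧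
      (∀ᶠ t in atTop, C * expScale k m t ≤ -g' t) ∧ OG g (k - 1 / 2) m := by
  -- The leading part of minus the derivative of `expScale (k - 1 / 2) m` is m/3 times `expScale k
  -- m`. The factor 6/m makes it twice what is needed, and the spare half absorbs the term of lower
  -- power.
  refine ⟨fun t => C * (6 / m) * expScale (k - 1 / 2) m t, fun t => C * (6 / m) *
    ((k - 1 / 2) * expScale (k - 1 / 2 - 1) m t - m / 3 * expScale (k - 1 / 2 + 1 / 2) m t),
    ?_, ?_, (isBigO_refl _ _).const_mul_left _⟩
  · filter_upwards [eventually_gt_atTop 0] with t ht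
    exact (hasDerivAt_expScale _ _ ht).const_mul _
  · have ho : (fun t => (6 / m) * (k - 1 / 2) * expScale (k - 1 / 2 - 1) m t) =o[atTop]
        expScale k m := (expScale_isLittleO (Or.inr ⟨rfl, by linarith⟩)).const_mul_left _
    filter_upwards [eventually_gt_atTop 0, ho.bound one_pos] with t ht h1
    rw [sub_add_cancel]
    rw [Real.norm_eq_abs, Real.norm_of_nonneg (expScale_pos _ _ ht).le, one_mul] at h1
    have h2 := le_of_abs_le h1
    have : -(C * (6 / m) * ((k - 1 / 2) * expScale (k - 1 / 2 - 1) m t - m / 3 * expScale k m t)) =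
        C * (2 * expScale k m t - (6 / m) * (k - 1 / 2) * expScale (k - 1 / 2 - 1) m t) := by
      field_simp; ring
    rw [this]
    exact mul_le_mul_of_nonneg_left (by linarith) hC

lemma OG.of_deriv {f f' : ℝ → ℝ} {k m : ℝ} (hf : ∀ᶠ t in atTop, HasDerivAt f (f' t) t)
    (hf' : OG f' k m) (hf0 : Tendsto f atTop (𝓝 0)) (hm : 0 < m) (k' : ℝ) (hk : k - 1 / 2 ≤ k') :
    OG f k' m := by
  obtain ⟨C, hC, hb⟩ := hf'.exists_nonneg
  obtain ⟨g, g', hg, hle, hg0⟩ := exists_expScale_majorant k hm hC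
  have h := abs_le_of_abs_deriv_le hf hg ?_ hf0 (hg0.tendsto_zero (Or.inl hm))
  · refine (IsBigO.of_bound 1 ?_ : f =O[atTop] g).trans
      (hg0.weaken k' m (Or.inr ⟨rfl, hk⟩))
    filter_upwards [h] with t ht
    rw [one_mul]
    exact ht.trans (le_abs_self _)
  · filter_upwards [hle, hb.bound, eventually_gt_atTop 0] with t h1 h2 h3
    rw [Real.norm_eq_abs, Real.norm_of_nonneg (expScale_pos _ _ h3).le] at h2
    linarith

lemma OG.exists_tendsto_of_deriv {f f' : ℝ → ℝ} {k m : ℝ}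
    (hf : ∀ᶠ t in atTop, HasDerivAt f (f' t) t) (hf' : OG f' k m) (hm : 0 < m) :
    ∃ L, Tendsto f atTop (𝓝 L) := by
  obtain ⟨C, hC, hb⟩ := hf'.exists_nonneg
  obtain ⟨g, g', hg, hle, hg0⟩ := exists_expScale_majorant k hm hC
  refine tendsto_of_abs_deriv_le hf hg ?_ (hg0.tendsto_zero (Or.inl hm))
  filter_upwards [hle, hb.bound, eventually_gt_atTop 0] with t h1 h2 h3
  rw [Real.norm_eq_abs, Real.norm_of_nonneg (expScale_pos _ _ h3).le] at h2
  linarith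

/-- A convex function tending to zero at infinity has derivative tending to zero. -/
lemma tendsto_deriv_zero_of_convex {f f' f'' : ℝ → ℝ}
    (hf : ∀ᶠ t in atTop, HasDerivAt f (f' t) t) (hf' : ∀ᶠ t in atTop, HasDerivAt f' (f'' t) t)
    (h : ∀ᶠ t in atTop, 0 ≤ f'' t) (hf0 : Tendsto f atTop (𝓝 0)) :
    Tendsto f' atTop (𝓝 0) := by
  obtain ⟨T, hT⟩ := eventually_atTop.1 (hf.and (hf'.and h))
  have hm : MonotoneOn f' (Ici T) :=
    monotoneOn_Ici_of_hasDerivAt (fun x hx => (hT x hx).2.1) fun x hx => (hT x hx).2.2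
  have mv : ∀ s, T ≤ s → ∃ c ∈ Ioo s (s + 1), f' c = f (s + 1) - f s := by
    intro s hs
    obtain ⟨c, hc, he⟩ := exists_hasDerivAt_eq_slope f f' (lt_add_one s)
      (fun x hx => (hT x (hs.trans hx.1)).1.continuousAt.continuousWithinAt)
      (fun x hx => (hT x (hs.trans hx.1.le)).1)
    exact ⟨c, hc, by simpa using he⟩
  have l1 : Tendsto (fun t => f (t + 1) - f t) atTop (𝓝 0) := by
    simpa using (hf0.comp (tendsto_atTop_add_const_right atTop (1 : ℝ) tendsto_id)).sub hf0
  have l2 : Tendsto (fun t => f t - f (t - 1)) atTop (𝓝 0) := by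
    simpa [sub_eq_add_neg] using
      hf0.sub (hf0.comp (tendsto_atTop_add_const_right atTop (-1 : ℝ) tendsto_id))
  refine tendsto_of_tendsto_of_tendsto_of_le_of_le' l2 l1 ?_ ?_
  · filter_upwards [eventually_ge_atTop (T + 1)] with t ht
    obtain ⟨c, hc, he⟩ := mv (t - 1) (by linarith)
    rw [sub_add_cancel] at he hc
    rw [← he]
    exact hm (mem_Ici.2 (by linarith [hc.1])) (mem_Ici.2 (by linarith)) hc.2.le
  · filter_upwards [eventually_ge_atTop (T + 1)] with t ht
    obtain ⟨c, hc, he⟩ := mv t (by linarith)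
    rw [← he]
    exact hm (mem_Ici.2 (by linarith)) (mem_Ici.2 (by linarith [hc.1])) hc.1.le

/-! ### WKB asymptotics for f'' = (m²/9) t f -/

/-- The approximate logarithmic derivative of a solution of `f'' = (m²/9) t f`. -/
def wkbLog (m t : ℝ) : ℝ := -(m / 3) * Real.sqrt t - 1 / (4 * t)

/-- `f` (with derivative `f'`) behaves at infinity like a positive multiple of
`t^{-1/4} exp (-(2/9) m t^{3/2})`. -/
structure IsWKB (m : ℝ) (f f' : ℝ → ℝ) : Prop where
  hasDerivAt : ∀ᶠ t in atTop, HasDerivAt f (f' t) t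
  pos : ∀ᶠ t in atTop, 0 < f t
  log_deriv : ∃ K, ∀ᶠ t in atTop, |f' t - wkbLog m t * f t| ≤ K * t ^ (-(5 / 2) : ℝ) * f t
  tendsto : ∃ c, 0 < c ∧ Tendsto (fun t => f t / expScale (-(1 / 4)) m t) atTop (𝓝 c)

/-- The Riccati equation of f'' = (m²/9) t f holds up to the defect 5/(16 t²). This defect is the
only source of error in the WKB comparison. -/
lemma hasDerivAt_wkbLog (m : ℝ) {t : ℝ} (ht : 0 < t) :
    HasDerivAt (wkbLog m) (m ^ 2 / 9 * t + 5 / (16 * t ^ 2) - wkbLog m t ^ 2) t := by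
  have h1 := (Real.hasDerivAt_sqrt ht.ne').const_mul (-(m / 3))
  have h2 := (((hasDerivAt_id t).const_mul 4).inv (by simpa using ht.ne'))
  have h3 := h1.sub h2
  refine (h3.congr_deriv ?_).congr_of_eventuallyEq (Eventually.of_forall fun s => ?_)
  · have hs := Real.sqrt_pos.2 ht
    have e : t = Real.sqrt t ^ 2 := (Real.sq_sqrt ht.le).symm
    unfold wkbLog
    set r := Real.sqrt t
    simp only [id]
    rw [e]
    field_simp
    ring
  · simp [wkbLog]

lemma hasDerivAt_expScale_wkb (m : ℝ) {t : ℝ} (ht : 0 < t) :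
    HasDerivAt (expScale (-(1 / 4)) m) (wkbLog m t * expScale (-(1 / 4)) m t) t := by
  refine (hasDerivAt_expScale (-(1 / 4)) m ht).congr_deriv ?_
  unfold expScale wkbLog
  rw [Real.rpow_add ht, Real.rpow_sub_one ht.ne', Real.sqrt_eq_rpow]
  field_simp
  ring

/-- The logarithm of f / `expScale (-(1 / 4)) m` has derivative O(t^{-5/2}), which is integrable;
its limit is exponentiated, so c is positive. -/
lemma exists_tendsto_of_log_deriv {m : ℝ} {f f' : ℝ → ℝ}
    (hf : ∀ᶠ t in atTop, HasDerivAt f (f' t) t) (hpos : ∀ᶠ t in atTop, 0 < f t) {K : ℝ}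
    (hK : ∀ᶠ t in atTop, |f' t - wkbLog m t * f t| ≤ K * t ^ (-(5 / 2) : ℝ) * f t) :
    IsWKB m f f' := by
  refine ⟨hf, hpos, ⟨K, hK⟩, ?_⟩
  have key := tendsto_of_abs_deriv_le
    (f := fun t => Real.log (f t) - Real.log (expScale (-(1 / 4)) m t))
    (f' := fun t => f' t / f t - wkbLog m t)
    (g := fun t => K * (2 / 3) * t ^ (-(3 / 2) : ℝ))
    (g' := fun t => K * (2 / 3) * (-(3 / 2) * t ^ (-(3 / 2) - 1 : ℝ))) ?_ ?_ ?_ ?_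
  · obtain ⟨L, hL⟩ := key
    refine ⟨Real.exp L, Real.exp_pos L, ?_⟩
    refine ((Real.continuous_exp.tendsto L).comp hL).congr' ?_
    filter_upwards [hpos, eventually_gt_atTop 0] with t h1 h2
    simp only [Function.comp]
    rw [Real.exp_sub, Real.exp_log h1, Real.exp_log (expScale_pos _ _ h2)]
  · filter_upwards [hf, hpos, eventually_gt_atTop 0] with t h1 h2 h3
    refine ((h1.log h2.ne').sub ((hasDerivAt_expScale_wkb m h3).log
      (expScale_pos _ _ h3).ne')).congr_deriv ?_
    rw [mul_div_cancel_right₀ _ (expScale_pos _ _ h3).ne']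
  · filter_upwards [eventually_gt_atTop 0] with t h3
    exact (Real.hasDerivAt_rpow_const (Or.inl h3.ne')).const_mul _
  · filter_upwards [hK, hpos] with t h1 h2
    rw [show f' t / f t - wkbLog m t = (f' t - wkbLog m t * f t) / f t by field_simp,
      abs_div, abs_of_pos h2, div_le_iff₀ h2,
      show (-(3 / 2) - 1 : ℝ) = -(5 / 2) by norm_num]
    refine h1.trans (le_of_eq ?_)
    ring
  · simpa using (tendsto_rpow_neg_atTop (y := 3 / 2) (by norm_num)).const_mul (K * (2 / 3))

/-- The weighted Wronskian used to compare `f` with `expScale (-1/4) m`. -/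
lemma hasDerivAt_wkb_wronskian {m t f'' : ℝ} {f f' : ℝ → ℝ} (hf : HasDerivAt f (f' t) t)
    (hf' : HasDerivAt f' f'' t) (he : f'' = m ^ 2 / 9 * t * f t) (ht : 0 < t) :
    HasDerivAt (fun t => (f' t - wkbLog m t * f t) * expScale (-(1 / 4)) m t)
      (-(5 / (16 * t ^ 2)) * (f t * expScale (-(1 / 4)) m t)) t := by
  refine ((hf'.sub ((hasDerivAt_wkbLog m ht).mul hf)).mul
    (hasDerivAt_expScale_wkb m ht)).congr_deriv ?_
  rw [he]
  simp only [Pi.sub_apply, Pi.mul_apply]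
  ring

/-- This function controls the weighted Wronskian: the bracket is of size √t f, and t^{-5/2} √t =
t^{-2} is the order of the defect. -/
lemma hasDerivAt_wkb_comparison {m t : ℝ} {f f' : ℝ → ℝ} (hf : HasDerivAt f (f' t) t)
    (ht : 0 < t) :
    HasDerivAt (fun t => t ^ (-(5 / 2) : ℝ) * (f t * expScale (-(1 / 4)) m t))
      (t ^ (-(5 / 2) : ℝ) * expScale (-(1 / 4)) m t *
        (f' t + f t * (wkbLog m t - 5 / (2 * t)))) t := by
  refine ((Real.hasDerivAt_rpow_const (p := -(5 / 2)) (Or.inl ht.ne')).mul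
    (hf.mul (hasDerivAt_expScale_wkb m ht))).congr_deriv ?_
  rw [Real.rpow_sub_one ht.ne']
  simp only [Pi.mul_apply]
  field_simp
  ring

lemma rpow_neg_five_halves_mul_sqrt {t : ℝ} (ht : 0 < t) :
    t ^ (-(5 / 2) : ℝ) * Real.sqrt t = 1 / t ^ 2 := by
  rw [Real.sqrt_eq_rpow, ← Real.rpow_add ht, show (-(5 / 2) + 1 / 2 : ℝ) = -2 by norm_num,
    Real.rpow_neg ht.le]
  norm_num

lemma tendsto_wkbLog_mul_expScale {m : ℝ} (hm : 0 < m) :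
    Tendsto (fun t => wkbLog m t * expScale (-(1 / 4)) m t) atTop (𝓝 0) := by
  have h1 := (tendsto_expScale_of_pos (-(5 / 4)) hm).const_mul (-(1 / 4))
  have h2 := (tendsto_expScale_of_pos (1 / 4) hm).const_mul (m / 3)
  have h3 := h1.sub h2
  simp only [mul_zero, sub_zero] at h3
  refine h3.congr' ?_
  filter_upwards [eventually_gt_atTop 0] with t ht
  rw [(hasDerivAt_expScale_wkb m ht).unique (hasDerivAt_expScale (-(1 / 4)) m ht)]
  norm_num

/-- The decaying case. -/
lemma IsWKB.of_decaying {m : ℝ} (hm : 0 < m) {f f' : ℝ → ℝ}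
    (hf : ∀ᶠ t in atTop, HasDerivAt f (f' t) t)
    (hf' : ∀ᶠ t in atTop, HasDerivAt f' (m ^ 2 / 9 * t * f t) t)
    (hpos : ∀ᶠ t in atTop, 0 < f t) (h0 : Tendsto f atTop (𝓝 0)) : IsWKB m f f' := by
  have hconv : ∀ᶠ t in atTop, 0 ≤ m ^ 2 / 9 * t * f t := by
    filter_upwards [hpos, eventually_gt_atTop 0] with t h1 h2
    positivity
  have h0' := tendsto_deriv_zero_of_convex hf hf' hconv h0
  -- By convexity f' is nondecreasing, and its limit is 0.
  have hneg : ∀ᶠ t in atTop, f' t ≤ 0 := by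
    obtain ⟨T, hT⟩ := eventually_atTop.1 (hf'.and hconv)
    have hmono : MonotoneOn f' (Ici T) :=
      monotoneOn_Ici_of_hasDerivAt (fun x hx => (hT x hx).1) fun x hx => (hT x hx).2
    filter_upwards [eventually_ge_atTop T] with t ht
    exact ge_of_tendsto h0' <| by
      filter_upwards [eventually_ge_atTop t] with s hs
      exact hmono (mem_Ici.2 ht) (mem_Ici.2 (ht.trans hs)) hs
  have hp0 := tendsto_expScale_of_pos (-(1 / 4)) hm
  have key := abs_le_of_abs_deriv_le
    (f := fun t => (f' t - wkbLog m t * f t) * expScale (-(1 / 4)) m t)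
    (f' := fun t => -(5 / (16 * t ^ 2)) * (f t * expScale (-(1 / 4)) m t))
    (g := fun t => 1 / m * (t ^ (-(5 / 2) : ℝ) * (f t * expScale (-(1 / 4)) m t)))
    (g' := fun t => 1 / m * (t ^ (-(5 / 2) : ℝ) * expScale (-(1 / 4)) m t *
        (f' t + f t * (wkbLog m t - 5 / (2 * t))))) ?_ ?_ ?_ ?_ ?_
  · refine exists_tendsto_of_log_deriv hf hpos (K := 1 / m) ?_
    filter_upwards [key, eventually_gt_atTop 0] with t h1 h2
    have hp := expScale_pos (-(1 / 4)) m h2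
    rw [abs_mul, abs_of_pos hp] at h1
    refine le_of_mul_le_mul_right (h1.trans (le_of_eq ?_)) hp
    ring
  · filter_upwards [hf, hf', eventually_gt_atTop 0] with t h1 h2 h3
    exact hasDerivAt_wkb_wronskian h1 h2 rfl h3
  · filter_upwards [hf, eventually_gt_atTop 0] with t h1 h3
    exact (hasDerivAt_wkb_comparison h1 h3).const_mul _
  · filter_upwards [hpos, hneg, eventually_gt_atTop 0] with t h1 h2 h3
    have hp := expScale_pos (-(1 / 4)) m h3
    have hr : 0 < t ^ (-(5 / 2) : ℝ) := by positivity
    have hq := rpow_neg_five_halves_mul_sqrt h3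
    rw [abs_mul, abs_neg, abs_of_pos (by positivity : 0 < f t * expScale (-(1 / 4)) m t),
      abs_of_pos (by positivity : 0 < 5 / (16 * t ^ 2))]
    have e1 : f' t + f t * (wkbLog m t - 5 / (2 * t)) ≤ -(m / 3 * Real.sqrt t * f t) := by
      have : wkbLog m t - 5 / (2 * t) ≤ -(m / 3 * Real.sqrt t) := by
        have a1 : 0 < 1 / (4 * t) := by positivity
        have a2 : 0 < 5 / (2 * t) := by positivity
        unfold wkbLog; linarith
      nlinarith
    -- Rounding 5/16 up to 1/3 matches the product of the constant 1/m of the comparison function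
    -- with the m/3 in `wkbLog`.
    calc 5 / (16 * t ^ 2) * (f t * expScale (-(1 / 4)) m t)
        ≤ 1 / 3 * (1 / t ^ 2) * (f t * expScale (-(1 / 4)) m t) := by
          gcongr
          rw [div_le_iff₀ (by positivity)]
          field_simp
          norm_num
      _ = 1 / m * (t ^ (-(5 / 2) : ℝ) * expScale (-(1 / 4)) m t *
          (m / 3 * Real.sqrt t * f t)) := by
          rw [← hq]; field_simp
      _ ≤ 1 / m * (t ^ (-(5 / 2) : ℝ) * expScale (-(1 / 4)) m t *
          (-(f' t + f t * (wkbLog m t - 5 / (2 * t))))) := by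
          gcongr
          linarith
      _ = _ := by ring
  · have h1 := (h0'.mul hp0).sub ((tendsto_wkbLog_mul_expScale hm).mul h0)
    simp only [mul_zero, sub_zero] at h1
    refine h1.congr fun t => ?_
    ring
  · have h1 := ((tendsto_rpow_neg_atTop (y := 5 / 2) (by norm_num)).mul
      (h0.mul hp0)).const_mul (1 / m)
    simpa using h1

lemma tendsto_expScale_atTop (k : ℝ) {m : ℝ} (hm : m < 0) :
    Tendsto (expScale k m) atTop atTop := by
  have h := tendsto_expScale_of_pos (-k) (m := -m) (by linarith)
  have h' : Tendsto (expScale (-k) (-m)) atTop (𝓝[>] 0) := by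
    refine tendsto_nhdsWithin_iff.2 ⟨h, ?_⟩
    filter_upwards [eventually_gt_atTop 0] with t ht
    exact expScale_pos _ _ ht
  refine h'.inv_tendsto_nhdsGT_zero.congr' ?_
  filter_upwards [eventually_gt_atTop 0] with t ht
  simp only [Pi.inv_apply]
  rw [expScale_inv _ _ ht, neg_neg, neg_neg]

/-- The growing case. -/
lemma IsWKB.of_growing {m : ℝ} (hm : m < 0) {f f' : ℝ → ℝ}
    (hf : ∀ᶠ t in atTop, HasDerivAt f (f' t) t)
    (hf' : ∀ᶠ t in atTop, HasDerivAt f' (m ^ 2 / 9 * t * f t) t)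
    (hpos : ∀ᶠ t in atTop, 0 < f t) (hpos' : ∀ᶠ t in atTop, 0 ≤ f' t) : IsWKB m f f' := by
  set M := -m with hM
  have hM0 : 0 < M := by linarith
  have hbound : ∀ᶠ t : ℝ in atTop, 11 / (4 * t) ≤ M / 6 * Real.sqrt t := by
    -- The claim amounts to 33/2 ≤ M t √t, and 17 exceeds 33/2.
    filter_upwards [eventually_ge_atTop 1, eventually_ge_atTop (17 / M)] with t h1 h2
    have h3 : 1 ≤ Real.sqrt t := Real.one_le_sqrt.2 h1
    rw [div_le_iff₀ (by positivity)]
    rw [div_le_iff₀ hM0] at h2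
    nlinarith [mul_le_mul_of_nonneg_left h3 (by positivity : 0 ≤ t * M)]
  have hle : ∀ᶠ t in atTop, |-(5 / (16 * t ^ 2)) * (f t * expScale (-(1 / 4)) m t)| ≤
      2 / M * (t ^ (-(5 / 2) : ℝ) * expScale (-(1 / 4)) m t *
        (f' t + f t * (wkbLog m t - 5 / (2 * t)))) := by
    filter_upwards [hpos, hpos', eventually_gt_atTop 0, hbound] with t h1 h2 h3 h4
    have hp := expScale_pos (-(1 / 4)) m h3
    have hr : 0 < t ^ (-(5 / 2) : ℝ) := by positivity
    have hq := rpow_neg_five_halves_mul_sqrt h3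
    rw [abs_mul, abs_neg, abs_of_pos (by positivity : 0 < f t * expScale (-(1 / 4)) m t),
      abs_of_pos (by positivity : 0 < 5 / (16 * t ^ 2))]
    have e1 : M / 6 * Real.sqrt t * f t ≤ f' t + f t * (wkbLog m t - 5 / (2 * t)) := by
      have : M / 6 * Real.sqrt t ≤ wkbLog m t - 5 / (2 * t) := by
        have a1 : 1 / (4 * t) + 5 / (2 * t) = 11 / (4 * t) := by field_simp; norm_num
        unfold wkbLog; rw [show m = -M by simp [hM]]; linarith
      nlinarith
    calc 5 / (16 * t ^ 2) * (f t * expScale (-(1 / 4)) m t)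
        ≤ 1 / 3 * (1 / t ^ 2) * (f t * expScale (-(1 / 4)) m t) := by
          gcongr
          rw [div_le_iff₀ (by positivity)]
          field_simp
          norm_num
      _ = 2 / M * (t ^ (-(5 / 2) : ℝ) * expScale (-(1 / 4)) m t *
          (M / 6 * Real.sqrt t * f t)) := by
          rw [← hq]; field_simp; norm_num
      _ ≤ _ := by gcongr
  obtain ⟨T, hT⟩ := eventually_atTop.1 (hf.and (hf'.and (hle.and (hpos.and
    (hpos'.and (eventually_gt_atTop 0))))))
  set w := fun t => (f' t - wkbLog m t * f t) * expScale (-(1 / 4)) m t with hw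
  set g := fun t => 2 / M * (t ^ (-(5 / 2) : ℝ) * (f t * expScale (-(1 / 4)) m t)) with hg
  have dw : ∀ x, T ≤ x → HasDerivAt w _ x := fun x hx =>
    hasDerivAt_wkb_wronskian (hT x hx).1 (hT x hx).2.1 rfl (hT x hx).2.2.2.2.2
  have dg : ∀ x, T ≤ x → HasDerivAt g _ x := fun x hx =>
    (hasDerivAt_wkb_comparison (m := m) (hT x hx).1 (hT x hx).2.2.2.2.2).const_mul (2 / M)
  have m1 : MonotoneOn (fun t => g t - w t) (Ici T) :=
    monotoneOn_Ici_of_hasDerivAt (fun x hx => (dg x hx).sub (dw x hx))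
      fun x hx => by linarith [(abs_le.1 (hT x hx).2.2.1).2]
  have m2 : MonotoneOn (fun t => g t + w t) (Ici T) :=
    monotoneOn_Ici_of_hasDerivAt (fun x hx => (dg x hx).add (dw x hx))
      fun x hx => by linarith [(abs_le.1 (hT x hx).2.2.1).1]
  have mf : MonotoneOn f (Ici T) :=
    monotoneOn_Ici_of_hasDerivAt (fun x hx => (hT x hx).1) fun x hx => (hT x hx).2.2.2.2.1
  have hfT : 0 < f T := (hT T le_rfl).2.2.2.1
  -- Nothing decays in the growing case, so the comparison starts at T instead of infinity. The
  -- divergence of g then absorbs the initial values, at the price of a factor 2 in the bound for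
  -- |w|.
  have hginf : Tendsto g atTop atTop := by
    have h1 := (tendsto_expScale_atTop (-(5 / 2) + -(1 / 4)) hm).const_mul_atTop
      (by positivity : 0 < 2 / M * f T)
    refine tendsto_atTop_mono' _ ?_ h1
    filter_upwards [eventually_ge_atTop T] with t ht
    have ht0 := (hT t ht).2.2.2.2.2
    have hp := expScale_pos (-(1 / 4)) m ht0
    have e : expScale (-(5 / 2) + -(1 / 4)) m t =
        t ^ (-(5 / 2) : ℝ) * expScale (-(1 / 4)) m t := by
      rw [expScale, Real.rpow_add ht0, expScale, mul_assoc]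
    have hft := mf (mem_Ici.2 le_rfl) (mem_Ici.2 ht) ht
    rw [e, hg]
    calc _ = 2 / M * (t ^ (-(5 / 2) : ℝ) * (f T * expScale (-(1 / 4)) m t)) := by ring
      _ ≤ _ := by
        have : 0 < t ^ (-(5 / 2) : ℝ) := by positivity
        simp only
        gcongr
  refine exists_tendsto_of_log_deriv hf hpos (K := 2 * (2 / M)) ?_
  filter_upwards [hginf.eventually_ge_atTop (|g T - w T| + |g T + w T|),
    eventually_ge_atTop T] with t h1 h2
  have l1 := m1 (mem_Ici.2 le_rfl) (mem_Ici.2 h2) h2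
  have l2 := m2 (mem_Ici.2 le_rfl) (mem_Ici.2 h2) h2
  have hp := expScale_pos (-(1 / 4)) m (hT t h2).2.2.2.2.2
  simp only at l1 l2
  have hwg : |w t| ≤ 2 * g t := by
    rw [abs_le]
    have := neg_abs_le (g T - w T)
    have := neg_abs_le (g T + w T)
    have := abs_nonneg (g T - w T)
    have := abs_nonneg (g T + w T)
    constructor <;> linarith
  rw [hw, hg] at hwg
  simp only at hwg
  rw [abs_mul, abs_of_pos hp] at hwg
  refine le_of_mul_le_mul_right (hwg.trans (le_of_eq ?_)) hp
  ring

section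
variable {m : ℝ} {f f' : ℝ → ℝ}

lemma IsWKB.isOG (h : IsWKB m f f') : OG f (-(1 / 4)) m := by
  obtain ⟨c, hc, ht⟩ := h.tendsto
  refine isBigO_of_div_tendsto_nhds ?_ c ht
  filter_upwards [eventually_gt_atTop 0] with t h1 h2
  exact absurd h2 (expScale_pos _ _ h1).ne'

lemma IsWKB.isOG_inv (h : IsWKB m f f') : OG (fun t => (f t)⁻¹) (1 / 4) (-m) := by
  obtain ⟨c, hc, ht⟩ := h.tendsto
  refine isBigO_of_div_tendsto_nhds ?_ c⁻¹ ((ht.inv₀ hc.ne').congr' ?_)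
  · filter_upwards [eventually_gt_atTop 0] with t h1 h2
    exact absurd h2 (expScale_pos _ _ h1).ne'
  · filter_upwards [eventually_gt_atTop 0] with t h1
    have := expScale_inv (-(1 / 4)) m h1
    rw [neg_neg] at this
    simp only [Pi.div_apply]
    rw [← this]
    simp [div_eq_mul_inv, mul_comm]

lemma OG_sqrt : OG Real.sqrt (1 / 2) 0 :=
  (OG.rpow (1 / 2)).congr (Eventually.of_forall fun t => (Real.sqrt_eq_rpow t).symm)

lemma OG_inv_id : OG (fun t => t⁻¹) (-1) 0 :=
  (OG.rpow (-1)).congr (Eventually.of_forall fun t => Real.rpow_neg_one t)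

lemma OG_wkbLog (m : ℝ) : OG (wkbLog m) (1 / 2) 0 := by
  have h1 := OG_sqrt.const_mul (-(m / 3))
  have h2 := (OG_inv_id.const_mul (1 / 4)).weaken (1 / 2) 0 (by norm_num)
  refine (h1.sub h2).congr (Eventually.of_forall fun t => ?_)
  simp only [wkbLog]
  rw [one_div, one_div, mul_inv]

lemma IsWKB.isOG_log_deriv (h : IsWKB m f f') :
    OG (fun t => f' t - wkbLog m t * f t) (-(11 / 4)) m := by
  obtain ⟨K, hK⟩ := h.log_deriv
  have h1 : OG (fun t => t ^ (-(5 / 2) : ℝ) * f t) (-(11 / 4)) m :=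
    (OG.rpow _).mul h.isOG _ _ (by norm_num)
  refine IsBigO.trans (IsBigO.of_bound |K| ?_) h1
  filter_upwards [hK] with t ht
  rw [Real.norm_eq_abs, Real.norm_eq_abs]
  calc _ ≤ _ := ht
    _ ≤ |K * t ^ (-(5 / 2) : ℝ) * f t| := le_abs_self _
    _ = _ := by rw [mul_assoc, abs_mul]

lemma IsWKB.isOG_deriv (h : IsWKB m f f') : OG f' (1 / 4) m := by
  have h1 := h.isOG_log_deriv.weaken (1 / 4) m (by norm_num)
  have h2 := (OG_wkbLog m).mul h.isOG (1 / 4) m (by norm_num)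
  exact (h1.add h2).congr (Eventually.of_forall fun t => by ring)

end

/-! ### Reciprocals and integrals from infinity -/

lemma OG.inv_of_sub {f g : ℝ → ℝ} {k m k' m' : ℝ} (hg : OG (fun t => (g t)⁻¹) k' m')
    (hd : OG (fun t => f t - g t) k m) (h : 0 < m + m' ∨ 0 = m + m' ∧ k + k' < 0)
    (h0 : ∀ᶠ t in atTop, g t ≠ 0) :
    OG (fun t => (f t)⁻¹) k' m' ∧ Tendsto (fun t => f t / g t) atTop (𝓝 1) := by
  have h1 : Tendsto (fun t => (f t - g t) * (g t)⁻¹) atTop (𝓝 0) :=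
    (hd.mul hg (k + k') (m + m') (Or.inr ⟨rfl, le_rfl⟩)).tendsto_zero h
  have h2 : Tendsto (fun t => f t / g t) atTop (𝓝 1) := by
    have := h1.const_add 1
    rw [add_zero] at this
    refine this.congr' ?_
    filter_upwards [h0] with t ht
    field_simp
    ring
  refine ⟨?_, h2⟩
  have h3 := OG.of_tendsto (h2.inv₀ one_ne_zero)
  refine (h3.mul hg k' m' (by norm_num)).congr ?_
  filter_upwards [h0] with t ht
  field_simp

lemma OG.isBigO_exp_neg {f : ℝ → ℝ} {k m : ℝ} (hf : OG f k m) (hm : 0 < m) :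
    f =O[atTop] fun t => Real.exp (-1 * t) := by
  refine (hf.weaken 0 (m / 2) (Or.inl (by linarith))).trans (IsBigO.of_bound 1 ?_)
  -- With √t ≥ 9/m the exponent (2/9)(m/2) t^{3/2} = (m/9) √t · t is at least t.
  filter_upwards [eventually_ge_atTop 1, eventually_ge_atTop ((9 / m) ^ 2)] with t h1 h2
  have h0 : 0 < t := by linarith
  have h3 : 9 / m ≤ t ^ (1 / 2 : ℝ) := by
    rw [← Real.sqrt_eq_rpow]; exact Real.le_sqrt_of_sq_le h2
  have h4 : t ^ (3 / 2 : ℝ) = t ^ (1 / 2 : ℝ) * t := by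
    rw [show (3 / 2 : ℝ) = 1 / 2 + 1 by norm_num, Real.rpow_add_one h0.ne']
  rw [one_mul, expScale, Real.rpow_zero, one_mul, Real.norm_of_nonneg (Real.exp_pos _).le,
    Real.norm_of_nonneg (Real.exp_pos _).le, Real.exp_le_exp, h4]
  rw [div_le_iff₀ hm] at h3
  nlinarith

lemma intFromTop_spec {f : ℝ → ℝ} {k m : ℝ} (hc : Continuous f) (hf : OG f k m) (hm : 0 < m) :
    (∀ t, HasDerivAt (intFromTop f) (f t) t) ∧ Tendsto (intFromTop f) atTop (𝓝 0) := by
  have hi : ∀ a, IntegrableOn f (Ioi a) := fun a =>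
    integrable_of_isBigO_exp_neg one_pos hc.continuousOn (hf.isBigO_exp_neg hm)
  have he : intFromTop f = fun t => (∫ s in (0 : ℝ)..t, f s) - ∫ s in Ioi (0 : ℝ), f s := by
    funext t
    rw [intFromTop, ← intervalIntegral.integral_Ioi_sub_Ioi' (hi 0) (hi t)]
    ring
  constructor
  · intro t
    rw [he]
    exact (hc.integral_hasStrictDerivAt 0 t).hasDerivAt.sub_const _
  · rw [he]
    simpa using (intervalIntegral_tendsto_integral_Ioi 0 (hi 0) tendsto_id).sub_const
      (∫ s in Ioi (0 : ℝ), f s)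

/-! ### The Airy functions of t / 3^{2/3} -/

/-- The scaling constant `3^{2/3}`. -/
def airyScaling : ℝ := (3 : ℝ) ^ (2 / 3 : ℝ)

lemma airyScaling_pos : 0 < airyScaling := by unfold airyScaling; positivity

lemma airyScaling_cube : airyScaling ^ 3 = 9 := by
  rw [airyScaling, ← Real.rpow_natCast, ← Real.rpow_mul (by norm_num)]
  norm_num

/-- The derivative of `scAi`. -/
def dscAi (t : ℝ) : ℝ := scAi' t / airyScaling

/-- The derivative of `scBi`. -/
def dscBi (t : ℝ) : ℝ := scBi' t / airyScaling

lemma scAi'_eq (t : ℝ) : scAi' t = airyAi' (t / airyScaling) := by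
  rw [scAi', deriv_airyAi, airyScaling]

lemma scBi'_eq (t : ℝ) : scBi' t = airyBi' (t / airyScaling) := by
  rw [scBi', deriv_airyBi, airyScaling]

lemma hasDerivAt_div_airyScaling (t : ℝ) :
    HasDerivAt (fun t => t / airyScaling) (1 / airyScaling) t :=
  (hasDerivAt_id t).div_const _

lemma hasDerivAt_scAi (t : ℝ) : HasDerivAt scAi (dscAi t) t := by
  refine ((hasDerivAt_airyAi _).comp t (hasDerivAt_div_airyScaling t)).congr_deriv ?_
  rw [dscAi, scAi'_eq]; ring

lemma hasDerivAt_scBi (t : ℝ) : HasDerivAt scBi (dscBi t) t := by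
  refine ((hasDerivAt_airyBi _).comp t (hasDerivAt_div_airyScaling t)).congr_deriv ?_
  rw [dscBi, scBi'_eq]; ring

lemma hasDerivAt_dscAi (t : ℝ) : HasDerivAt dscAi (t / 9 * scAi t) t := by
  have h : dscAi = fun t => airyAi' (t / airyScaling) / airyScaling := by
    funext s; rw [dscAi, scAi'_eq]
  rw [h]
  refine (((hasDerivAt_airyAi' _).comp t (hasDerivAt_div_airyScaling t)).div_const _).congr_deriv ?_
  have := airyScaling_pos
  rw [← airyScaling_cube, scAi, ← airyScaling]
  field_simp

lemma hasDerivAt_dscBi (t : ℝ) : HasDerivAt dscBi (t / 9 * scBi t) t := by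
  have h : dscBi = fun t => airyBi' (t / airyScaling) / airyScaling := by
    funext s; rw [dscBi, scBi'_eq]
  rw [h]
  refine (((hasDerivAt_airyBi' _).comp t (hasDerivAt_div_airyScaling t)).div_const _).congr_deriv ?_
  have := airyScaling_pos
  rw [← airyScaling_cube, scBi, ← airyScaling]
  field_simp

lemma sc_wronskian (t : ℝ) :
    scAi t * dscBi t - dscAi t * scBi t = 1 / (Real.pi * airyScaling) := by
  have h := airy_wronskian (t / airyScaling)
  rw [dscAi, dscBi, scAi'_eq, scBi'_eq, scAi, scBi, ← airyScaling, ← div_div, ← h]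
  ring

lemma continuous_airyAi : Continuous airyAi :=
  continuous_iff_continuousAt.2 fun x => (hasDerivAt_airyAi x).continuousAt
lemma continuous_airyAi' : Continuous airyAi' :=
  continuous_iff_continuousAt.2 fun x => (hasDerivAt_airyAi' x).continuousAt
lemma continuous_scAi : Continuous scAi :=
  continuous_iff_continuousAt.2 fun x => (hasDerivAt_scAi x).continuousAt
lemma continuous_scBi : Continuous scBi :=
  continuous_iff_continuousAt.2 fun x => (hasDerivAt_scBi x).continuousAt
lemma continuous_dscAi : Continuous dscAi :=
  continuous_iff_continuousAt.2 fun x => (hasDerivAt_dscAi x).continuousAt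
lemma continuous_dscBi : Continuous dscBi :=
  continuous_iff_continuousAt.2 fun x => (hasDerivAt_dscBi x).continuousAt

lemma isWKB_airyAi : IsWKB 3 airyAi airyAi' := by
  refine IsWKB.of_decaying (by norm_num) (Eventually.of_forall hasDerivAt_airyAi)
    (Eventually.of_forall fun t => (hasDerivAt_airyAi' t).congr_deriv (by ring)) ?_ tendsto_airyAi
  filter_upwards [eventually_ge_atTop 0] with t ht using airyAi_pos ht

lemma isWKB_scAi : IsWKB 1 scAi dscAi := by
  refine IsWKB.of_decaying (by norm_num) (Eventually.of_forall hasDerivAt_scAi)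
    (Eventually.of_forall fun t => (hasDerivAt_dscAi t).congr_deriv (by ring)) ?_
    (tendsto_airyAi.comp (tendsto_id.atTop_div_const airyScaling_pos))
  filter_upwards [eventually_ge_atTop 0] with t ht using
    airyAi_pos (div_nonneg ht airyScaling_pos.le)

lemma isWKB_scBi : IsWKB (-1) scBi dscBi := by
  refine IsWKB.of_growing (by norm_num) (Eventually.of_forall hasDerivAt_scBi)
    (Eventually.of_forall fun t => (hasDerivAt_dscBi t).congr_deriv (by ring)) ?_ ?_
  · filter_upwards [eventually_ge_atTop 0] with t ht using
      (airyBi_pos_and_airyBi'_pos (div_nonneg ht airyScaling_pos.le)).1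
  · filter_upwards [eventually_ge_atTop 0] with t ht
    rw [dscBi, scBi'_eq]
    exact div_nonneg (airyBi_pos_and_airyBi'_pos (div_nonneg ht airyScaling_pos.le)).2.le
      airyScaling_pos.le

lemma IsWKB.ne_zero {m : ℝ} {f f' : ℝ → ℝ} (h : IsWKB m f f') : ∀ᶠ t in atTop, f t ≠ 0 :=
  h.pos.mono fun _ ht => ht.ne'

/-! ### The Hastings-McLeod solution near `+∞` -/

lemma IsHastingsMcLeod.hasDerivAt {u : ℝ → ℝ} (hu : IsHastingsMcLeod u) (t : ℝ) : HasDerivAt u (deriv u t) t :=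
  (hu.contDiff.differentiable (by norm_num) t).hasDerivAt

lemma IsHastingsMcLeod.contDiff_deriv {u : ℝ → ℝ} (hu : IsHastingsMcLeod u) : ContDiff ℝ 1 (deriv u) :=
  ((contDiff_succ_iff_deriv (n := 1)).1 (by rw [one_add_one_eq_two]; exact hu.contDiff)).2.2

lemma IsHastingsMcLeod.hasDerivAt_deriv {u : ℝ → ℝ} (hu : IsHastingsMcLeod u) (t : ℝ) :
    HasDerivAt (deriv u) (t * u t + 2 * u t ^ 3) t := by
  rw [← hu.painleve t]
  exact (hu.contDiff_deriv.differentiable (by norm_num) t).hasDerivAt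

lemma IsHastingsMcLeod.continuous {u : ℝ → ℝ} (hu : IsHastingsMcLeod u) : Continuous u := hu.contDiff.continuous

lemma IsHastingsMcLeod.continuous_deriv {u : ℝ → ℝ} (hu : IsHastingsMcLeod u) : Continuous (deriv u) := hu.contDiff_deriv.continuous

lemma IsHastingsMcLeod.tendsto_div {u : ℝ → ℝ} (hu : IsHastingsMcLeod u) : Tendsto (fun t => u t / airyAi t) Filter.atTop (𝓝 1) :=
  (isEquivalent_iff_tendsto_one isWKB_airyAi.ne_zero).1 hu.atTop

lemma IsHastingsMcLeod.pos {u : ℝ → ℝ} (hu : IsHastingsMcLeod u) : ∀ᶠ t in Filter.atTop, 0 < u t := by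
  filter_upwards [hu.tendsto_div.eventually_const_lt (show (0 : ℝ) < 1 by norm_num),
    isWKB_airyAi.pos] with t h1 h2
  exact (div_pos_iff_of_pos_right h2).1 h1

lemma IsHastingsMcLeod.isOG {u : ℝ → ℝ} (hu : IsHastingsMcLeod u) : OG u (-(1 / 4)) 3 := by
  have h := (OG.of_tendsto hu.tendsto_div).mul isWKB_airyAi.isOG (-(1 / 4)) 3 (by norm_num)
  refine h.congr ?_
  filter_upwards [isWKB_airyAi.ne_zero] with t ht
  field_simp

lemma IsHastingsMcLeod.tendsto_deriv {u : ℝ → ℝ} (hu : IsHastingsMcLeod u) : Tendsto (deriv u) Filter.atTop (𝓝 0) := by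
  refine tendsto_deriv_zero_of_convex (Eventually.of_forall hu.hasDerivAt)
    (Eventually.of_forall hu.hasDerivAt_deriv) ?_ (hu.isOG.tendsto_zero (by norm_num))
  filter_upwards [hu.pos, eventually_gt_atTop 0] with t h1 h2
  positivity

/-- In the derivative of the Wronskian the linear terms cancel and only 2 u³ Ai, of rate 12,
remains. -/
lemma IsHastingsMcLeod.isOG_wronskian {u : ℝ → ℝ} (hu : IsHastingsMcLeod u) :
    OG (fun t => deriv u t * airyAi t - u t * airyAi' t) (-(3 / 2)) 12 := by
  refine OG.of_deriv (k := -1) (f' := fun t => 2 * (u t * (u t * (u t * airyAi t))))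
    (Eventually.of_forall fun t => ?_) ?_ ?_ (by norm_num) _ (by norm_num)
  · refine (((hu.hasDerivAt_deriv t).mul (hasDerivAt_airyAi t)).sub
      ((hu.hasDerivAt t).mul (hasDerivAt_airyAi' t))).congr_deriv ?_
    ring
  · have h1 := hu.isOG.mul isWKB_airyAi.isOG (-(1 / 2)) 6 (by norm_num)
    have h2 := hu.isOG.mul h1 (-(3 / 4)) 9 (by norm_num)
    exact (hu.isOG.mul h2 (-1) 12 (by norm_num)).const_mul 2
  · simpa using (hu.tendsto_deriv.mul tendsto_airyAi).sub
      ((hu.isOG.mul isWKB_airyAi.isOG_deriv 0 6 (by norm_num)).tendsto_zero (by norm_num))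

/-- The derivative of u / Ai is the Wronskian divided by Ai², of rate 12 - 6 = 6. Integrating from
the limit 1 and multiplying by Ai gives rate 9. -/
lemma IsHastingsMcLeod.isOG_sub {u : ℝ → ℝ} (hu : IsHastingsMcLeod u) : OG (fun t => u t - airyAi t) (-(7 / 4)) 9 := by
  have h1 : OG (fun t => u t / airyAi t - 1) (-(3 / 2)) 6 := by
    refine OG.of_deriv (k := -1) (f' := fun t =>
      (deriv u t * airyAi t - u t * airyAi' t) * ((airyAi t)⁻¹ * (airyAi t)⁻¹)) ?_ ?_ ?_
      (by norm_num) _ (by norm_num)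
    · filter_upwards [isWKB_airyAi.ne_zero] with t ht
      refine (((hu.hasDerivAt t).div (hasDerivAt_airyAi t) ht).sub_const 1).congr_deriv ?_
      field_simp
    · exact hu.isOG_wronskian.mul (isWKB_airyAi.isOG_inv.mul isWKB_airyAi.isOG_inv
        (1 / 2) (-6) (by norm_num)) (-1) 6 (by norm_num)
    · simpa using hu.tendsto_div.sub_const 1
  refine (h1.mul isWKB_airyAi.isOG (-(7 / 4)) 9 (by norm_num)).congr ?_
  filter_upwards [isWKB_airyAi.ne_zero] with t ht
  field_simp

lemma IsHastingsMcLeod.isOG_deriv_sub {u : ℝ → ℝ} (hu : IsHastingsMcLeod u) : OG (fun t => deriv u t - airyAi' t) (-(5 / 4)) 9 := by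
  have h1 := hu.isOG_wronskian.mul isWKB_airyAi.isOG_inv (-(5 / 4)) 9 (by norm_num)
  have h2 := isWKB_airyAi.isOG_deriv.mul isWKB_airyAi.isOG_inv (1 / 2) 0 (by norm_num)
  have h3 := hu.isOG_sub.mul h2 (-(5 / 4)) 9 (by norm_num)
  refine (h1.add h3).congr ?_
  filter_upwards [isWKB_airyAi.ne_zero] with t ht
  field_simp
  ring

/-- The equation for u is nonlinear, so the WKB property is carried over from Ai: the differences u
- Ai and u' - Ai' have rate 9 against 3. -/
lemma IsHastingsMcLeod.isWKB {u : ℝ → ℝ} (hu : IsHastingsMcLeod u) : IsWKB 3 u (deriv u) := by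
  have hinv : OG (fun t => (u t)⁻¹) (1 / 4) (-3) :=
    (OG.inv_of_sub isWKB_airyAi.isOG_inv hu.isOG_sub (by norm_num) isWKB_airyAi.ne_zero).1
  have h1 : OG (fun t => deriv u t - wkbLog 3 t * u t) (-(11 / 4)) 3 := by
    have h2 := hu.isOG_deriv_sub.weaken (-(11 / 4)) 3 (by norm_num)
    have h3 := (OG_wkbLog 3).mul hu.isOG_sub (-(11 / 4)) 3 (by norm_num)
    refine ((isWKB_airyAi.isOG_log_deriv.add h2).sub h3).congr (Eventually.of_forall fun t => ?_)
    ring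
  have h4 : OG (fun t => (deriv u t - wkbLog 3 t * u t) * (u t)⁻¹) (-(5 / 2)) 0 :=
    h1.mul hinv _ _ (by norm_num)
  refine ⟨Eventually.of_forall hu.hasDerivAt, hu.pos, ?_, ?_⟩
  · obtain ⟨K, hK⟩ := h4.bound
    refine ⟨K, ?_⟩
    filter_upwards [hK, hu.pos, eventually_gt_atTop 0] with t h1 h2 h3
    rw [expScale_zero, Real.norm_eq_abs, abs_mul, abs_inv, abs_of_pos h2,
      ← div_eq_mul_inv, div_le_iff₀ h2, Real.norm_of_nonneg (by positivity)] at h1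
    exact h1
  · obtain ⟨c, hc, ht⟩ := isWKB_airyAi.tendsto
    refine ⟨c, hc, ?_⟩
    have h5 := hu.tendsto_div.mul ht
    rw [one_mul] at h5
    refine h5.congr' ?_
    filter_upwards [isWKB_airyAi.ne_zero] with t h6
    field_simp

/-! ### Asymptotics of Φ₀₁, Φ₀₂ and the mixed Airy integral -/

lemma Phi01_spec {u : ℝ → ℝ} (hu : IsHastingsMcLeod u) : (∀ t, HasDerivAt (Phi01 u) (1 / 3 * deriv u t * scBi t + u t * dscBi t) t) ∧
    Tendsto (Phi01 u) Filter.atTop (𝓝 0) := by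
  have e : (fun s => 1 / 3 * deriv u s * scBi s + 1 / (3 : ℝ) ^ (2 / 3 : ℝ) * u s * scBi' s) =
      fun t => 1 / 3 * deriv u t * scBi t + u t * dscBi t := by
    funext t; rw [dscBi, airyScaling]; ring
  have h : Phi01 u = intFromTop (fun t => 1 / 3 * deriv u t * scBi t + u t * dscBi t) := by
    funext t; rw [Phi01, e]
  rw [h]
  have h1 := (hu.isWKB.isOG_deriv.const_mul (1 / 3)).mul isWKB_scBi.isOG 0 2 (by norm_num)
  have h2 := hu.isWKB.isOG.mul isWKB_scBi.isOG_deriv 0 2 (by norm_num)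
  refine intFromTop_spec ?_ (h1.add h2) (by norm_num)
  have := hu.continuous
  have := hu.continuous_deriv
  have := continuous_scBi
  have := continuous_dscBi
  fun_prop

lemma Phi02_spec {u : ℝ → ℝ} (hu : IsHastingsMcLeod u) : (∀ t, HasDerivAt (Phi02 u) (1 / 3 * deriv u t * scAi t + u t * dscAi t) t) ∧
    Tendsto (Phi02 u) Filter.atTop (𝓝 0) := by
  have e : (fun s => 1 / 3 * deriv u s * scAi s + 1 / (3 : ℝ) ^ (2 / 3 : ℝ) * u s * scAi' s) =
      fun t => 1 / 3 * deriv u t * scAi t + u t * dscAi t := by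
    funext t; rw [dscAi, airyScaling]; ring
  have h : Phi02 u = intFromTop (fun t => 1 / 3 * deriv u t * scAi t + u t * dscAi t) := by
    funext t; rw [Phi02, e]
  rw [h]
  have h1 := (hu.isWKB.isOG_deriv.const_mul (1 / 3)).mul isWKB_scAi.isOG 0 4 (by norm_num)
  have h2 := hu.isWKB.isOG.mul isWKB_scAi.isOG_deriv 0 4 (by norm_num)
  refine intFromTop_spec ?_ (h1.add h2) (by norm_num)
  have := hu.continuous
  have := hu.continuous_deriv
  have := continuous_scAi
  have := continuous_dscAi
  fun_prop

/-- To leading order the integrand is (-1/3 - 1/3) √t u Ai(t̂), while (u Ai(t̂))' is (-1 - 1/3) √t u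
Ai(t̂); hence the factor 1/2. -/
lemma Phi02_isOG_sub {u : ℝ → ℝ} (hu : IsHastingsMcLeod u) : OG (fun t => Phi02 u t - 1 / 2 * (u t * scAi t)) (-2) 4 := by
  refine OG.of_deriv (k := -(3 / 2)) (f' := fun t => 1 / 3 * deriv u t * scAi t + u t * dscAi t -
    1 / 2 * (deriv u t * scAi t + u t * dscAi t)) (Eventually.of_forall fun t => ?_) ?_ ?_
    (by norm_num) _ (by norm_num)
  · exact ((Phi02_spec hu).1 t).sub
      (((hu.hasDerivAt t).mul (hasDerivAt_scAi t)).const_mul (1 / 2))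
  · have h1 := hu.isWKB.isOG_log_deriv.mul isWKB_scAi.isOG (-(3 / 2)) 4 (by norm_num)
    have h2 := hu.isWKB.isOG.mul isWKB_scAi.isOG_log_deriv (-(3 / 2)) 4 (by norm_num)
    have h3 := OG_inv_id.mul (hu.isWKB.isOG.mul isWKB_scAi.isOG (-(1 / 2)) 4 (by norm_num))
      (-(3 / 2)) 4 (by norm_num)
    refine (((h1.const_mul (-(1 / 6))).add (h2.const_mul (1 / 2))).add
      (h3.const_mul (-(1 / 12)))).congr ?_
    filter_upwards [eventually_gt_atTop 0] with t ht
    unfold wkbLog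
    field_simp
    ring
  · have := (Phi02_spec hu).2.sub (((hu.isWKB.isOG.mul isWKB_scAi.isOG (-(1 / 2)) 4
      (by norm_num)).tendsto_zero (by norm_num)).const_mul (1 / 2))
    rwa [mul_zero, sub_zero] at this

/-- For Bi(t̂) the two √t terms cancel, leaving -(1/(3t)) u Bi(t̂), whereas (u Bi(t̂))' is -(2/3) √t
u Bi(t̂) to leading order. The primitive is therefore smaller by t^{-3/2}, which makes q grow like
t^{3/2} in class B. -/
lemma Phi01_isOG_sub {u : ℝ → ℝ} (hu : IsHastingsMcLeod u) :
    OG (fun t => Phi01 u t - 1 / 2 * (t ^ (-(3 / 2) : ℝ) * (u t * scBi t))) (-(7 / 2)) 2 := by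
  have hub := hu.isWKB.isOG.mul isWKB_scBi.isOG (-(1 / 2)) 2 (by norm_num)
  refine OG.of_deriv (k := -3) (f' := fun t => 1 / 3 * deriv u t * scBi t + u t * dscBi t -
    1 / 2 * (-(3 / 2) * t ^ (-(3 / 2) - 1 : ℝ) * (u t * scBi t) + t ^ (-(3 / 2) : ℝ) *
      (deriv u t * scBi t + u t * dscBi t))) ?_ ?_ ?_ (by norm_num) _ (by norm_num)
  · filter_upwards [eventually_gt_atTop 0] with t ht
    exact ((Phi01_spec hu).1 t).sub (((Real.hasDerivAt_rpow_const (Or.inl ht.ne')).mul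
      ((hu.hasDerivAt t).mul (hasDerivAt_scBi t))).const_mul (1 / 2))
  · have h1 := hu.isWKB.isOG_log_deriv.mul isWKB_scBi.isOG (-3) 2 (by norm_num)
    have h2 := hu.isWKB.isOG.mul isWKB_scBi.isOG_log_deriv (-3) 2 (by norm_num)
    have h3 := (OG.rpow (-(5 / 2))).mul hub (-3) 2 (by norm_num)
    have h4 := (OG.rpow (-(3 / 2))).mul (h1.add h2) (-3) 2 (by norm_num)
    refine ((((h1.const_mul (1 / 3)).add h2).add h3).sub (h4.const_mul (1 / 2))).congr ?_
    filter_upwards [eventually_gt_atTop 0] with t ht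
    have e1 : t ^ (-(3 / 2) - 1 : ℝ) = t ^ (-(5 / 2) : ℝ) := by norm_num
    have e2 : t ^ (-(3 / 2) : ℝ) = t ^ (-(5 / 2) : ℝ) * t := by
      rw [← Real.rpow_add_one ht.ne']; norm_num
    have e3 : t ^ (-(5 / 2) : ℝ) * Real.sqrt t = 1 / t ^ 2 := rpow_neg_five_halves_mul_sqrt ht
    have e4 : t * t⁻¹ = 1 := mul_inv_cancel₀ ht.ne'
    have e5 : t * t ^ (-(5 / 2) : ℝ) * Real.sqrt t = t⁻¹ := by
      rw [mul_assoc, e3]; field_simp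
    rw [e1, e2]
    simp only [wkbLog, one_div, mul_inv]
    linear_combination (-(1 / 3) * u t * scBi t) * e5 -
      (1 / 4 * t ^ (-(5 / 2) : ℝ) * u t * scBi t) * e4
  · have := (Phi01_spec hu).2.sub ((((OG.rpow (-(3 / 2))).mul hub (-2) 2
      (by norm_num)).tendsto_zero (by norm_num)).const_mul (1 / 2))
    rwa [mul_zero, sub_zero] at this

lemma Phi01_inv {u : ℝ → ℝ} (hu : IsHastingsMcLeod u) :
    OG (fun t => (Phi01 u t)⁻¹) 2 (-2) ∧
      Tendsto (fun t => Phi01 u t / (1 / 2 * (t ^ (-(3 / 2) : ℝ) * (u t * scBi t)))) atTop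
        (𝓝 1) := by
  refine OG.inv_of_sub ?_ (Phi01_isOG_sub hu) (by norm_num) ?_
  · have h := ((OG.rpow (3 / 2)).mul (hu.isWKB.isOG_inv.mul isWKB_scBi.isOG_inv (1 / 2) (-2)
      (by norm_num)) 2 (-2) (by norm_num)).const_mul 2
    refine h.congr ?_
    filter_upwards [eventually_gt_atTop 0] with t ht
    rw [Real.rpow_neg ht.le]
    simp only [mul_inv, inv_inv, one_div]
  · filter_upwards [eventually_gt_atTop 0, hu.pos, isWKB_scBi.pos] with t h1 h2 h3
    positivity

lemma Phi02_isOG {u : ℝ → ℝ} (hu : IsHastingsMcLeod u) : OG (Phi02 u) (-(1 / 2)) 4 := by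
  have h := (hu.isWKB.isOG.mul isWKB_scAi.isOG (-(1 / 2)) 4 (by norm_num)).const_mul (1 / 2)
  exact (((Phi02_isOG_sub hu).weaken _ _ (by norm_num)).add h).congr
    (Eventually.of_forall fun t => by ring)

lemma airyMixedInt_spec : (∀ t, HasDerivAt airyMixedInt
      (1 / 3 * airyAi' t * scBi t + airyAi t * dscBi t) t) ∧
    OG airyMixedInt (-(1 / 2)) 2 := by
  have e : airyMixedInt =
      intFromTop fun t => 1 / 3 * airyAi' t * scBi t + airyAi t * dscBi t := by
    funext t
    rw [airyMixedInt, deriv_airyAi]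
    congr 1
    funext s
    rw [dscBi, airyScaling]; ring
  have h1 := (isWKB_airyAi.isOG_deriv.const_mul (1 / 3)).mul isWKB_scBi.isOG 0 2 (by norm_num)
  have h2 := isWKB_airyAi.isOG.mul isWKB_scBi.isOG_deriv 0 2 (by norm_num)
  have h := intFromTop_spec ?_ (h1.add h2) (by norm_num)
  · rw [e]
    exact ⟨h.1, OG.of_deriv (Eventually.of_forall h.1) (h1.add h2) h.2 (by norm_num) _
      (by norm_num)⟩
  · have := continuous_airyAi
    have := continuous_airyAi'
    have := continuous_scBi
    have := continuous_dscBi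
    fun_prop

/-- Replacing u by Ai costs rate 9 - 1 = 8, which is negligible in class A; this is why Ai alone can
appear in the quadratic terms there. -/
lemma Phi01_sub_airyMixedInt {u : ℝ → ℝ} (hu : IsHastingsMcLeod u) :
    OG (fun t => Phi01 u t - airyMixedInt t) (-2) 8 := by
  refine OG.of_deriv (k := -(3 / 2))
    (Eventually.of_forall fun t => ((Phi01_spec hu).1 t).sub (airyMixedInt_spec.1 t)) ?_ ?_
    (by norm_num) _ (by norm_num)
  · have h1 := (hu.isOG_deriv_sub.const_mul (1 / 3)).mul isWKB_scBi.isOG (-(3 / 2)) 8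
      (by norm_num)
    have h2 := hu.isOG_sub.mul isWKB_scBi.isOG_deriv (-(3 / 2)) 8 (by norm_num)
    exact (h1.add h2).congr (Eventually.of_forall fun t => by ring)
  · have h := (Phi01_spec hu).2.sub (airyMixedInt_spec.2.tendsto_zero (by norm_num))
    rw [sub_zero] at h
    exact h

/-! ### Linear systems with exponentially small coefficients -/

section LinearSystem

/-- `η` solves the linear system `η i' = ∑ j, c i j * η j` near `+∞`. -/
def SolvesLinear {ι : Type*} [Fintype ι] (c : ι → ι → ℝ → ℝ) (η : ι → ℝ → ℝ) : Prop :=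
  ∀ᶠ t in atTop, ∀ i, HasDerivAt (η i) (∑ j, c i j t * η j t) t

variable {ι : Type*} [Fintype ι] {c : ι → ι → ℝ → ℝ} {η : ι → ℝ → ℝ} {m : ℝ}

lemma SolvesLinear.sub {θ : ι → ℝ → ℝ} (h : SolvesLinear c η) (h' : SolvesLinear c θ) :
    SolvesLinear c (fun i t => η i t - θ i t) := by
  filter_upwards [h, h'] with t h1 h2 i
  refine ((h1 i).sub (h2 i)).congr_deriv ?_
  simp only [mul_sub, Finset.sum_sub_distrib]

lemma SolvesLinear.const_mul (h : SolvesLinear c η) (a : ℝ) :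
    SolvesLinear c (fun i t => a * η i t) := by
  filter_upwards [h] with t h1 i
  refine ((h1 i).const_mul a).congr_deriv ?_
  rw [Finset.mul_sum]
  exact Finset.sum_congr rfl fun j _ => by ring

/-- The squared length of a solution changes at an integrable relative rate. -/
lemma SolvesLinear.exists_energy_bound (h : SolvesLinear c η) (hm : 0 < m)
    (hc : ∀ i j, OG (c i j) 0 m) :
    ∃ N' g g' : ℝ → ℝ, (∀ᶠ t in atTop, HasDerivAt (fun t => ∑ i, η i t ^ 2) (N' t) t) ∧
      (∀ᶠ t in atTop, HasDerivAt g (g' t) t) ∧ Tendsto g atTop (𝓝 0) ∧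
      ∀ᶠ t in atTop, |N' t| ≤ -g' t * ∑ i, η i t ^ 2 := by
  have hC : OG (fun t => ∑ i, ∑ j, |c i j t|) 0 m :=
    IsBigO.fun_sum fun i _ => IsBigO.fun_sum fun j _ => (hc i j).norm_left
  obtain ⟨C, hC0, hb⟩ := hC.exists_nonneg
  obtain ⟨g, g', hg, hle, hg0⟩ := exists_expScale_majorant 0 hm (by positivity : 0 ≤ 2 * C)
  refine ⟨fun t => ∑ i, 2 * η i t * ∑ j, c i j t * η j t, g, g', ?_, hg,
    hg0.tendsto_zero (Or.inl hm), ?_⟩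
  · filter_upwards [h] with t ht
    refine (HasDerivAt.fun_sum fun i _ => (ht i).pow 2).congr_deriv ?_
    exact Finset.sum_congr rfl fun i _ => by simp
  · filter_upwards [hle, hb.bound, eventually_gt_atTop 0] with t h1 h2 h3
    rw [Real.norm_of_nonneg (Finset.sum_nonneg fun i _ => Finset.sum_nonneg fun j _ =>
      abs_nonneg _), Real.norm_of_nonneg (expScale_pos _ _ h3).le] at h2
    set N := ∑ i, η i t ^ 2 with hN
    have hN0 : 0 ≤ N := Finset.sum_nonneg fun i _ => sq_nonneg _
    have hi : ∀ i, η i t ^ 2 ≤ N := fun i =>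
      Finset.single_le_sum (f := fun i => η i t ^ 2) (fun i _ => sq_nonneg _) (Finset.mem_univ i)
    have hij : ∀ i j, |2 * η i t * (c i j t * η j t)| ≤ |c i j t| * (2 * N) := by
      intro i j
      -- Each squared entry is at most N, so the arithmetic-geometric mean inequality suffices.
      have : |η i t| * |η j t| ≤ N := by
        have := two_mul_le_add_sq (|η i t|) (|η j t|)
        rw [sq_abs, sq_abs] at this
        linarith [hi i, hi j]
      calc |2 * η i t * (c i j t * η j t)| = |c i j t| * (2 * (|η i t| * |η j t|)) := by
            rw [abs_mul, abs_mul, abs_mul, abs_two]; ring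
        _ ≤ _ := by gcongr
    calc |∑ i, 2 * η i t * ∑ j, c i j t * η j t|
        ≤ ∑ i, ∑ j, |c i j t| * (2 * N) := by
          refine (Finset.abs_sum_le_sum_abs _ _).trans (Finset.sum_le_sum fun i _ => ?_)
          rw [Finset.mul_sum]
          exact (Finset.abs_sum_le_sum_abs _ _).trans (Finset.sum_le_sum fun j _ => hij i j)
      _ = (∑ i, ∑ j, |c i j t|) * (2 * N) := by simp only [Finset.sum_mul]
      _ ≤ (C * expScale 0 m t) * (2 * N) := by gcongr
      _ = (2 * C * expScale 0 m t) * N := by ring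
      _ ≤ _ := by gcongr

/-- Grönwall in both directions. The nonincreasing quantity bounds solutions; the nondecreasing one
prevents a nonzero solution from tending to 0. -/
lemma SolvesLinear.exists_energy_monotone (h : SolvesLinear c η) (hm : 0 < m)
    (hc : ∀ i j, OG (c i j) 0 m) :
    ∃ (g : ℝ → ℝ) (T : ℝ), Tendsto g atTop (𝓝 0) ∧
      AntitoneOn (fun t => (∑ i, η i t ^ 2) * Real.exp (g t)) (Ici T) ∧
      MonotoneOn (fun t => (∑ i, η i t ^ 2) * Real.exp (-g t)) (Ici T) := by
  obtain ⟨N', g, g', hN, hg, hg0, hle⟩ := h.exists_energy_bound hm hc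
  obtain ⟨T, hT⟩ := eventually_atTop.1 (hN.and (hg.and hle))
  refine ⟨g, T, hg0, ?_, ?_⟩
  · have := monotoneOn_Ici_of_hasDerivAt (fun x hx => ((hT x hx).1.mul (hT x hx).2.1.exp).neg)
      (fun x hx => ?_)
    · intro x hx y hy hxy
      simpa using this hx hy hxy
    · have h1 := (abs_le.1 (hT x hx).2.2).2
      have h2 := Real.exp_pos (g x)
      nlinarith
  · refine monotoneOn_Ici_of_hasDerivAt (fun x hx => (hT x hx).1.mul (hT x hx).2.1.neg.exp)
      (fun x hx => ?_)
    have h1 := (abs_le.1 (hT x hx).2.2).1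
    have h2 := Real.exp_pos (-g x)
    simp only [Pi.neg_apply]
    nlinarith

lemma SolvesLinear.isOG (h : SolvesLinear c η) (hm : 0 < m) (hc : ∀ i j, OG (c i j) 0 m)
    (i : ι) : OG (η i) 0 0 := by
  obtain ⟨g, T, hg, ha, -⟩ := h.exists_energy_monotone hm hc
  set B := (∑ i, η i T ^ 2) * Real.exp (g T) with hB
  have h1 : Tendsto (fun t => B * Real.exp (-g t)) atTop (𝓝 (B * Real.exp (-0))) :=
    ((Real.continuous_exp.tendsto _).comp hg.neg).const_mul B
  have h2 : (fun t => η i t ^ 2) =O[atTop] fun t => (1 : ℝ) ^ 2 := by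
    have h3 := h1.isBigO_one ℝ
    refine IsBigO.trans (IsBigO.of_bound 1 ?_) (h3.congr_right fun t => (one_pow 2).symm)
    filter_upwards [eventually_ge_atTop T] with t ht
    have h4 := ha (mem_Ici.2 le_rfl) (mem_Ici.2 ht) ht
    have h5 : η i t ^ 2 ≤ ∑ i, η i t ^ 2 :=
      Finset.single_le_sum (f := fun i => η i t ^ 2) (fun i _ => sq_nonneg _) (Finset.mem_univ i)
    rw [one_mul, Real.norm_of_nonneg (sq_nonneg _)]
    refine le_trans ?_ (le_abs_self _)
    rw [Real.exp_neg, ← div_eq_mul_inv, le_div_iff₀ (Real.exp_pos _)]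
    exact (mul_le_mul_of_nonneg_right h5 (Real.exp_pos _).le).trans h4
  have h3 : η i =O[atTop] fun _ => (1 : ℝ) := IsBigO.of_pow two_ne_zero h2
  rw [OG, expScale_zero]
  simpa using h3

lemma SolvesLinear.exists_tendsto (h : SolvesLinear c η) (hm : 0 < m)
    (hc : ∀ i j, OG (c i j) 0 m) (i : ι) : ∃ L, Tendsto (η i) atTop (𝓝 L) := by
  refine OG.exists_tendsto_of_deriv (k := 0) (m := m) (f' := fun t => ∑ j, c i j t * η j t)
    (h.mono fun t ht => ht i) ?_ hm
  exact IsBigO.fun_sum fun j _ => (hc i j).mul (h.isOG hm hc j) 0 m (by simp)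

lemma SolvesLinear.eventually_eq_zero (h : SolvesLinear c η) (hm : 0 < m)
    (hc : ∀ i j, OG (c i j) 0 m) (h0 : ∀ i, Tendsto (η i) atTop (𝓝 0)) :
    ∀ᶠ t in atTop, ∀ i, η i t = 0 := by
  obtain ⟨g, T, hg, -, hmono⟩ := h.exists_energy_monotone hm hc
  have h1 : Tendsto (fun t => (∑ i, η i t ^ 2) * Real.exp (-g t)) atTop (𝓝 0) := by
    have e1 : Tendsto (fun t => ∑ i, η i t ^ 2) atTop (𝓝 (∑ i : ι, (0 : ℝ) ^ 2)) :=
      tendsto_finsetSum _ fun i _ => (h0 i).pow 2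
    have e2 := e1.mul ((Real.continuous_exp.tendsto _).comp hg.neg)
    simpa using e2
  filter_upwards [eventually_ge_atTop T] with t ht
  have h2 : (∑ i, η i t ^ 2) * Real.exp (-g t) ≤ 0 := ge_of_tendsto h1 <| by
    filter_upwards [eventually_ge_atTop t] with s hs
    exact hmono (mem_Ici.2 ht) (mem_Ici.2 (ht.trans hs)) hs
  have h3 : ∑ i, η i t ^ 2 ≤ 0 := nonpos_of_mul_nonpos_left h2 (Real.exp_pos _)
  have h4 : ∑ i, η i t ^ 2 = 0 := le_antisymm h3 (Finset.sum_nonneg fun i _ => sq_nonneg _)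
  intro i
  have := (Finset.sum_eq_zero_iff_of_nonneg fun i _ => sq_nonneg (η i t)).1 h4 i (Finset.mem_univ i)
  exact pow_eq_zero_iff two_ne_zero |>.1 this

/-- In the variable τ = 1/t a coefficient f becomes -f(1/τ)/τ², which tends to 0 as τ decreases to
0. The convention 0⁻¹ = 0 gives the expression exactly this value at τ = 0. -/
lemma continuousOn_inverted_coefficient {f : ℝ → ℝ} (hf : Continuous f) (hm : 0 < m)
    (h : OG f 0 m) : ContinuousOn (fun τ : ℝ => -τ⁻¹ ^ 2 * f τ⁻¹) (Ici 0) := by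
  intro τ hτ
  rcases (mem_Ici.1 hτ).eq_or_lt with rfl | hpos
  · rw [← continuousWithinAt_Ioi_iff_Ici, ContinuousWithinAt]
    have h1 : Tendsto (fun t : ℝ => -t ^ 2 * f t) atTop (𝓝 0) := by
      have h2 := ((OG.rpow 2).mul h 2 m (by simp)).const_mul (-1)
      refine (h2.tendsto_zero (Or.inl hm)).congr fun t => ?_
      rw [Real.rpow_two]; ring
    have h3 := h1.comp tendsto_inv_nhdsGT_zero
    refine (h3.congr fun τ => rfl).trans (by simp)
  · refine ContinuousAt.continuousWithinAt ?_
    have h1 : ContinuousAt (fun τ : ℝ => τ⁻¹) τ := continuousAt_inv₀ hpos.ne'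
    exact ((h1.pow 2).neg).mul (hf.continuousAt.comp h1)

/-- A linear system with exponentially small coefficients has solutions with any prescribed limit
at infinity: in the variable `1 / t` this is an initial value problem at `0`. -/
lemma exists_solvesLinear (hm : 0 < m) (hc : ∀ i j, OG (c i j) 0 m)
    (hcont : ∀ i j, Continuous (c i j)) (L : ι → ℝ) :
    ∃ η : ι → ℝ → ℝ, SolvesLinear c η ∧ ∀ i, Tendsto (η i) atTop (𝓝 (L i)) := by
  set d : ι → ι → ℝ → ℝ := fun i j τ => -τ⁻¹ ^ 2 * c i j τ⁻¹ with hd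
  have hdc : ∀ i j, ContinuousOn (d i j) (Ici 0) := fun i j =>
    continuousOn_inverted_coefficient (hcont i j) hm (hc i j)
  have hd0 : ∀ i j, d i j 0 = 0 := fun i j => by simp [hd]
  obtain ⟨δ, hδ0, hδ1, hδ⟩ : ∃ δ : ℝ, 0 < δ ∧ δ ≤ 1 / 2 ∧
      ∀ τ ∈ Icc 0 δ, ∀ i, ∑ j, |d i j τ| ≤ 1 := by
    have h1 : ∀ i, ContinuousOn (fun τ => ∑ j, |d i j τ|) (Ici 0) := fun i =>
      continuousOn_finsetSum _ fun j _ => (hdc i j).abs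
    have h2 : ∀ᶠ τ in 𝓝[≥] (0 : ℝ), ∀ i, ∑ j, |d i j τ| ≤ 1 := by
      refine eventually_all.2 fun i => ?_
      have h3 := (h1 i 0 (mem_Ici.2 le_rfl)).tendsto
      simp only [hd0, abs_zero, Finset.sum_const_zero] at h3
      exact (h3.eventually_lt_const one_pos).mono fun τ hτ => hτ.le
    obtain ⟨δ, hδ, hsub⟩ := mem_nhdsGE_iff_exists_Icc_subset.1 h2
    refine ⟨min δ (1 / 2), lt_min hδ (by norm_num), min_le_right _ _, fun τ hτ => ?_⟩
    exact hsub ⟨hτ.1, hτ.2.trans (min_le_left _ _)⟩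
  set f : ℝ → (ι → ℝ) → (ι → ℝ) := fun τ x i => ∑ j, d i j τ * x j with hf
  have hlin : ∀ τ ∈ Icc 0 δ, ∀ x, ‖f τ x‖ ≤ ‖x‖ := by
    intro τ hτ x
    refine (pi_norm_le_iff_of_nonneg (norm_nonneg x)).2 fun i => ?_
    calc ‖∑ j, d i j τ * x j‖ ≤ ∑ j, |d i j τ| * ‖x‖ := by
          refine norm_sum_le_of_le _ fun j _ => ?_
          rw [norm_mul]
          exact mul_le_mul_of_nonneg_left (norm_le_pi_norm x j) (norm_nonneg _)
      _ = (∑ j, |d i j τ|) * ‖x‖ := by rw [Finset.sum_mul]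
      _ ≤ 1 * ‖x‖ := by gcongr; exact hδ τ hτ i
      _ = ‖x‖ := one_mul _
  -- On [0, δ] the field satisfies ‖f(τ, x)‖ ≤ ‖x‖ and is linear in x, so it is 1-Lipschitz and at
  -- most 2‖L‖ + 1 on the ball of radius ‖L‖ + 1 about L. The choice δ ≤ 1/2 keeps (2‖L‖ + 1) δ
  -- within that radius.
  have hpl : IsPicardLindelof f (tmin := 0) (tmax := δ) ⟨0, le_rfl, hδ0.le⟩ L (‖L‖₊ + 1) 0
      (2 * ‖L‖₊ + 1) 1 := by
    constructor
    · intro τ hτ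
      refine LipschitzOnWith.of_dist_le_mul fun x _ y _ => ?_
      rw [dist_eq_norm, dist_eq_norm, NNReal.coe_one, one_mul]
      have : f τ x - f τ y = f τ (x - y) := by
        funext i
        simp only [hf, Pi.sub_apply, mul_sub, Finset.sum_sub_distrib]
      rw [this]
      exact hlin τ hτ _
    · intro x _
      refine continuousOn_pi.2 fun i => continuousOn_finsetSum _ fun j _ => ?_
      exact ((hdc i j).mono fun τ hτ => hτ.1).mul continuousOn_const
    · intro τ hτ x hx
      refine (hlin τ hτ x).trans ?_
      have h1 : ‖x - L‖ ≤ ‖L‖ + 1 := by simpa [dist_eq_norm] using hx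
      have h2 := norm_le_norm_sub_add x L
      push_cast
      linarith
    · push_cast
      simp only [sub_zero, sub_self, max_eq_left hδ0.le]
      nlinarith [norm_nonneg L]
  obtain ⟨α, hα0, hα⟩ := hpl.exists_eq_forall_mem_Icc_hasDerivWithinAt₀
  refine ⟨fun i t => α t⁻¹ i, ?_, fun i => ?_⟩
  · filter_upwards [eventually_gt_atTop 0, eventually_gt_atTop δ⁻¹] with t h1 h2 i
    have h3 : t⁻¹ ∈ Ioo 0 δ := ⟨inv_pos.2 h1, inv_lt_of_inv_lt₀ hδ0 h2⟩
    have h4 := (hα t⁻¹ (Ioo_subset_Icc_self h3)).hasDerivAt (Icc_mem_nhds h3.1 h3.2)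
    have h5 := (hasDerivAt_pi.1 h4 i).comp t (hasDerivAt_inv h1.ne')
    refine h5.congr_deriv ?_
    simp only [hf, hd, inv_inv, Finset.sum_mul]
    refine Finset.sum_congr rfl fun j _ => ?_
    field_simp
  · have h1 := (hα 0 ⟨le_rfl, hδ0.le⟩).continuousWithinAt.tendsto
    have h2 : Tendsto (fun t : ℝ => t⁻¹) atTop (𝓝[Icc 0 δ] 0) := by
      refine tendsto_nhdsWithin_iff.2 ⟨tendsto_inv_atTop_zero, ?_⟩
      filter_upwards [eventually_gt_atTop 0, eventually_gt_atTop δ⁻¹] with t h1 h2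
      exact ⟨(inv_pos.2 h1).le, (inv_lt_of_inv_lt₀ hδ0 h2).le⟩
    have h3 := (tendsto_pi_nhds.1 (h1.comp h2)) i
    simp only at hα0
    rw [hα0] at h3
    exact h3

end LinearSystem

/-! ### Linearisation of the (q, α) system -/

/-- The inverse of the Wronskian of `scAi` and `scBi`. -/
def invWronskian : ℝ := Real.pi * airyScaling

lemma invWronskian_pos : 0 < invWronskian := mul_pos Real.pi_pos airyScaling_pos

lemma invWronskian_mul (t : ℝ) :
    invWronskian * (scAi t * dscBi t - dscAi t * scBi t) = 1 := by
  rw [sc_wronskian, ← invWronskian, mul_one_div_cancel invWronskian_pos.ne']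

/-- The right-hand side `f` of `x'' = t x / 9 + f` along `x = ξ₁ scBi + ξ₂ scAi`. -/
def forcing (u ξ₁ ξ₂ W : ℝ → ℝ) (t : ℝ) : ℝ :=
  2 / 9 * (u t * (u t * (ξ₁ t * scBi t + ξ₂ t * scAi t))) + 4 / 9 * (u t * W t)

/-- The integrand of `Phi01`. -/
def dPhi01 (u : ℝ → ℝ) (t : ℝ) : ℝ := 1 / 3 * deriv u t * scBi t + u t * dscBi t

/-- The integrand of `Phi02`. -/
def dPhi02 (u : ℝ → ℝ) (t : ℝ) : ℝ := 1 / 3 * deriv u t * scAi t + u t * dscAi t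

/-- The linear system (in variation of constants form) whose projectivisation is the
`(q, α)` system. -/
structure LinSol (u ξ₁ ξ₂ W : ℝ → ℝ) : Prop where
  deriv₁ : ∀ᶠ t in atTop, HasDerivAt ξ₁ (invWronskian * (scAi t * forcing u ξ₁ ξ₂ W t)) t
  deriv₂ : ∀ᶠ t in atTop, HasDerivAt ξ₂ (-invWronskian * (scBi t * forcing u ξ₁ ξ₂ W t)) t
  deriv₃ : ∀ᶠ t in atTop, HasDerivAt W (ξ₁ t * dPhi01 u t + ξ₂ t * dPhi02 u t) t

/-- The coefficients of the linear system. -/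
def linCoeff (u : ℝ → ℝ) : Fin 3 → Fin 3 → ℝ → ℝ :=
  ![![fun t => 2 / 9 * invWronskian * (scAi t * (u t * (u t * scBi t))),
      fun t => 2 / 9 * invWronskian * (scAi t * (u t * (u t * scAi t))),
      fun t => 4 / 9 * invWronskian * (scAi t * u t)],
    ![fun t => -(2 / 9) * invWronskian * (scBi t * (u t * (u t * scBi t))),
      fun t => -(2 / 9) * invWronskian * (scBi t * (u t * (u t * scAi t))),
      fun t => -(4 / 9) * invWronskian * (scBi t * u t)],
    ![dPhi01 u, dPhi02 u, fun _ => 0]]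

lemma linSol_iff {u ξ₁ ξ₂ W : ℝ → ℝ} :
    LinSol u ξ₁ ξ₂ W ↔ SolvesLinear (linCoeff u) ![ξ₁, ξ₂, W] := by
  have e0 : ∀ t, invWronskian * (scAi t * forcing u ξ₁ ξ₂ W t) =
      ∑ j, linCoeff u 0 j t * (![ξ₁, ξ₂, W] : Fin 3 → ℝ → ℝ) j t := by
    intro t; simp [Fin.sum_univ_three, linCoeff, forcing]; ring
  have e1 : ∀ t, -invWronskian * (scBi t * forcing u ξ₁ ξ₂ W t) =
      ∑ j, linCoeff u 1 j t * (![ξ₁, ξ₂, W] : Fin 3 → ℝ → ℝ) j t := by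
    intro t; simp [Fin.sum_univ_three, linCoeff, forcing]; ring
  have e2 : ∀ t, ξ₁ t * dPhi01 u t + ξ₂ t * dPhi02 u t =
      ∑ j, linCoeff u 2 j t * (![ξ₁, ξ₂, W] : Fin 3 → ℝ → ℝ) j t := by
    intro t; simp [Fin.sum_univ_three, linCoeff]; ring
  constructor
  · rintro ⟨h1, h2, h3⟩
    filter_upwards [h1, h2, h3] with t h1 h2 h3
    rw [e0] at h1
    rw [e1] at h2
    rw [e2] at h3
    intro i
    fin_cases i
    exacts [h1, h2, h3]
  · intro h
    refine ⟨?_, ?_, ?_⟩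
    · filter_upwards [h] with t ht
      rw [e0]; exact ht 0
    · filter_upwards [h] with t ht
      rw [e1]; exact ht 1
    · filter_upwards [h] with t ht
      rw [e2]; exact ht 2

lemma isOG_dPhi01 {u : ℝ → ℝ} (hu : IsHastingsMcLeod u) : OG (dPhi01 u) 0 2 :=
  ((hu.isWKB.isOG_deriv.const_mul (1 / 3)).mul isWKB_scBi.isOG 0 2 (by norm_num)).add
    (hu.isWKB.isOG.mul isWKB_scBi.isOG_deriv 0 2 (by norm_num))

lemma isOG_dPhi02 {u : ℝ → ℝ} (hu : IsHastingsMcLeod u) : OG (dPhi02 u) 0 4 :=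
  ((hu.isWKB.isOG_deriv.const_mul (1 / 3)).mul isWKB_scAi.isOG 0 4 (by norm_num)).add
    (hu.isWKB.isOG.mul isWKB_scAi.isOG_deriv 0 4 (by norm_num))

/-- The slowest entries are `dPhi01` and the product of u with Bi(t̂), of rate 3 - 1 = 2. Every
other entry decays faster. -/
lemma isOG_linCoeff {u : ℝ → ℝ} (hu : IsHastingsMcLeod u) (i j : Fin 3) :
    OG (linCoeff u i j) 0 2 := by
  have hU := hu.isWKB.isOG
  have hA := isWKB_scAi.isOG
  have hB := isWKB_scBi.isOG
  have hUB := hU.mul (hU.mul hB (-(1 / 2)) 2 (by norm_num)) (-(3 / 4)) 5 (by norm_num)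
  have hUA := hU.mul (hU.mul hA (-(1 / 2)) 4 (by norm_num)) (-(3 / 4)) 7 (by norm_num)
  fin_cases i <;> fin_cases j
  · exact (hA.mul hUB 0 2 (by norm_num)).const_mul _
  · exact (hA.mul hUA 0 2 (by norm_num)).const_mul _
  · exact (hA.mul hU 0 2 (by norm_num)).const_mul _
  · exact (hB.mul hUB 0 2 (by norm_num)).const_mul _
  · exact (hB.mul hUA 0 2 (by norm_num)).const_mul _
  · exact (hB.mul hU 0 2 (by norm_num)).const_mul _
  · exact isOG_dPhi01 hu
  · exact (isOG_dPhi02 hu).weaken 0 2 (by norm_num)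
  · exact isBigO_zero _ _

lemma continuous_linCoeff {u : ℝ → ℝ} (hu : IsHastingsMcLeod u) (i j : Fin 3) :
    Continuous (linCoeff u i j) := by
  have hU := hu.continuous
  have hU' := hu.continuous_deriv
  have hA := continuous_scAi
  have hB := continuous_scBi
  have hA' := continuous_dscAi
  have hB' := continuous_dscBi
  fin_cases i <;> fin_cases j
  · exact continuous_const.mul (hA.mul (hU.mul (hU.mul hB)))
  · exact continuous_const.mul (hA.mul (hU.mul (hU.mul hA)))
  · exact continuous_const.mul (hA.mul hU)
  · exact continuous_const.mul (hB.mul (hU.mul (hU.mul hB)))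
  · exact continuous_const.mul (hB.mul (hU.mul (hU.mul hA)))
  · exact continuous_const.mul (hB.mul hU)
  · exact ((continuous_const.mul hU').mul hB).add (hU.mul hB')
  · exact ((continuous_const.mul hU').mul hA).add (hU.mul hA')
  · exact continuous_const

namespace LinSol

variable {u ξ₁ ξ₂ W : ℝ → ℝ}

lemma exists_tendsto (hu : IsHastingsMcLeod u) (h : LinSol u ξ₁ ξ₂ W) :
    ∃ c₁ c₂ c₀, Tendsto ξ₁ atTop (𝓝 c₁) ∧ Tendsto ξ₂ atTop (𝓝 c₂) ∧ Tendsto W atTop (𝓝 c₀) := by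
  have h' := fun i => (linSol_iff.1 h).exists_tendsto two_pos (isOG_linCoeff hu) i
  obtain ⟨c₁, h1⟩ := h' 0
  obtain ⟨c₂, h2⟩ := h' 1
  obtain ⟨c₀, h3⟩ := h' 2
  exact ⟨c₁, c₂, c₀, h1, h2, h3⟩

lemma eventually_eq (hu : IsHastingsMcLeod u) (h : LinSol u ξ₁ ξ₂ W) {ζ₁ ζ₂ V : ℝ → ℝ}
    (h' : LinSol u ζ₁ ζ₂ V) {c₁ c₂ c₀ : ℝ} (h1 : Tendsto ξ₁ atTop (𝓝 c₁))
    (h2 : Tendsto ξ₂ atTop (𝓝 c₂)) (h3 : Tendsto W atTop (𝓝 c₀))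
    (h1' : Tendsto ζ₁ atTop (𝓝 c₁)) (h2' : Tendsto ζ₂ atTop (𝓝 c₂))
    (h3' : Tendsto V atTop (𝓝 c₀)) :
    ∀ᶠ t in atTop, ξ₁ t = ζ₁ t ∧ ξ₂ t = ζ₂ t ∧ W t = V t := by
  have hs := ((linSol_iff.1 h).sub (linSol_iff.1 h')).eventually_eq_zero two_pos
    (isOG_linCoeff hu) (fun i => by
      fin_cases i
      · simpa using h1.sub h1'
      · simpa using h2.sub h2'
      · simpa using h3.sub h3')
  filter_upwards [hs] with t ht
  exact ⟨sub_eq_zero.1 (ht 0), sub_eq_zero.1 (ht 1), sub_eq_zero.1 (ht 2)⟩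

lemma exists_of_limit (hu : IsHastingsMcLeod u) (c₁ c₂ c₀ : ℝ) :
    ∃ ξ₁ ξ₂ W, LinSol u ξ₁ ξ₂ W ∧ Tendsto ξ₁ atTop (𝓝 c₁) ∧ Tendsto ξ₂ atTop (𝓝 c₂) ∧
      Tendsto W atTop (𝓝 c₀) := by
  obtain ⟨η, hη, hl⟩ := exists_solvesLinear two_pos (isOG_linCoeff hu) (continuous_linCoeff hu)
    ![c₁, c₂, c₀]
  refine ⟨η 0, η 1, η 2, linSol_iff.2 ?_, hl 0, hl 1, hl 2⟩
  convert hη using 1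
  funext i
  fin_cases i <;> rfl

lemma const_mul (h : LinSol u ξ₁ ξ₂ W) (a : ℝ) :
    LinSol u (fun t => a * ξ₁ t) (fun t => a * ξ₂ t) (fun t => a * W t) := by
  have h' := (linSol_iff.1 h).const_mul a
  refine linSol_iff.2 ?_
  convert h' using 1
  funext i
  fin_cases i <;> rfl

/-- The first component `x` of the linear system. -/
def X (ξ₁ ξ₂ : ℝ → ℝ) (t : ℝ) : ℝ := ξ₁ t * scBi t + ξ₂ t * scAi t

/-- The derivative of the first component of the linear system. -/
def P (ξ₁ ξ₂ : ℝ → ℝ) (t : ℝ) : ℝ := ξ₁ t * dscBi t + ξ₂ t * dscAi t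

lemma hasDerivAt_X (h : LinSol u ξ₁ ξ₂ W) :
    ∀ᶠ t in atTop, HasDerivAt (X ξ₁ ξ₂) (P ξ₁ ξ₂ t) t := by
  filter_upwards [h.deriv₁, h.deriv₂] with t h1 h2
  refine ((h1.mul (hasDerivAt_scBi t)).add (h2.mul (hasDerivAt_scAi t))).congr_deriv ?_
  rw [P]; ring

lemma hasDerivAt_P (h : LinSol u ξ₁ ξ₂ W) :
    ∀ᶠ t in atTop, HasDerivAt (P ξ₁ ξ₂)
      ((t / 9 + 2 / 9 * u t ^ 2) * X ξ₁ ξ₂ t + 4 / 9 * u t * W t) t := by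
  filter_upwards [h.deriv₁, h.deriv₂] with t h1 h2
  refine ((h1.mul (hasDerivAt_dscBi t)).add (h2.mul (hasDerivAt_dscAi t))).congr_deriv ?_
  have hw := invWronskian_mul t
  have e : forcing u ξ₁ ξ₂ W t = 2 / 9 * u t ^ 2 * X ξ₁ ξ₂ t + 4 / 9 * u t * W t := by
    rw [forcing, X]; ring
  rw [e, X]
  linear_combination (2 / 9 * u t ^ 2 * (ξ₁ t * scBi t + ξ₂ t * scAi t) + 4 / 9 * u t * W t) * hw

/-- The solution of the projective system given by a solution of the linear system. -/
lemma solvesShifted (hu : IsHastingsMcLeod u) (h : LinSol u ξ₁ ξ₂ W)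
    (hW : ∀ᶠ t in atTop, W t ≠ 0) :
    SolvesShiftedSystem u (fun t => u t * X ξ₁ ξ₂ t / W t)
      (fun t => -(3 / 2) * (u t * P ξ₁ ξ₂ t / W t)) := by
  filter_upwards [h.hasDerivAt_X, h.hasDerivAt_P, h.deriv₃, hW, hu.pos] with t h1 h2 h3 h4 h5
  have e : ξ₁ t * dPhi01 u t + ξ₂ t * dPhi02 u t =
      u t * P ξ₁ ξ₂ t + deriv u t * X ξ₁ ξ₂ t / 3 := by
    rw [dPhi01, dPhi02, X, P]; ring
  rw [e] at h3
  have hd := hu.hasDerivAt t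
  constructor
  · refine ((hd.mul h1).div h3 h4).congr_deriv ?_
    simp only [Pi.mul_apply]
    field_simp
    ring
  · refine (((hd.mul h2).div h3 h4).const_mul (-(3 / 2))).congr_deriv ?_
    simp only [Pi.mul_apply]
    field_simp
    ring

/-- Every solution of the projective system comes from a solution of the linear system. -/
lemma exists_of_solvesShifted (hu : IsHastingsMcLeod u) {q α : ℝ → ℝ}
    (h : SolvesShiftedSystem u q α) :
    ∃ ξ₁ ξ₂ W, LinSol u ξ₁ ξ₂ W ∧ (∀ t, 0 < W t) ∧
      (∀ᶠ t in atTop, q t = u t * X ξ₁ ξ₂ t / W t) ∧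
      ∀ᶠ t in atTop, α t = -(3 / 2) * (u t * P ξ₁ ξ₂ t / W t) := by
  obtain ⟨T, hT⟩ := eventually_atTop.1 (h.and hu.pos)
  -- The logarithmic derivative that W' = u p + u' x / 3 forces on W when x = q W / u and p = -(2/3)
  -- α W / u.
  set r : ℝ → ℝ := fun t => -(2 / 3) * α t + deriv u t / u t * q t / 3 with hr
  have hrc : ContinuousOn r (Ici T) := by
    intro t ht
    have h1 := (hT t ht).1.1.continuousAt
    have h2 := (hT t ht).1.2.continuousAt
    have h3 := (hu.continuous_deriv.continuousAt.div hu.continuous.continuousAt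
      (hT t ht).2.ne' : ContinuousAt (fun t => deriv u t / u t) t)
    exact ((h2.const_mul _).add ((h3.mul h1).div_const 3)).continuousWithinAt
  -- Freezing r to the left of T gives a continuous function on the line, so that W is defined
  -- everywhere by one interval integral.
  have hrc' : Continuous fun t => r (max t T) :=
    hrc.comp_continuous (by fun_prop) fun t => mem_Ici.2 (le_max_right _ _)
  set W : ℝ → ℝ := fun t => Real.exp (∫ s in T..t, r (max s T)) with hW
  have hWd : ∀ t, T ≤ t → HasDerivAt W (W t * r t) t := by
    intro t ht
    have := (hrc'.integral_hasStrictDerivAt T t).hasDerivAt.exp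
    rw [max_eq_left ht] at this
    exact this
  have hWpos : ∀ t, 0 < W t := fun t => Real.exp_pos _
  set x : ℝ → ℝ := fun t => q t * W t / u t with hx
  set p : ℝ → ℝ := fun t => -(2 / 3) * (α t * W t / u t) with hp
  have hxd : ∀ t, T ≤ t → HasDerivAt x (p t) t := by
    intro t ht
    have h0 := (hT t ht).2.ne'
    refine (((hT t ht).1.1.mul (hWd t ht)).div (hu.hasDerivAt t) h0).congr_deriv ?_
    simp only [hr, hp, Pi.mul_apply]
    field_simp
    ring
  have hpd : ∀ t, T ≤ t →
      HasDerivAt p ((t / 9 + 2 / 9 * u t ^ 2) * x t + 4 / 9 * u t * W t) t := by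
    intro t ht
    have h0 := (hT t ht).2.ne'
    refine ((((hT t ht).1.2.mul (hWd t ht)).div (hu.hasDerivAt t) h0).const_mul
      (-(2 / 3))).congr_deriv ?_
    simp only [hr, hx, Pi.mul_apply]
    field_simp
    ring
  -- Cramer's rule for x = ξ₁ Bi(t̂) + ξ₂ Ai(t̂), p = ξ₁ Bi(t̂)' + ξ₂ Ai(t̂)', with the constant
  -- Wronskian as determinant.
  set ξ₁ : ℝ → ℝ := fun t => invWronskian * (scAi t * p t - dscAi t * x t) with hξ₁
  set ξ₂ : ℝ → ℝ := fun t => invWronskian * (dscBi t * x t - scBi t * p t) with hξ₂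
  have eX : ∀ t, X ξ₁ ξ₂ t = x t := by
    intro t
    have hw := invWronskian_mul t
    simp only [X, hξ₁, hξ₂]
    linear_combination x t * hw
  have eP : ∀ t, P ξ₁ ξ₂ t = p t := by
    intro t
    have hw := invWronskian_mul t
    simp only [P, hξ₁, hξ₂]
    linear_combination p t * hw
  have eF : ∀ t, forcing u ξ₁ ξ₂ W t = 2 / 9 * u t ^ 2 * x t + 4 / 9 * u t * W t := by
    intro t
    rw [← eX, forcing, X]; ring
  refine ⟨ξ₁, ξ₂, W, ⟨?_, ?_, ?_⟩, hWpos, ?_, ?_⟩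
  · filter_upwards [eventually_ge_atTop T] with t ht
    refine ((((hasDerivAt_scAi t).mul (hpd t ht)).sub ((hasDerivAt_dscAi t).mul
      (hxd t ht))).const_mul invWronskian).congr_deriv ?_
    rw [eF]; ring
  · filter_upwards [eventually_ge_atTop T] with t ht
    refine ((((hasDerivAt_dscBi t).mul (hxd t ht)).sub ((hasDerivAt_scBi t).mul
      (hpd t ht))).const_mul invWronskian).congr_deriv ?_
    rw [eF]; ring
  · filter_upwards [eventually_ge_atTop T] with t ht
    refine (hWd t ht).congr_deriv ?_
    have h0 := (hT t ht).2.ne'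
    have e : ξ₁ t * dPhi01 u t + ξ₂ t * dPhi02 u t =
        u t * P ξ₁ ξ₂ t + deriv u t * X ξ₁ ξ₂ t / 3 := by
      rw [dPhi01, dPhi02, X, P]; ring
    rw [e, eX, eP]
    simp only [hr, hx, hp]
    field_simp
  · filter_upwards [eventually_ge_atTop T] with t ht
    have h0 := (hT t ht).2.ne'
    have h1 := (hWpos t).ne'
    rw [eX]
    simp only [hx]
    field_simp
  · filter_upwards [eventually_ge_atTop T] with t ht
    have h0 := (hT t ht).2.ne'
    have h1 := (hWpos t).ne'
    rw [eP]
    simp only [hp]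
    field_simp

end LinSol

/-! ### Expansions of solutions of the linear system -/

lemma OG.sub_limit {f f' : ℝ → ℝ} {k m L : ℝ} (hf : ∀ᶠ t in atTop, HasDerivAt f (f' t) t)
    (hf' : OG f' k m) (hL : Tendsto f atTop (𝓝 L)) (hm : 0 < m) (k' : ℝ) (hk : k - 1 / 2 ≤ k') :
    OG (fun t => f t - L) k' m :=
  OG.of_deriv (hf.mono fun _ h => h.sub_const L) hf' (by simpa using hL.sub_const L) hm k' hk

lemma OG.isLittleO {f : ℝ → ℝ} {k m k' m' : ℝ} (hf : OG f k m)
    (h : m' < m ∨ m' = m ∧ k < k') : f =o[atTop] expScale k' m' :=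
  hf.trans_isLittleO (expScale_isLittleO h)

lemma OG.div {f g : ℝ → ℝ} {k m k' m' : ℝ} (hf : OG f k m) (hg : OG (fun t => (g t)⁻¹) k' m')
    (k'' m'' : ℝ) (h : m'' < m + m' ∨ m'' = m + m' ∧ k + k' ≤ k'') :
    OG (fun t => f t / g t) k'' m'' :=
  (hf.mul hg k'' m'' h).congr (Eventually.of_forall fun _ => (div_eq_mul_inv _ _).symm)

/-- The bound on the forcing term coming from bounds on `x` and `W`. -/
lemma isOG_forcing {u ξ₁ ξ₂ W : ℝ → ℝ} (hu : IsHastingsMcLeod u) {k m k' m' : ℝ}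
    (hX : OG (LinSol.X ξ₁ ξ₂) k m) (hW : OG W k' m') (K M : ℝ)
    (h : M < 6 + m ∨ M = 6 + m ∧ k - 1 / 2 ≤ K) (h' : M < 3 + m' ∨ M = 3 + m' ∧ k' - 1 / 4 ≤ K) :
    OG (forcing u ξ₁ ξ₂ W) K M := by
  have hU := hu.isWKB.isOG
  have h1 := hU.mul (hU.mul hX (k - 1 / 4) (m + 3) (Or.inr ⟨by ring, by linarith⟩)) K M
    (h.imp (fun h => by linarith) fun h => ⟨by linarith, by linarith⟩)
  have h2 := hU.mul hW K M (h'.imp (fun h => by linarith) fun h => ⟨by linarith, by linarith⟩)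
  exact (h1.const_mul (2 / 9)).add (h2.const_mul (4 / 9))

/-- A bound on `ξ₁ b + ξ₂ a` with general `b`, `a`. -/
lemma OG.comb {f g b a : ℝ → ℝ} {k m k₁ m₁ k₂ m₂ : ℝ} (hb : OG b k (-1)) (ha : OG a k 1)
    (hf : OG f k₁ m₁) (hg : OG g k₂ m₂) (K : ℝ)
    (h1 : m < m₁ - 1 ∨ m = m₁ - 1 ∧ k₁ ≤ K) (h2 : m < m₂ + 1 ∨ m = m₂ + 1 ∧ k₂ ≤ K) :
    OG (fun t => f t * b t + g t * a t) (k + K) m :=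
  (hf.mul hb _ _ (h1.imp (fun h => by linarith) fun h => ⟨by linarith, by linarith⟩)).add
    (hg.mul ha _ _ (h2.imp (fun h => by linarith) fun h => ⟨by linarith, by linarith⟩))

namespace LinSol

variable {u ξ₁ ξ₂ W : ℝ → ℝ} {c₁ c₂ : ℝ}

/-! ### Solutions with `W → 1` -/

/-- The forcing is dominated by u W, of rate 3. Multiplying by Ai(t̂) or Bi(t̂) shifts the rate to 4
or 2. -/
lemma isOG_sub_of_tendsto_one (hu : IsHastingsMcLeod u) (h : LinSol u ξ₁ ξ₂ W)
    (h1 : Tendsto ξ₁ atTop (𝓝 c₁)) (h2 : Tendsto ξ₂ atTop (𝓝 c₂)) (h3 : Tendsto W atTop (𝓝 1)) :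
    OG (fun t => ξ₁ t - c₁) (-1) 4 ∧ OG (fun t => ξ₂ t - c₂) (-1) 2 := by
  have hX : OG (X ξ₁ ξ₂) (-(1 / 4) + 0) (-1) :=
    OG.comb isWKB_scBi.isOG isWKB_scAi.isOG (OG.of_tendsto h1) (OG.of_tendsto h2) 0 (by norm_num)
      (by norm_num)
  have hF := isOG_forcing hu hX (OG.of_tendsto h3) (-(1 / 4)) 3 (by norm_num) (by norm_num)
  exact ⟨OG.sub_limit h.deriv₁ ((isWKB_scAi.isOG.mul hF (-(1 / 2)) 4 (by norm_num)).const_mul _)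
      h1 (by norm_num) _ (by norm_num),
    OG.sub_limit h.deriv₂ ((isWKB_scBi.isOG.mul hF (-(1 / 2)) 2 (by norm_num)).const_mul _)
      h2 (by norm_num) _ (by norm_num)⟩

/-- In W' only c₁ `dPhi01` has rate below 4, so W - 1 is c₁ Φ₀₁ to this order, and Φ₀₁ may be
replaced by the Airy integral. -/
lemma isOG_W_sub_of_tendsto_one (hu : IsHastingsMcLeod u) (h : LinSol u ξ₁ ξ₂ W)
    (h1 : Tendsto ξ₁ atTop (𝓝 c₁)) (h2 : Tendsto ξ₂ atTop (𝓝 c₂)) (h3 : Tendsto W atTop (𝓝 1)) :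
    OG (fun t => W t - 1 - c₁ * airyMixedInt t) (-(1 / 2)) 4 := by
  have hξ := (h.isOG_sub_of_tendsto_one hu h1 h2 h3).1
  have hd : OG (fun t => W t - c₁ * Phi01 u t - 1) (-(1 / 2)) 4 := by
    refine OG.sub_limit (k := 0) (f' := fun t => ξ₁ t * dPhi01 u t + ξ₂ t * dPhi02 u t -
      c₁ * dPhi01 u t) ?_ ?_ (by simpa using h3.sub ((Phi01_spec hu).2.const_mul c₁))
      (by norm_num) _ (by norm_num)
    · filter_upwards [h.deriv₃] with t ht
      exact ht.sub (((Phi01_spec hu).1 t).const_mul c₁)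
    · have e1 := hξ.mul (isOG_dPhi01 hu) 0 4 (by norm_num)
      have e2 := (OG.of_tendsto h2).mul (isOG_dPhi02 hu) 0 4 (by norm_num)
      exact (e1.add e2).congr (Eventually.of_forall fun t => by ring)
  have hJ := ((Phi01_sub_airyMixedInt hu).const_mul c₁).weaken (-(1 / 2)) 4 (by norm_num)
  exact (hd.add hJ).congr (Eventually.of_forall fun t => by ring)

lemma isOG_inv_W_of_tendsto {c : ℝ} (hc : c ≠ 0) (h3 : Tendsto W atTop (𝓝 c)) :
    OG (fun t => (W t)⁻¹) 0 0 := OG.of_tendsto (h3.inv₀ hc)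

/-- Since W = 1 + c₁ J to the order required, dividing by W produces the quadratic term -c₁² b J.
The pair (b, a) is left general: the functions Bi(t̂), Ai(t̂) give q and their derivatives give α.
-/
lemma isOG_expansionA (hu : IsHastingsMcLeod u) (h : LinSol u ξ₁ ξ₂ W)
    (h1 : Tendsto ξ₁ atTop (𝓝 c₁)) (h2 : Tendsto ξ₂ atTop (𝓝 c₂)) (h3 : Tendsto W atTop (𝓝 1))
    {b a : ℝ → ℝ} {k : ℝ} (hb : OG b k (-1)) (ha : OG a k 1) :
    OG (fun t => u t * (ξ₁ t * b t + ξ₂ t * a t) / W t -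
      airyAi t * (c₁ * b t + c₂ * a t - c₁ ^ 2 * (b t * airyMixedInt t))) (k - 3 / 4) 6 := by
  obtain ⟨e1, e2⟩ := h.isOG_sub_of_tendsto_one hu h1 h2 h3
  have e3 := h.isOG_W_sub_of_tendsto_one hu h1 h2 h3
  have hJ := airyMixedInt_spec.2
  set J := airyMixedInt
  have hbJ := hb.mul hJ (k - 1 / 2) 1 (Or.inr ⟨by norm_num, by linarith⟩)
  have hS : OG (fun t => c₁ * b t + c₂ * a t - c₁ ^ 2 * (b t * J t)) k (-1) :=
    ((hb.const_mul c₁).add ((ha.const_mul c₂).weaken _ _ (by norm_num))).sub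
      ((hbJ.const_mul _).weaken _ _ (by norm_num))
  have hE1 : OG (fun t => (ξ₁ t - c₁) * b t + (ξ₂ t - c₂) * a t) (k + -(1 / 2)) 3 :=
    OG.comb hb ha e1 e2 _ (by norm_num) (by norm_num)
  have hE2 := e3.mul hS (k + -(1 / 2)) 3 (Or.inr ⟨by norm_num, by linarith⟩)
  have hE3 := ha.mul hJ (k + -(1 / 2)) 3 (Or.inr ⟨by norm_num, by linarith⟩)
  have hE4 := hbJ.mul hJ (k + -(1 / 2)) 3 (Or.inr ⟨by norm_num, by linarith⟩)
  -- This is ξ₁ b + ξ₂ a - W S, where S is the claimed bracket; the terms in c₁ c₂ and c₁³ are what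
  -- remains of c₁ b + c₂ a - (1 + c₁ J) S.
  have hnum := ((hE1.sub hE2).sub (hE3.const_mul (c₁ * c₂))).add (hE4.const_mul (c₁ ^ 3))
  have hY := (hnum.div (isOG_inv_W_of_tendsto one_ne_zero h3) (k + -(1 / 2)) 3
    (Or.inr ⟨by norm_num, by linarith⟩))
  have g1 := hu.isWKB.isOG.mul hY (k - 3 / 4) 6 (Or.inr ⟨by norm_num, by linarith⟩)
  have g2 := hu.isOG_sub.mul hS (k - 3 / 4) 6 (Or.inl (by norm_num))
  refine (g1.add g2).congr ?_
  filter_upwards [h3.eventually_ne one_ne_zero] with t ht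
  field_simp
  ring

lemma isOG_of_tendsto_one (hu : IsHastingsMcLeod u)
    (h1 : Tendsto ξ₁ atTop (𝓝 c₁)) (h2 : Tendsto ξ₂ atTop (𝓝 c₂)) (h3 : Tendsto W atTop (𝓝 1))
    {b a : ℝ → ℝ} {k : ℝ} (hb : OG b k (-1)) (ha : OG a k 1) :
    OG (fun t => u t * (ξ₁ t * b t + ξ₂ t * a t) / W t) k 1 := by
  have hX : OG (fun t => ξ₁ t * b t + ξ₂ t * a t) (k + 0) (-1) :=
    OG.comb hb ha (OG.of_tendsto h1) (OG.of_tendsto h2) 0 (by norm_num) (by norm_num)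
  exact (hu.isWKB.isOG.mul hX k 1 (Or.inl (by norm_num))).div
    (isOG_inv_W_of_tendsto one_ne_zero h3) k 1 (Or.inr ⟨by norm_num, by linarith⟩)

/-! ### The case `c₁ = c₂ = 0` -/

lemma airyAi_scAi_spec : (∀ t, HasDerivAt (intFromTop fun s => airyAi s * scAi s)
      (airyAi t * scAi t) t) ∧ OG (intFromTop fun s => airyAi s * scAi s) (-1) 4 := by
  have h1 := isWKB_airyAi.isOG.mul isWKB_scAi.isOG (-(1 / 2)) 4 (by norm_num)
  have h := intFromTop_spec (continuous_airyAi.mul continuous_scAi) h1 (by norm_num)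
  exact ⟨h.1, OG.of_deriv (Eventually.of_forall h.1) h1 h.2 (by norm_num) _ (by norm_num)⟩

lemma airyAi_scBi_spec : (∀ t, HasDerivAt (intFromTop fun s => airyAi s * scBi s)
      (airyAi t * scBi t) t) ∧ OG (intFromTop fun s => airyAi s * scBi s) (-1) 2 := by
  have h1 := isWKB_airyAi.isOG.mul isWKB_scBi.isOG (-(1 / 2)) 2 (by norm_num)
  have h := intFromTop_spec (continuous_airyAi.mul continuous_scBi) h1 (by norm_num)
  exact ⟨h.1, OG.of_deriv (Eventually.of_forall h.1) h1 h.2 (by norm_num) _ (by norm_num)⟩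

/-- With zero limits x is generated entirely by the forcing, which is (4/9) Ai up to rate 9;
variation of constants then gives the two integrals. -/
lemma isOG_leadingZero (hu : IsHastingsMcLeod u) (h : LinSol u ξ₁ ξ₂ W)
    (h1 : Tendsto ξ₁ atTop (𝓝 0)) (h2 : Tendsto ξ₂ atTop (𝓝 0)) (h3 : Tendsto W atTop (𝓝 1))
    {b a : ℝ → ℝ} {k : ℝ} (hb : OG b k (-1)) (ha : OG a k 1) :
    OG (fun t => u t * (ξ₁ t * b t + ξ₂ t * a t) / W t - airyAi t * (4 / 9 * invWronskian *
      (b t * intFromTop (fun s => airyAi s * scAi s) t -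
        a t * intFromTop (fun s => airyAi s * scBi s) t))) (k - 11 / 4) 12 := by
  obtain ⟨e1, e2⟩ := h.isOG_sub_of_tendsto_one hu h1 h2 h3
  simp only [sub_zero] at e1 e2
  obtain ⟨d1, i1⟩ := airyAi_scAi_spec
  obtain ⟨d2, i2⟩ := airyAi_scBi_spec
  set I₁ := intFromTop fun s => airyAi s * scAi s
  set I₂ := intFromTop fun s => airyAi s * scBi s
  set w := invWronskian
  have hX : OG (X ξ₁ ξ₂) (-(1 / 4) + -1) 3 :=
    OG.comb isWKB_scBi.isOG isWKB_scAi.isOG e1 e2 (-1) (by norm_num) (by norm_num)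
  have hW : OG (fun t => W t - 1) (-(3 / 2)) 6 :=
    OG.sub_limit (k := -1) h.deriv₃ ((e1.mul (isOG_dPhi01 hu) (-1) 6 (by norm_num)).add
      (e2.mul (isOG_dPhi02 hu) (-1) 6 (by norm_num))) h3 (by norm_num) _ (by norm_num)
  have hU := hu.isWKB.isOG
  have hF : OG (fun t => forcing u ξ₁ ξ₂ W t - 4 / 9 * airyAi t) (-(7 / 4)) 9 := by
    have f1 := (hU.mul (hU.mul hX (-(3 / 2)) 6 (by norm_num)) (-(7 / 4)) 9
      (by norm_num)).const_mul (2 / 9)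
    have f2 := (hU.mul hW (-(7 / 4)) 9 (by norm_num)).const_mul (4 / 9)
    have f3 := hu.isOG_sub.const_mul (4 / 9)
    refine ((f1.add f2).add f3).congr (Eventually.of_forall fun t => ?_)
    rw [forcing, X]; ring
  have g1 : OG (fun t => ξ₁ t - 4 / 9 * w * I₁ t) (-(5 / 2)) 10 := by
    refine OG.of_deriv (k := -2) (f' := fun t => w * (scAi t * forcing u ξ₁ ξ₂ W t) -
      4 / 9 * w * (airyAi t * scAi t)) ?_ ?_ ?_ (by norm_num) _ (by norm_num)
    · filter_upwards [h.deriv₁] with t ht using ht.sub ((d1 t).const_mul _)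
    · exact ((isWKB_scAi.isOG.mul hF (-2) 10 (by norm_num)).const_mul w).congr
        (Eventually.of_forall fun t => by ring)
    · have := h1.sub ((i1.tendsto_zero (by norm_num)).const_mul (4 / 9 * w))
      rwa [mul_zero, sub_zero] at this
  have g2 : OG (fun t => ξ₂ t + 4 / 9 * w * I₂ t) (-(5 / 2)) 8 := by
    refine OG.of_deriv (k := -2) (f' := fun t => -w * (scBi t * forcing u ξ₁ ξ₂ W t) +
      4 / 9 * w * (airyAi t * scBi t)) ?_ ?_ ?_ (by norm_num) _ (by norm_num)
    · filter_upwards [h.deriv₂] with t ht using ht.add ((d2 t).const_mul _)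
    · exact ((isWKB_scBi.isOG.mul hF (-2) 8 (by norm_num)).const_mul (-w)).congr
        (Eventually.of_forall fun t => by ring)
    · have := h2.add ((i2.tendsto_zero (by norm_num)).const_mul (4 / 9 * w))
      rwa [mul_zero, add_zero] at this
  have hE : OG (fun t => (ξ₁ t - 4 / 9 * w * I₁ t) * b t + (ξ₂ t + 4 / 9 * w * I₂ t) * a t)
      (k + -(5 / 2)) 9 := OG.comb hb ha g1 g2 _ (by norm_num) (by norm_num)
  have hS : OG (fun t => 4 / 9 * w * I₁ t * b t + -(4 / 9 * w) * I₂ t * a t) (k + -1) 3 :=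
    OG.comb hb ha (i1.const_mul _) (i2.const_mul _) _ (by norm_num) (by norm_num)
  have hWi := isOG_inv_W_of_tendsto one_ne_zero h3
  have t1 := (hU.mul hE (k - 11 / 4) 12 (Or.inr ⟨by norm_num, by linarith⟩)).div hWi
    (k - 11 / 4) 12 (Or.inr ⟨by norm_num, by linarith⟩)
  have t2 := ((hU.mul hS (k - 5 / 4) 6 (Or.inr ⟨by norm_num, by linarith⟩)).mul hW
    (k - 11 / 4) 12 (Or.inr ⟨by norm_num, by linarith⟩)).div hWi
    (k - 11 / 4) 12 (Or.inr ⟨by norm_num, by linarith⟩)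
  have t3 := hu.isOG_sub.mul hS (k - 11 / 4) 12 (Or.inr ⟨by norm_num, by linarith⟩)
  refine ((t1.sub t2).add t3).congr ?_
  filter_upwards [h3.eventually_ne one_ne_zero] with t ht
  field_simp
  ring

/-! ### Solutions with `W → 0`, `ξ₁ → 1` -/

lemma isOG_W_of_tendsto_zero (hu : IsHastingsMcLeod u) (h : LinSol u ξ₁ ξ₂ W)
    (h1 : Tendsto ξ₁ atTop (𝓝 c₁)) (h2 : Tendsto ξ₂ atTop (𝓝 c₂)) (h3 : Tendsto W atTop (𝓝 0)) :
    OG W (-(1 / 2)) 2 :=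
  OG.of_deriv (k := 0) h.deriv₃
    (((OG.of_tendsto h1).mul (isOG_dPhi01 hu) 0 2 (by norm_num)).add
      ((OG.of_tendsto h2).mul (isOG_dPhi02 hu) 0 2 (by norm_num))) h3 (by norm_num) _ (by norm_num)

/-- Here W itself has rate 2, so the forcing improves to rate 5, with u² x and u W contributing
equally. -/
lemma isOG_sub_of_tendsto_zero (hu : IsHastingsMcLeod u) (h : LinSol u ξ₁ ξ₂ W)
    (h1 : Tendsto ξ₁ atTop (𝓝 c₁)) (h2 : Tendsto ξ₂ atTop (𝓝 c₂)) (h3 : Tendsto W atTop (𝓝 0)) :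
    OG (fun t => ξ₁ t - c₁) (-(3 / 2)) 6 ∧ OG (fun t => ξ₂ t - c₂) (-(3 / 2)) 4 := by
  have hX : OG (X ξ₁ ξ₂) (-(1 / 4) + 0) (-1) :=
    OG.comb isWKB_scBi.isOG isWKB_scAi.isOG (OG.of_tendsto h1) (OG.of_tendsto h2) 0 (by norm_num)
      (by norm_num)
  have hF := isOG_forcing hu hX (h.isOG_W_of_tendsto_zero hu h1 h2 h3) (-(3 / 4)) 5
    (by norm_num) (by norm_num)
  exact ⟨OG.sub_limit h.deriv₁ ((isWKB_scAi.isOG.mul hF (-1) 6 (by norm_num)).const_mul _)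
      h1 (by norm_num) _ (by norm_num),
    OG.sub_limit h.deriv₂ ((isWKB_scBi.isOG.mul hF (-1) 4 (by norm_num)).const_mul _)
      h2 (by norm_num) _ (by norm_num)⟩

lemma isOG_W_sub_of_tendsto_zero (hu : IsHastingsMcLeod u) (h : LinSol u ξ₁ ξ₂ W)
    (h1 : Tendsto ξ₁ atTop (𝓝 c₁)) (h2 : Tendsto ξ₂ atTop (𝓝 c₂)) (h3 : Tendsto W atTop (𝓝 0)) :
    OG (fun t => W t - c₁ * Phi01 u t - c₂ * Phi02 u t) (-2) 8 := by
  obtain ⟨e1, e2⟩ := h.isOG_sub_of_tendsto_zero hu h1 h2 h3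
  refine OG.of_deriv (k := -(3 / 2)) (f' := fun t => ξ₁ t * dPhi01 u t + ξ₂ t * dPhi02 u t -
    c₁ * dPhi01 u t - c₂ * dPhi02 u t) ?_ ?_ ?_ (by norm_num) _ (by norm_num)
  · filter_upwards [h.deriv₃] with t ht
    exact (ht.sub (((Phi01_spec hu).1 t).const_mul c₁)).sub (((Phi02_spec hu).1 t).const_mul c₂)
  · have f1 := e1.mul (isOG_dPhi01 hu) (-(3 / 2)) 8 (by norm_num)
    have f2 := e2.mul (isOG_dPhi02 hu) (-(3 / 2)) 8 (by norm_num)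
    exact (f1.add f2).congr (Eventually.of_forall fun t => by ring)
  · simpa using (h3.sub ((Phi01_spec hu).2.const_mul c₁)).sub ((Phi02_spec hu).2.const_mul c₂)

lemma isOG_ratio (hu : IsHastingsMcLeod u) : OG (fun t => Phi02 u t / Phi01 u t) (3 / 2) 2 :=
  (Phi02_isOG hu).div (Phi01_inv hu).1 _ _ (by norm_num)

lemma Phi01_ne_zero (hu : IsHastingsMcLeod u) : ∀ᶠ t in atTop, Phi01 u t ≠ 0 := by
  filter_upwards [(Phi01_inv hu).2.eventually_ne one_ne_zero] with t ht h0
  rw [h0, zero_div] at ht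
  exact ht rfl

lemma tendsto_W_div_Phi01 (hu : IsHastingsMcLeod u) (h : LinSol u ξ₁ ξ₂ W)
    (h1 : Tendsto ξ₁ atTop (𝓝 1)) (h2 : Tendsto ξ₂ atTop (𝓝 c₂)) (h3 : Tendsto W atTop (𝓝 0)) :
    Tendsto (fun t => W t / Phi01 u t) atTop (𝓝 1) := by
  have hd : OG (fun t => W t - Phi01 u t) (-(1 / 2)) 4 :=
    (((h.isOG_W_sub_of_tendsto_zero hu h1 h2 h3).weaken _ _ (by norm_num)).add
      ((Phi02_isOG hu).const_mul c₂)).congr (Eventually.of_forall fun t => by ring)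
  exact (OG.inv_of_sub (Phi01_inv hu).1 hd (by norm_num) (Phi01_ne_zero hu)).2

/-- Dividing by W ≈ (1 + c₂ R) Φ₀₁ gives a geometric expansion in R, stopped after the quadratic
term. The second estimate is the size of that term, which fixes the powers 9/2 and 5 in the
first-order errors. -/
lemma isOG_expansionB (hu : IsHastingsMcLeod u) (h : LinSol u ξ₁ ξ₂ W)
    (h1 : Tendsto ξ₁ atTop (𝓝 1)) (h2 : Tendsto ξ₂ atTop (𝓝 c₂)) (h3 : Tendsto W atTop (𝓝 0))
    {b a : ℝ → ℝ} {k : ℝ} (hb : OG b k (-1)) (ha : OG a k 1) :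
    OG (fun t => u t * (ξ₁ t * b t + ξ₂ t * a t) / W t -
      (b t + c₂ * (a t - b t * (Phi02 u t / Phi01 u t)) -
        c₂ ^ 2 * ((Phi02 u t / Phi01 u t) * (a t - b t * (Phi02 u t / Phi01 u t)))) *
      (airyAi t / Phi01 u t)) (k + 25 / 4) 6 ∧
    OG (fun t => ((Phi02 u t / Phi01 u t) * (a t - b t * (Phi02 u t / Phi01 u t))) *
      (airyAi t / Phi01 u t)) (k + 19 / 4) 4 := by
  obtain ⟨e1, e2⟩ := h.isOG_sub_of_tendsto_zero hu h1 h2 h3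
  have e3 := h.isOG_W_sub_of_tendsto_zero hu h1 h2 h3
  have hD := h.tendsto_W_div_Phi01 hu h1 h2 h3
  have hΦi := (Phi01_inv hu).1
  have hR := isOG_ratio hu
  have hE1 : OG (fun t => (ξ₁ t - 1) * b t + (ξ₂ t - c₂) * a t) (k + -(3 / 2)) 5 :=
    OG.comb hb ha e1 e2 _ (by norm_num) (by norm_num)
  have hE2 := e3.div hΦi 0 6 (by norm_num)
  set R := fun t => Phi02 u t / Phi01 u t with hRdef
  have hG : OG (fun t => a t - b t * R t) (k + 3 / 2) 1 :=
    (ha.weaken _ _ (Or.inr ⟨rfl, by linarith⟩)).sub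
      (hb.mul hR _ _ (Or.inr ⟨by norm_num, le_rfl⟩))
  have hRG := hR.mul hG (k + 3) 3 (Or.inr ⟨by norm_num, by linarith⟩)
  have hRRG := hR.mul hRG (k + 9 / 2) 5 (Or.inr ⟨by norm_num, by linarith⟩)
  have hS : OG (fun t => b t + c₂ * (a t - b t * R t) - c₂ ^ 2 * (R t * (a t - b t * R t)))
      k (-1) :=
    (hb.add ((hG.const_mul c₂).weaken _ _ (Or.inl (by norm_num)))).sub
      ((hRG.const_mul _).weaken _ _ (Or.inl (by norm_num)))
  -- With G = a - b R, the product of 1 + c₂ R and the truncated bracket S is b + c₂ a - c₂³ R² G;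
  -- hence the cubic remainder.
  have hnum := ((hE1.weaken (k + 9 / 2) 5 (Or.inr ⟨rfl, by linarith⟩)).add
    (hRRG.const_mul (c₂ ^ 3))).sub
    (hE2.mul hS (k + 9 / 2) 5 (Or.inr ⟨by norm_num, by linarith⟩))
  have hDi : OG (fun t => (W t / Phi01 u t)⁻¹) 0 0 := OG.of_tendsto (hD.inv₀ one_ne_zero)
  have hY := hnum.div hDi (k + 9 / 2) 5 (Or.inr ⟨by norm_num, by linarith⟩)
  have g1 := (hu.isWKB.isOG.div hΦi (7 / 4) 1 (by norm_num)).mul hY (k + 25 / 4) 6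
    (Or.inr ⟨by norm_num, by linarith⟩)
  have g2 := (hu.isOG_sub.div hΦi (1 / 4) 7 (by norm_num)).mul hS (k + 25 / 4) 6
    (Or.inr ⟨by norm_num, by linarith⟩)
  have g3 := isWKB_airyAi.isOG.div hΦi (7 / 4) 1 (by norm_num)
  refine ⟨(g1.add g2).congr ?_, hRG.mul g3 _ _ (Or.inr ⟨by norm_num, by linarith⟩)⟩
  filter_upwards [Phi01_ne_zero hu, hD.eventually_ne one_ne_zero] with t hΦ hWΦ
  have hW : W t ≠ 0 := by
    intro h0
    rw [h0, zero_div] at hWΦ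
    exact hWΦ rfl
  simp only [hRdef]
  field_simp
  ring

end LinSol

/-! ### From the linear system to the three classes -/

/-- The derivative of Bi(t̂) in t is Bi'(t̂) / 3^{2/3}; this identity turns the factor 3/2 of the
linearisation into the 3^{1/3}/2 of the expansions. -/
lemma three_rpow_mul_airyScaling : (3 : ℝ) ^ (1 / 3 : ℝ) * airyScaling = 3 := by
  rw [airyScaling, ← Real.rpow_add (by norm_num)]
  norm_num

lemma scAi'_eq_mul (t : ℝ) : scAi' t = airyScaling * dscAi t := by
  rw [dscAi, mul_div_cancel₀ _ airyScaling_pos.ne']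

lemma scBi'_eq_mul (t : ℝ) : scBi' t = airyScaling * dscBi t := by
  rw [dscBi, mul_div_cancel₀ _ airyScaling_pos.ne']

lemma expScale_zero_left (m : ℝ) :
    expScale 0 m = fun t => Real.exp (-(2 / 9 * m) * t ^ (3 / 2 : ℝ)) := by
  funext t
  simp only [expScale, Real.rpow_zero, one_mul]
  congr 1; ring

/-- `(q, α)` is represented by a solution of the linear system. -/
structure Represents (u ξ₁ ξ₂ W q α : ℝ → ℝ) : Prop where
  linSol : LinSol u ξ₁ ξ₂ W
  ne_zero : ∀ᶠ t in atTop, W t ≠ 0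
  q_eq : ∀ᶠ t in atTop, u t * LinSol.X ξ₁ ξ₂ t / W t = q t
  α_eq : ∀ᶠ t in atTop, -(3 / 2) * (u t * LinSol.P ξ₁ ξ₂ t / W t) = α t

namespace Represents

variable {u ξ₁ ξ₂ W q α : ℝ → ℝ} {c₁ c₂ : ℝ}

/-- The triple (ξ₁, ξ₂, W) is a set of homogeneous coordinates; scaling normalises the decisive
limit to 1. -/
lemma const_mul (h : Represents u ξ₁ ξ₂ W q α) {c : ℝ} (hc : c ≠ 0) :
    Represents u (fun t => c * ξ₁ t) (fun t => c * ξ₂ t) (fun t => c * W t) q α := by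
  have e : ∀ t, W t ≠ 0 → ∀ x, u t * (c * x) / (c * W t) = u t * x / W t := by
    intro t ht x
    field_simp
  refine ⟨h.linSol.const_mul c, h.ne_zero.mono fun t ht => mul_ne_zero hc ht, ?_, ?_⟩
  · filter_upwards [h.q_eq, h.ne_zero] with t h1 h2
    rw [← h1, ← e t h2, LinSol.X, LinSol.X]
    congr 2; ring
  · filter_upwards [h.α_eq, h.ne_zero] with t h1 h2
    rw [← h1, ← e t h2, LinSol.P, LinSol.P]
    congr 3; ring

lemma exists_of_solvesShifted (hu : IsHastingsMcLeod u) (h : SolvesShiftedSystem u q α) :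
    ∃ ξ₁ ξ₂ W, Represents u ξ₁ ξ₂ W q α := by
  obtain ⟨ξ₁, ξ₂, W, h1, h2, h3, h4⟩ := LinSol.exists_of_solvesShifted hu h
  exact ⟨ξ₁, ξ₂, W, h1, Eventually.of_forall fun t => (h2 t).ne', h3.mono fun _ h => h.symm,
    h4.mono fun _ h => h.symm⟩

/-! ### Class A -/

lemma classA_limits (hu : IsHastingsMcLeod u) (h : Represents u ξ₁ ξ₂ W q α)
    (h1 : Tendsto ξ₁ atTop (𝓝 c₁)) (h2 : Tendsto ξ₂ atTop (𝓝 c₂)) (h3 : Tendsto W atTop (𝓝 1)) :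
    Tendsto q atTop (𝓝 0) ∧ Tendsto α atTop (𝓝 0) := by
  constructor
  · exact (OG.congr (LinSol.isOG_of_tendsto_one hu h1 h2 h3 isWKB_scBi.isOG isWKB_scAi.isOG)
      h.q_eq).tendsto_zero (by norm_num)
  · exact (OG.congr ((LinSol.isOG_of_tendsto_one hu h1 h2 h3 isWKB_scBi.isOG_deriv
      isWKB_scAi.isOG_deriv).const_mul (-(3 / 2))) h.α_eq).tendsto_zero (by norm_num)

lemma expansionA (hu : IsHastingsMcLeod u) (h : Represents u ξ₁ ξ₂ W q α)
    (h1 : Tendsto ξ₁ atTop (𝓝 c₁)) (h2 : Tendsto ξ₂ atTop (𝓝 c₂)) (h3 : Tendsto W atTop (𝓝 1)) :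
    ExpansionA c₁ c₂ q α := by
  have hexp : (fun t : ℝ => Real.exp (-(4 / 3) * t ^ (3 / 2 : ℝ))) = expScale 0 6 := by
    rw [expScale_zero_left]; norm_num
  rw [ExpansionA, hexp]
  constructor
  · have e := h.linSol.isOG_expansionA hu h1 h2 h3 isWKB_scBi.isOG isWKB_scAi.isOG
    refine (e.congr ?_).isLittleO (by norm_num)
    filter_upwards [h.q_eq] with t ht
    rw [← ht, LinSol.X, tildeM]
    ring
  · have e := h.linSol.isOG_expansionA hu h1 h2 h3 isWKB_scBi.isOG_deriv isWKB_scAi.isOG_deriv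
    refine ((e.const_mul (-(3 / 2))).congr ?_).isLittleO (by norm_num)
    filter_upwards [h.α_eq] with t ht
    rw [← ht, LinSol.P, tildeN, scAi'_eq_mul, scBi'_eq_mul]
    linear_combination (-(1 / 2) * airyAi t * (c₁ * dscBi t + c₂ * dscAi t -
      c₁ ^ 2 * (dscBi t * airyMixedInt t))) * three_rpow_mul_airyScaling

lemma leadingZero (hu : IsHastingsMcLeod u) (h : Represents u ξ₁ ξ₂ W q α)
    (h1 : Tendsto ξ₁ atTop (𝓝 0)) (h2 : Tendsto ξ₂ atTop (𝓝 0)) (h3 : Tendsto W atTop (𝓝 1)) :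
    LeadingZero q α := by
  have hexp : (fun t : ℝ => Real.exp (-(8 / 3) * t ^ (3 / 2 : ℝ))) = expScale 0 12 := by
    rw [expScale_zero_left]; norm_num
  have hexp' : (fun t : ℝ => Real.sqrt t * Real.exp (-(8 / 3) * t ^ (3 / 2 : ℝ))) =
      expScale (1 / 2) 12 := by
    funext t
    rw [expScale, Real.sqrt_eq_rpow]; norm_num
  have hw : 4 * Real.pi / (3 : ℝ) ^ (4 / 3 : ℝ) = 4 / 9 * invWronskian := by
    have : (3 : ℝ) ^ (4 / 3 : ℝ) * airyScaling = 9 := by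
      rw [airyScaling, ← Real.rpow_add (by norm_num)]; norm_num
    rw [invWronskian, div_eq_iff (by positivity)]
    linear_combination (-(4 / 9) * Real.pi) * this
  rw [LeadingZero, hexp, hexp']
  constructor
  · have e := h.linSol.isOG_leadingZero hu h1 h2 h3 isWKB_scBi.isOG isWKB_scAi.isOG
    refine (e.congr ?_).isLittleO (by norm_num)
    filter_upwards [h.q_eq] with t ht
    rw [← ht, LinSol.X, hw]
    ring
  · have e := h.linSol.isOG_leadingZero hu h1 h2 h3 isWKB_scBi.isOG_deriv isWKB_scAi.isOG_deriv
    refine ((e.const_mul (-(3 / 2))).congr ?_).isLittleO (by norm_num)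
    filter_upwards [h.α_eq] with t ht
    rw [← ht, LinSol.P, invWronskian, scAi'_eq_mul, scBi'_eq_mul]
    ring

/-! ### Class B -/

lemma expansionB (hu : IsHastingsMcLeod u) (h : Represents u ξ₁ ξ₂ W q α)
    (h1 : Tendsto ξ₁ atTop (𝓝 1)) (h2 : Tendsto ξ₂ atTop (𝓝 c₂)) (h3 : Tendsto W atTop (𝓝 0)) :
    ExpansionB u c₂ q α := by
  have hexp : (fun t : ℝ => Real.exp (-(8 / 9) * t ^ (3 / 2 : ℝ))) = expScale 0 4 := by
    rw [expScale_zero_left]; norm_num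
  have hexp1 : (fun t : ℝ => t ^ (9 / 2 : ℝ) * Real.exp (-(8 / 9) * t ^ (3 / 2 : ℝ))) =
      expScale (9 / 2) 4 := by
    funext t
    rw [expScale]; norm_num
  have hexp2 : (fun t : ℝ => t ^ 5 * Real.exp (-(8 / 9) * t ^ (3 / 2 : ℝ))) = expScale 5 4 := by
    funext t
    rw [expScale, show (5 : ℝ) = ((5 : ℕ) : ℝ) by norm_num, Real.rpow_natCast]; norm_num
  rw [ExpansionB, hexp, hexp1, hexp2]
  obtain ⟨e, f⟩ := h.linSol.isOG_expansionB hu h1 h2 h3 isWKB_scBi.isOG isWKB_scAi.isOG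
  obtain ⟨e', f'⟩ :=
    h.linSol.isOG_expansionB hu h1 h2 h3 isWKB_scBi.isOG_deriv isWKB_scAi.isOG_deriv
  -- Including the correction leaves rate 6 against the required 4, so the power of t is immaterial.
  -- Without it the error has the size of the correction.
  have k1 : OG (fun t => q t - (mainBq u c₂ t + corrBq u c₂ t)) 6 6 := by
    refine (e.congr ?_).weaken _ _ (by norm_num)
    filter_upwards [h.q_eq] with t ht
    rw [← ht, LinSol.X, mainBq, corrBq]
    ring
  have k2 : OG (fun t => α t - (mainBα u c₂ t + corrBα u c₂ t)) (13 / 2) 6 := by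
    refine ((e'.const_mul (-(3 / 2))).congr ?_).weaken _ _ (by norm_num)
    filter_upwards [h.α_eq] with t ht
    rw [← ht, LinSol.P, mainBα, corrBα, scAi'_eq_mul, scBi'_eq_mul]
    linear_combination (-(1 / 2) * ((dscBi t + c₂ * (dscAi t - dscBi t *
      (Phi02 u t / Phi01 u t)) - c₂ ^ 2 * ((Phi02 u t / Phi01 u t) * (dscAi t - dscBi t *
      (Phi02 u t / Phi01 u t)))) * (airyAi t / Phi01 u t))) * three_rpow_mul_airyScaling
  have l1 : OG (corrBq u c₂) (9 / 2) 4 := by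
    refine ((f.const_mul (-c₂ ^ 2)).weaken _ _ (by norm_num)).congr
      (Eventually.of_forall fun t => ?_)
    rw [corrBq]; ring
  have l2 : OG (corrBα u c₂) 5 4 := by
    refine ((f'.const_mul (3 / 2 * c₂ ^ 2)).weaken _ _ (by norm_num)).congr
      (Eventually.of_forall fun t => ?_)
    rw [corrBα, scAi'_eq_mul, scBi'_eq_mul]
    linear_combination (-(1 / 2) * c₂ ^ 2 * ((Phi02 u t / Phi01 u t) * (dscAi t - dscBi t *
      (Phi02 u t / Phi01 u t))) * (airyAi t / Phi01 u t)) * three_rpow_mul_airyScaling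
  refine ⟨?_, ?_, k1.isLittleO (by norm_num), k2.isLittleO (by norm_num)⟩
  · exact ((k1.weaken _ _ (by norm_num)).add l1).congr (Eventually.of_forall fun t => by ring)
  · exact ((k2.weaken _ _ (by norm_num)).add l2).congr (Eventually.of_forall fun t => by ring)

lemma tendsto_dscBi_div : Tendsto (fun t => dscBi t / scBi t) atTop atTop := by
  have h1 : OG (fun t => (dscBi t - wkbLog (-1) t * scBi t) / scBi t - 1 / 4 * t⁻¹) (-1) 0 :=
    (isWKB_scBi.isOG_log_deriv.div isWKB_scBi.isOG_inv (-1) 0 (by norm_num)).sub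
      (OG_inv_id.const_mul _)
  have h2 : Tendsto (fun t => 1 / 3 * Real.sqrt t) atTop atTop :=
    Real.tendsto_sqrt_atTop.const_mul_atTop (by norm_num)
  refine (h2.atTop_add (h1.tendsto_zero (by norm_num))).congr' ?_
  filter_upwards [isWKB_scBi.ne_zero] with t ht
  unfold wkbLog
  field_simp
  ring

/-- The asymptotics of Φ₀₁ make q equal to 2 t^{3/2} (1 + o(1)), and α = -(3/2) q x'/x with x'/x →
+∞. -/
lemma classB_limits (hu : IsHastingsMcLeod u) (h : Represents u ξ₁ ξ₂ W q α)
    (h1 : Tendsto ξ₁ atTop (𝓝 1)) (h2 : Tendsto ξ₂ atTop (𝓝 c₂)) (h3 : Tendsto W atTop (𝓝 0)) :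
    Tendsto q atTop atTop ∧ Tendsto α atTop atBot := by
  have hab : OG (fun t => scAi t / scBi t) 0 2 :=
    isWKB_scAi.isOG.div isWKB_scBi.isOG_inv _ _ (by norm_num)
  have hXb : Tendsto (fun t => LinSol.X ξ₁ ξ₂ t / scBi t) atTop (𝓝 1) := by
    have := h1.add (h2.mul (hab.tendsto_zero (by norm_num)))
    rw [mul_zero, add_zero] at this
    refine this.congr' ?_
    filter_upwards [isWKB_scBi.ne_zero] with t ht
    rw [LinSol.X]
    field_simp
  have hPb : Tendsto (fun t => LinSol.P ξ₁ ξ₂ t / scBi t) atTop atTop := by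
    have e1 : OG (fun t => dscAi t / scBi t) 1 2 :=
      isWKB_scAi.isOG_deriv.div isWKB_scBi.isOG_inv _ _ (by norm_num)
    have e2 := h2.mul (e1.tendsto_zero (by norm_num))
    refine ((h1.pos_mul_atTop one_pos tendsto_dscBi_div).atTop_add e2).congr' ?_
    filter_upwards [isWKB_scBi.ne_zero] with t ht
    rw [LinSol.P]
    field_simp
  have hW := h.linSol.tendsto_W_div_Phi01 hu h1 h2 h3
  have hΦ := (Phi01_inv hu).2
  have hg : Tendsto (fun t => 2 * (LinSol.X ξ₁ ξ₂ t / scBi t *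
      ((Phi01 u t / (1 / 2 * (t ^ (-(3 / 2) : ℝ) * (u t * scBi t))))⁻¹ * (W t / Phi01 u t)⁻¹)))
      atTop (𝓝 (2 * (1 * ((1 : ℝ)⁻¹ * (1 : ℝ)⁻¹)))) :=
    (hXb.mul ((hΦ.inv₀ one_ne_zero).mul (hW.inv₀ one_ne_zero))).const_mul 2
  have hq : Tendsto q atTop atTop := by
    refine ((tendsto_rpow_atTop (y := 3 / 2) (by norm_num)).atTop_mul_pos (by norm_num)
      hg).congr' ?_
    filter_upwards [h.q_eq, h.ne_zero, LinSol.Phi01_ne_zero hu, isWKB_scBi.ne_zero, hu.pos,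
      eventually_gt_atTop 0] with t q1 q2 q3 q4 q5 q6
    rw [← q1, Real.rpow_neg q6.le]
    have : 0 < t ^ (3 / 2 : ℝ) := by positivity
    field_simp
  refine ⟨hq, ?_⟩
  have hα : Tendsto (fun t => q t * (LinSol.P ξ₁ ξ₂ t / scBi t *
      (LinSol.X ξ₁ ξ₂ t / scBi t)⁻¹)) atTop atTop :=
    hq.atTop_mul_atTop₀ (hPb.atTop_mul_pos (by norm_num) (hXb.inv₀ one_ne_zero))
  refine (hα.const_mul_atTop_of_neg (show (-(3 / 2) : ℝ) < 0 by norm_num)).congr' ?_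
  filter_upwards [h.q_eq, h.α_eq, h.ne_zero, isWKB_scBi.ne_zero,
    hXb.eventually_ne one_ne_zero] with t q1 q2 q3 q4 q5
  have q6 : LinSol.X ξ₁ ξ₂ t ≠ 0 := by
    intro h0
    rw [h0, zero_div] at q5
    exact q5 rfl
  rw [← q1, ← q2]
  field_simp

/-! ### Class C -/

/-- Now W ≈ (1/2) u Ai(t̂) and x ≈ Ai(t̂), so q → 2; as Ai(t̂)' ≈ -(1/3) √t Ai(t̂), also α ≈ √t,
with error O(1/t). -/
lemma classC (hu : IsHastingsMcLeod u) (h : Represents u ξ₁ ξ₂ W q α)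
    (h1 : Tendsto ξ₁ atTop (𝓝 0)) (h2 : Tendsto ξ₂ atTop (𝓝 1)) (h3 : Tendsto W atTop (𝓝 0)) :
    ClassC q α := by
  have hU := hu.isWKB.isOG
  obtain ⟨e1, e2⟩ := h.linSol.isOG_sub_of_tendsto_zero hu h1 h2 h3
  have e3 := h.linSol.isOG_W_sub_of_tendsto_zero hu h1 h2 h3
  simp only [sub_zero] at e1
  have hWa : OG (fun t => W t - 1 / 2 * (u t * scAi t)) (-2) 4 :=
    ((e3.weaken _ _ (by norm_num)).add (Phi02_isOG_sub hu)).congr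
      (Eventually.of_forall fun t => by ring)
  have hua := hU.mul isWKB_scAi.isOG (-(1 / 2)) 4 (by norm_num)
  have hWi : OG (fun t => (W t)⁻¹) (1 / 2) (-4) := by
    refine (OG.inv_of_sub (g := fun t => 1 / 2 * (u t * scAi t)) ?_ hWa (by norm_num) ?_).1
    · refine ((hu.isWKB.isOG_inv.mul isWKB_scAi.isOG_inv (1 / 2) (-4) (by norm_num)).const_mul
        2).congr (Eventually.of_forall fun t => ?_)
      simp only [mul_inv, inv_inv, one_div]
    · filter_upwards [hu.pos, isWKB_scAi.pos] with t q1 q2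
      positivity
  have hX : OG (fun t => ξ₁ t * scBi t + (ξ₂ t - 1) * scAi t) (-(1 / 4) + -(3 / 2)) 5 :=
    OG.comb isWKB_scBi.isOG isWKB_scAi.isOG e1 e2 _ (by norm_num) (by norm_num)
  have hP : OG (fun t => ξ₁ t * dscBi t + (ξ₂ t - 1) * dscAi t) (1 / 4 + -(3 / 2)) 5 :=
    OG.comb isWKB_scBi.isOG_deriv isWKB_scAi.isOG_deriv e1 e2 _ (by norm_num) (by norm_num)
  have hq : OG (fun t => q t - 2) (-(3 / 2)) 0 := by
    refine (((hU.mul hX (-2) 4 (by norm_num)).sub (hWa.const_mul 2)).div hWi (-(3 / 2)) 0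
      (by norm_num)).congr ?_
    filter_upwards [h.q_eq, h.ne_zero] with t q1 q2
    rw [← q1, LinSol.X]
    field_simp
    ring
  have hα : OG (fun t => α t - Real.sqrt t) (-1) 0 := by
    have n1 := (hU.mul hP (-(3 / 2)) 4 (by norm_num)).const_mul (-(3 / 2))
    have n2 := (hU.mul isWKB_scAi.isOG_log_deriv (-(3 / 2)) 4 (by norm_num)).const_mul (-(3 / 2))
    have n3 := (OG_inv_id.mul hua (-(3 / 2)) 4 (by norm_num)).const_mul (3 / 8)
    have n4 := OG_sqrt.mul hWa (-(3 / 2)) 4 (by norm_num)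
    refine ((((n1.add n2).add n3).sub n4).div hWi (-1) 0 (by norm_num)).congr ?_
    filter_upwards [h.α_eq, h.ne_zero, eventually_gt_atTop 0] with t q1 q2 q3
    rw [← q1, LinSol.P, wkbLog]
    field_simp
    ring
  have hα0 := hα.tendsto_zero (by norm_num)
  refine ⟨?_, ?_, hα0⟩
  · have := (hq.tendsto_zero (by norm_num)).add_const 2
    simpa using this
  · refine (hα0.isBigO_one ℝ).trans_isLittleO ?_
    refine (isLittleO_const_left_of_ne one_ne_zero).2 ?_
    exact tendsto_norm_atTop_atTop.comp Real.tendsto_sqrt_atTop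

end Represents

/-! ### Uniqueness of the class A parameters and size of the quadratic terms -/

/-- The expansion of q alone suffices. Dividing the difference by Ai(t) Bi(t̂) isolates c₁ - d₁; the
quadratic terms then agree, and dividing by Ai(t) Ai(t̂), of rate 4 against the error rate 6,
isolates c₂ - d₂. -/
lemma ExpansionA.unique {q α : ℝ → ℝ} {c₁ c₂ d₁ d₂ : ℝ} (h : ExpansionA c₁ c₂ q α)
    (h' : ExpansionA d₁ d₂ q α) : c₁ = d₁ ∧ c₂ = d₂ := by
  have hexp : (fun t : ℝ => Real.exp (-(4 / 3) * t ^ (3 / 2 : ℝ))) = expScale 0 6 := by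
    rw [expScale_zero_left]; norm_num
  have hd : OG (fun t => airyAi t * ((c₁ - d₁) * scBi t + (c₂ - d₂) * scAi t -
      (c₁ ^ 2 - d₁ ^ 2) * (scBi t * airyMixedInt t))) 0 6 := by
    have h1 := h.1
    have h2 := h'.1
    rw [hexp] at h1 h2
    refine OG.congr (h2.isBigO.sub h1.isBigO) (Eventually.of_forall fun t => ?_)
    simp only [tildeM]; ring
  have hA := hd.div isWKB_airyAi.isOG_inv (1 / 4) 3 (by norm_num)
  have hc : c₁ = d₁ := by
    have k1 := (hA.div isWKB_scBi.isOG_inv (1 / 2) 4 (by norm_num)).tendsto_zero (by norm_num)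
    have hab : OG (fun t => scAi t / scBi t) 0 2 :=
      isWKB_scAi.isOG.div isWKB_scBi.isOG_inv _ _ (by norm_num)
    have k2 := (((hab.tendsto_zero (by norm_num)).const_mul (c₂ - d₂)).sub
      ((airyMixedInt_spec.2.tendsto_zero (by norm_num)).const_mul (c₁ ^ 2 - d₁ ^ 2))).const_add
        (c₁ - d₁)
    simp only [mul_zero, sub_zero, add_zero] at k2
    refine sub_eq_zero.1 (tendsto_nhds_unique (k2.congr' ?_) k1)
    filter_upwards [isWKB_airyAi.ne_zero, isWKB_scBi.ne_zero] with t q1 q2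
    field_simp
    ring
  refine ⟨hc, ?_⟩
  have k1 := (hA.div isWKB_scAi.isOG_inv (1 / 2) 2 (by norm_num)).tendsto_zero (by norm_num)
  refine sub_eq_zero.1 (tendsto_nhds_unique (tendsto_const_nhds.congr' ?_) k1)
  filter_upwards [isWKB_airyAi.ne_zero, isWKB_scAi.ne_zero] with t q1 q2
  rw [hc]
  field_simp
  ring

lemma ExpansionA.tendsto {q α : ℝ → ℝ} {c₁ c₂ : ℝ} (h : ExpansionA c₁ c₂ q α) :
    Tendsto q atTop (𝓝 0) ∧ Tendsto α atTop (𝓝 0) := by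
  have hexp : (fun t : ℝ => Real.exp (-(4 / 3) * t ^ (3 / 2 : ℝ))) = expScale 0 6 := by
    rw [expScale_zero_left]; norm_num
  obtain ⟨h1, h2⟩ := h
  rw [hexp] at h1 h2
  have key : ∀ {b a : ℝ → ℝ} {k : ℝ}, OG b k (-1) → OG a k 1 →
      OG (fun t => airyAi t * (c₁ * b t + c₂ * a t - c₁ ^ 2 * (b t * airyMixedInt t))) k 1 := by
    intro b a k hb ha
    have e := ((hb.const_mul c₁).add ((ha.const_mul c₂).weaken k (-1) (by norm_num))).sub
      ((hb.mul airyMixedInt_spec.2 k (-1) (Or.inl (by norm_num))).const_mul (c₁ ^ 2))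
    exact isWKB_airyAi.isOG.mul e k 1 (Or.inl (by norm_num))
  have k1 := key isWKB_scBi.isOG isWKB_scAi.isOG
  have k2 := (key isWKB_scBi.isOG_deriv isWKB_scAi.isOG_deriv).const_mul (-(3 / 2))
  have e1 := (k1.weaken (1 / 4) 1 (by norm_num)).add
    (OG.weaken h1.isBigO (1 / 4) 1 (by norm_num))
  have e2 := k2.add (OG.weaken h2.isBigO (1 / 4) 1 (by norm_num))
  constructor
  · refine (e1.congr (Eventually.of_forall fun t => ?_)).tendsto_zero (by norm_num)
    rw [tildeM]; ring
  · refine (e2.congr (Eventually.of_forall fun t => ?_)).tendsto_zero (by norm_num)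
    rw [tildeN, scAi'_eq_mul, scBi'_eq_mul]
    linear_combination (1 / 2 * airyAi t * (c₁ * dscBi t + c₂ * dscAi t -
      c₁ ^ 2 * (dscBi t * airyMixedInt t))) * three_rpow_mul_airyScaling

/-- Both functions have rate 1; the gain is only the t^{-1/2} from the integral J. -/
lemma tildeM_isLittleO : tildeM =o[atTop] scAi := by
  have h1 : OG (fun t => tildeM t / scAi t) (-(1 / 2)) 0 := by
    refine (((isWKB_scBi.isOG.mul airyMixedInt_spec.2 (-(3 / 4)) 1 (by norm_num)).const_mul
      (-1)).div isWKB_scAi.isOG_inv _ _ (by norm_num)).congr (Eventually.of_forall fun t => ?_)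
    rw [tildeM]; ring
  refine (isLittleO_iff_tendsto' ?_).2 (h1.tendsto_zero (by norm_num))
  filter_upwards [isWKB_scAi.ne_zero] with t h2 h3
  exact absurd h3 h2

/-- A lower bound on the derivative of Ai(t̂), which is -(1/3) √t Ai(t̂) to leading order. -/
lemma isOG_inv_dscAi :
    OG (fun t => (dscAi t)⁻¹) (-(1 / 4)) (-1) ∧ ∀ᶠ t in atTop, dscAi t ≠ 0 := by
  have h0 : OG (fun t => (-(1 / 3) * (Real.sqrt t * scAi t))⁻¹) (-(1 / 4)) (-1) := by
    have h1 : OG (fun t => (Real.sqrt t)⁻¹) (-(1 / 2)) 0 := by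
      refine (OG.rpow (-(1 / 2))).congr ?_
      filter_upwards [eventually_ge_atTop 0] with t ht
      rw [Real.rpow_neg ht, Real.sqrt_eq_rpow]
    refine ((h1.mul isWKB_scAi.isOG_inv (-(1 / 4)) (-1) (by norm_num)).const_mul (-3)).congr
      (Eventually.of_forall fun t => ?_)
    simp only [mul_inv, one_div, inv_neg, inv_inv]
  have key := OG.inv_of_sub (f := dscAi) (k := -(5 / 4)) (m := 1) h0 ?_ (by norm_num) ?_
  · refine ⟨key.1, (key.2.eventually_ne one_ne_zero).mono fun t ht h1 => ?_⟩
    rw [h1, zero_div] at ht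
    exact ht rfl
  · have h1 := isWKB_scAi.isOG_log_deriv.weaken (-(5 / 4)) 1 (by norm_num)
    have h2 := (OG_inv_id.mul isWKB_scAi.isOG (-(5 / 4)) 1 (by norm_num)).const_mul (1 / 4)
    refine (h1.sub h2).congr ?_
    filter_upwards [eventually_gt_atTop 0] with t ht
    rw [wkbLog]
    field_simp
    ring
  · filter_upwards [isWKB_scAi.ne_zero, eventually_gt_atTop 0] with t h1 h2
    have := Real.sqrt_pos.2 h2
    positivity

lemma tildeN_isLittleO : tildeN =o[atTop] scAi' := by
  have h1 : OG (fun t => tildeN t / scAi' t) (-(1 / 2)) 0 := by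
    refine (((isWKB_scBi.isOG_deriv.mul airyMixedInt_spec.2 (-(1 / 4)) 1 (by norm_num)).const_mul
      (-1)).div isOG_inv_dscAi.1 _ _ (by norm_num)).congr (Eventually.of_forall fun t => ?_)
    rw [tildeN, scAi'_eq_mul, scBi'_eq_mul]
    have := airyScaling_pos
    rw [show -(airyScaling * dscBi t) * airyMixedInt t =
      airyScaling * (-1 * (dscBi t * airyMixedInt t)) by ring, mul_div_mul_left _ _ this.ne']
  refine (isLittleO_iff_tendsto' ?_).2 (h1.tendsto_zero (by norm_num))
  filter_upwards [isOG_inv_dscAi.2] with t h3 h4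
  rw [scAi'_eq_mul] at h4
  exact absurd h4 (mul_ne_zero airyScaling_pos.ne' h3)

/-! ### Assembly of the classification -/

lemma SolvesSystem.shifted {u q₂ α : ℝ → ℝ} (h : SolvesSystem u q₂ α) :
    SolvesShiftedSystem u (fun t => 1 + q₂ t) α := by
  filter_upwards [h] with t ht
  exact ⟨(ht.1.const_add 1).congr_deriv (by ring), ht.2.congr_deriv (by ring)⟩

lemma SolvesShiftedSystem.unshifted {u q α : ℝ → ℝ} (h : SolvesShiftedSystem u q α) :
    SolvesSystem u (fun t => q t - 1) α := by
  filter_upwards [h] with t ht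
  exact ⟨(ht.1.sub_const 1).congr_deriv (by ring), ht.2.congr_deriv (by ring)⟩

/-- The three kinds of solutions, normalised. -/
lemma SolvesShiftedSystem.trichotomy {u q α : ℝ → ℝ} (hu : IsHastingsMcLeod u)
    (h : SolvesShiftedSystem u q α) :
    (∃ ξ₁ ξ₂ W c₁ c₂, Represents u ξ₁ ξ₂ W q α ∧ Tendsto ξ₁ atTop (𝓝 c₁) ∧
      Tendsto ξ₂ atTop (𝓝 c₂) ∧ Tendsto W atTop (𝓝 1)) ∨ ClassB u q α ∨ ClassC q α := by
  obtain ⟨ξ₁, ξ₂, W, hr⟩ := Represents.exists_of_solvesShifted hu h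
  obtain ⟨c₁, c₂, c₀, h1, h2, h3⟩ := hr.linSol.exists_tendsto hu
  have nrm : ∀ {f : ℝ → ℝ} {c : ℝ}, Tendsto f atTop (𝓝 c) → c ≠ 0 →
      Tendsto (fun t => c⁻¹ * f t) atTop (𝓝 1) := by
    intro f c hf hc
    have := hf.const_mul c⁻¹
    rwa [inv_mul_cancel₀ hc] at this
  have nul : ∀ {f : ℝ → ℝ} (c : ℝ), Tendsto f atTop (𝓝 0) →
      Tendsto (fun t => c⁻¹ * f t) atTop (𝓝 0) := by
    intro f c hf
    simpa using hf.const_mul c⁻¹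
  by_cases hc0 : c₀ = 0
  · right
    rw [hc0] at h3
    by_cases hc1 : c₁ = 0
    · right
      rw [hc1] at h1
      -- If all three limits vanished, the solution of the linear system would be eventually zero,
      -- and with it W.
      have hc2 : c₂ ≠ 0 := by
        intro hc2
        rw [hc2] at h2
        have h0 := ((linSol_iff.1 hr.linSol).eventually_eq_zero two_pos (isOG_linCoeff hu)
          fun i => by
            fin_cases i
            exacts [h1, h2, h3])
        obtain ⟨t, ht, ht'⟩ := (h0.and hr.ne_zero).exists
        exact ht' (ht 2)
      exact (hr.const_mul (inv_ne_zero hc2)).classC hu (nul _ h1) (nrm h2 hc2) (nul _ h3)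
    · left
      have hr' := hr.const_mul (inv_ne_zero hc1)
      obtain ⟨l1, l2⟩ := hr'.classB_limits hu (nrm h1 hc1) (h2.const_mul _) (nul _ h3)
      exact ⟨l1, l2, _, hr'.expansionB hu (nrm h1 hc1) (h2.const_mul _) (nul _ h3)⟩
  · left
    exact ⟨_, _, _, _, _, hr.const_mul (inv_ne_zero hc0), h1.const_mul _, h2.const_mul _,
      nrm h3 hc0⟩

lemma SolvesShiftedSystem.exists_represents {u q α : ℝ → ℝ} (hu : IsHastingsMcLeod u)
    (h : SolvesShiftedSystem u q α) (hq : Tendsto q atTop (𝓝 0)) :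
    ∃ ξ₁ ξ₂ W c₁ c₂, Represents u ξ₁ ξ₂ W q α ∧ Tendsto ξ₁ atTop (𝓝 c₁) ∧
      Tendsto ξ₂ atTop (𝓝 c₂) ∧ Tendsto W atTop (𝓝 1) := by
  rcases h.trichotomy hu with h | h | h
  · exact h
  · exact absurd hq (not_tendsto_nhds_of_tendsto_atTop h.1 0)
  · exact absurd (tendsto_nhds_unique h.1 hq) two_ne_zero

theorem mainTheorem5 (u : ℝ → ℝ) (hu : IsHastingsMcLeod u) :
    -- classification of the solutions of the shifted system
    (∀ q α : ℝ → ℝ, SolvesShiftedSystem u q α →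
      ClassA q α ∨ ClassB u q α ∨ ClassC q α) ∧
    -- the quadratic terms of Class A are lower order
    (tildeM =o[atTop] scAi ∧ tildeN =o[atTop] scAi') ∧
    -- solutions with `q₂ → -1`, `α → 0` are of Class A, with unique parameters
    (∀ q₂ α : ℝ → ℝ, SolvesSystem u q₂ α →
      Tendsto q₂ atTop (𝓝 (-1)) → Tendsto α atTop (𝓝 0) →
      ClassA (fun t => 1 + q₂ t) α ∧
      (∃! c : ℝ × ℝ, ExpansionA c.1 c.2 (fun t => 1 + q₂ t) α) ∧
      (ExpansionA 0 0 (fun t => 1 + q₂ t) α → LeadingZero (fun t => 1 + q₂ t) α)) ∧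
    -- every pair of parameters occurs
    (∀ c₁ c₂ : ℝ, ∃ q₂ α : ℝ → ℝ, SolvesSystem u q₂ α ∧
      Tendsto q₂ atTop (𝓝 (-1)) ∧ Tendsto α atTop (𝓝 0) ∧
      ExpansionA c₁ c₂ (fun t => 1 + q₂ t) α) ∧
    -- and determines the solution near `+∞`
    (∀ (c₁ c₂ : ℝ) (q₂ α p₂ β : ℝ → ℝ), SolvesSystem u q₂ α → SolvesSystem u p₂ β →
      ExpansionA c₁ c₂ (fun t => 1 + q₂ t) α → ExpansionA c₁ c₂ (fun t => 1 + p₂ t) β →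
      q₂ =ᶠ[atTop] p₂ ∧ α =ᶠ[atTop] β) := by
  refine ⟨?_, ⟨tildeM_isLittleO, tildeN_isLittleO⟩, ?_, ?_, ?_⟩
  · intro q α h
    rcases h.trichotomy hu with ⟨ξ₁, ξ₂, W, c₁, c₂, hr, h1, h2, h3⟩ | h | h
    · obtain ⟨l1, l2⟩ := hr.classA_limits hu h1 h2 h3
      exact Or.inl ⟨l1, l2, c₁, c₂, hr.expansionA hu h1 h2 h3⟩
    · exact Or.inr (Or.inl h)
    · exact Or.inr (Or.inr h)
  · intro q₂ α h hq _
    have hq' : Tendsto (fun t => 1 + q₂ t) atTop (𝓝 0) := by simpa using hq.const_add 1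
    obtain ⟨ξ₁, ξ₂, W, c₁, c₂, hr, h1, h2, h3⟩ := h.shifted.exists_represents hu hq'
    obtain ⟨l1, l2⟩ := hr.classA_limits hu h1 h2 h3
    have hE := hr.expansionA hu h1 h2 h3
    refine ⟨⟨l1, l2, c₁, c₂, hE⟩, ⟨(c₁, c₂), hE, ?_⟩, ?_⟩
    · rintro ⟨d₁, d₂⟩ hd
      obtain ⟨e1, e2⟩ := hd.unique hE
      exact Prod.ext e1 e2
    · intro h0
      obtain ⟨e1, e2⟩ := hE.unique h0
      rw [e1] at h1
      rw [e2] at h2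
      exact hr.leadingZero hu h1 h2 h3
  · intro c₁ c₂
    -- The normalisation c₀ = 1 makes the prescribed limits of ξ₁, ξ₂ the parameters of the
    -- expansion.
    obtain ⟨ξ₁, ξ₂, W, hl, h1, h2, h3⟩ := LinSol.exists_of_limit hu c₁ c₂ 1
    have hW := h3.eventually_ne one_ne_zero
    have hr : Represents u ξ₁ ξ₂ W (fun t => u t * LinSol.X ξ₁ ξ₂ t / W t)
        (fun t => -(3 / 2) * (u t * LinSol.P ξ₁ ξ₂ t / W t)) :=
      ⟨hl, hW, Eventually.of_forall fun _ => rfl, Eventually.of_forall fun _ => rfl⟩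
    obtain ⟨l1, l2⟩ := hr.classA_limits hu h1 h2 h3
    have hE := hr.expansionA hu h1 h2 h3
    refine ⟨_, _, (hl.solvesShifted hu hW).unshifted, by simpa using l1.sub_const 1, l2, ?_⟩
    simpa only [add_sub_cancel] using hE
  · intro c₁ c₂ q₂ α p₂ β hq hp hEq hEp
    obtain ⟨ξ₁, ξ₂, W, a₁, a₂, hr, h1, h2, h3⟩ :=
      hq.shifted.exists_represents hu hEq.tendsto.1
    obtain ⟨ζ₁, ζ₂, V, b₁, b₂, hs, k1, k2, k3⟩ :=
      hp.shifted.exists_represents hu hEp.tendsto.1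
    obtain ⟨rfl, rfl⟩ := (hr.expansionA hu h1 h2 h3).unique hEq
    obtain ⟨rfl, rfl⟩ := (hs.expansionA hu k1 k2 k3).unique hEp
    have he := hr.linSol.eventually_eq hu hs.linSol h1 h2 h3 k1 k2 k3
    constructor
    · filter_upwards [he, hr.q_eq, hs.q_eq] with t ⟨r1, r2, r3⟩ r4 r5
      rw [LinSol.X, r1, r2, r3] at r4
      rw [LinSol.X, r4] at r5
      linarith
    · filter_upwards [he, hr.α_eq, hs.α_eq] with t ⟨r1, r2, r3⟩ r4 r5
      rw [LinSol.P, r1, r2, r3] at r4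
      rw [LinSol.P, r4] at r5
      exact r5

end
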